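/- All graphs are finite and undirected. A graph $H$ is a minor of $G$ if (up to isomorphism) it can be obtained from $G$ by a sequence of edge deletions and edge contractions (loops and parallel edges being suppressed). A family of graphs is minor-closed if it contains every minor of each of its members, and nontrivial if it omits at least one graph with at least one vertex. For a connected graph $G=(V,E)$ with nonnegative edge weights, let $\mathrm{dist}(u,v)$ be the length of a shortest $u$-to-$v$ path. For a set of clients $C\subseteq V$ with $n=|C|$ and an integer $p>0$, the cost of a nonempty set $S\subseteq V$ of centers is $$\mathrm{cost}(S)=\sum_{c\in C}\Big(\min_{u\in S}\mathrm{dist}(c,u)\Big)^p .$$ Local search with parameters $\varepsilon>0$ and integers $k\ge 1$, $s$ is the following (nondeterministic) algorithm: start with an arbitrary set $S\subseteq V$ with $|S|=k$; as long as there is a nonempty $S'\subseteq V$ with $|S'|\le k$, $|S\setminus S'|+|S'\setminus S|\le s$, $\mathrm{cost}(S')\le(1-\varepsilon/n)\,\mathrm{cost}(S)$ and $\mathrm{cost}(S')<\mathrm{cost}(S)$, replace $S$ by such an $S'$; when there is none, output $S$. (The strict inequality follows from the preceding one if $\mathrm{cost}(S)>0$; it makes the search stop at cost $0$.) **Theorem.**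 Let $\mathcal K$ be a nontrivial minor-closed family of graphs, and let $p>0$ be an integer. There is a constant $c\in\mathbb N$, depending only on $\mathcal K$ and $p$, such that for every $0<\varepsilon<1/2$, every connected graph $G\in\mathcal K$, every assignment of nonnegative weights to the edges of $G$, every set $C$ of vertices and every integer $k\ge1$: local search with $s=\lfloor 1/\varepsilon^{c}\rfloor$ always terminates, and every set $S$ that it can output is nonempty, has at most $k$ elements and satisfies $$\mathrm{cost}(S)\le(1+\varepsilon)\,\mathrm{cost}(T)\quad\text{for every nonempty } T\subseteq V \text{ with } |T|\le k .$$ The case $p=1$ is $k$-median and the case $p=2$ is $k$-means. -/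

import Mathlib

universe u

noncomputable section

/-- A family of graphs, given as a property of (simple, undirected) graphs. -/
abbrev GraphFamily := ∀ V : Type u, SimpleGraph V → Prop

/-- Contraction of the edge `uv`: the endpoint `v` is identified with `u`, and the resulting
loops and parallel edges are suppressed. -/
def contractEdge {V : Type u} (G : SimpleGraph V) (u v : V) : SimpleGraph {x : V // x ≠ v} where
  Adj a b := a ≠ b ∧
    (G.Adj a b ∨ ((a : V) = u ∧ G.Adj v b) ∨ ((b : V) = u ∧ G.Adj a v))
  symm := ⟨fun a b h => by
    obtain ⟨hne, h⟩ := h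
    refine ⟨hne.symm, ?_⟩
    rcases h with h | ⟨h, h'⟩ | ⟨h, h'⟩
    · exact Or.inl h.symm
    · exact Or.inr (Or.inr ⟨h, h'.symm⟩)
    · exact Or.inr (Or.inl ⟨h, h'.symm⟩)⟩
  loopless := ⟨fun _ h => h.1 rfl⟩

/-- `IsMinorOf G H`: up to isomorphism, the graph `H` is obtained from `G` by a finite sequence of
edge deletions and edge contractions. (Deletion of vertices is not among the operations, so a
family that is also closed under vertex deletion is in particular closed under these.) -/
inductive IsMinorOf {V : Type u} (G : SimpleGraph V) : ∀ {W : Type u}, SimpleGraph W → Prop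
  | refl : IsMinorOf G G
  | iso {W W' : Type u} {H : SimpleGraph W} {H' : SimpleGraph W'} :
      IsMinorOf G H → (H ≃g H') → IsMinorOf G H'
  | deleteEdge {W : Type u} {H : SimpleGraph W} (e : Sym2 W) :
      IsMinorOf G H → IsMinorOf G (H.deleteEdges {e})
  | contract {W : Type u} {H : SimpleGraph W} {a b : W} :
      IsMinorOf G H → H.Adj a b → IsMinorOf G (contractEdge H a b)

/-- Every minor of a finite graph of the family belongs to the family. -/
def MinorClosed (K : GraphFamily.{u}) : Prop :=
  ∀ (V W : Type u) [Finite V] (G : SimpleGraph V) (H : SimpleGraph W),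
    K V G → IsMinorOf G H → K W H

/-- The family omits at least one finite graph with at least one vertex. -/
def NontrivialFamily (K : GraphFamily.{u}) : Prop :=
  ∃ (W : Type u) (_ : Finite W) (_ : Nonempty W) (H : SimpleGraph W), ¬ K W H

/-- Length of a walk with respect to edge weights `w`. -/
def walkLength {V : Type u} {G : SimpleGraph V} (w : Sym2 V → ℝ) {a b : V} (q : G.Walk a b) : ℝ :=
  (q.edges.map w).sum

/-- Shortest-path distance: the length of the shortest `a`-to-`b` path (for a connected finite
graph, the infimum is a minimum over a finite nonempty set). -/
def shortestPathDist {V : Type u} (G : SimpleGraph V) (w : Sym2 V → ℝ) (a b : V) : ℝ :=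
  ⨅ q : G.Path a b, walkLength w (q : G.Walk a b)

/-- `cost(S) = ∑_{c ∈ C} (min_{x ∈ S} d(c, x)) ^ p`; it is used only for nonempty `S`. -/
def clusterCost {X : Type u} (d : X → X → ℝ) (p : ℕ) (C S : Finset X) : ℝ :=
  ∑ c ∈ C, (⨅ x : {x // x ∈ S}, d c x) ^ p

/-- A solution of the clustering problem: a nonempty set of at most `k` centers. -/
def IsSolution {X : Type u} (k : ℕ) (S : Finset X) : Prop :=
  S.Nonempty ∧ S.card ≤ k

/-- One iteration `S ← S'` of local search. The condition `decrease` follows from `improve` as soon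
as `cost S > 0`; it makes the search stop at a solution of cost `0`. -/
structure LocalSearchStep {X : Type u} [DecidableEq X] (cost : Finset X → ℝ)
    (n k s : ℕ) (ε : ℝ) (S S' : Finset X) : Prop where
  solution : IsSolution k S'
  near : (S \ S').card + (S' \ S).card ≤ s
  improve : cost S' ≤ (1 - ε / n) * cost S
  decrease : cost S' < cost S

/-- `S` is a possible output of local search: it is reached by finitely many iterations from some
initial `k`-element set, and no further iteration is possible. -/
def IsLocalSearchOutput {X : Type u} [DecidableEq X] (cost : Finset X → ℝ)
    (n k s : ℕ) (ε : ℝ) (S : Finset X) : Prop :=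
  (∃ S₀ : Finset X, S₀.card = k ∧
      Relation.ReflTransGen (LocalSearchStep cost n k s ε) S₀ S) ∧
    ∀ S' : Finset X, ¬ LocalSearchStep cost n k s ε S S'

/-- Local search terminates: it has no infinite run from an initial `k`-element set. -/
def LocalSearchTerminates {X : Type u} [DecidableEq X] (cost : Finset X → ℝ)
    (n k s : ℕ) (ε : ℝ) : Prop :=
  ¬ ∃ run : ℕ → Finset X, (run 0).card = k ∧
      ∀ i : ℕ, LocalSearchStep cost n k s ε (run i) (run (i + 1))

end

/-! Local optimality of `L` is applied to two families of exchanges, and adding the inequalities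
compares cost(`L`) with cost(`T`) for an arbitrary solution `T`. Each exchange may lose
ε·cost(`L`)/n, so the number of exchanges must be a small fraction of n. Bundling at least 128
elementary exchanges into one keeps the total loss below ε·cost(`L`)/16 when n ≥ 32; for smaller n,
`T` itself is a single exchange away.

Given a second solution `M`, contract the Voronoi cells of F = `L` Δ `M`. The cells are connected,
so the contracted graph still excludes a clique model and has balanced separators of size
O(n^(3/4)). Recursive separation divides F into regions of bounded size with total overlap at most
δ|F| (`exists_division`). An exchange replaces, inside some regions, `L` by `M` together with all
vertices shared between regions. A path crossing the border of a region visits the cell of a shared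
vertex, which from there is no farther than the end of the path. Hence clients of exchanged regions
pay at most their price under `M`, and all others at most their price under `L`
(`exists_exchangeSystem`).

The shared vertices use up extra centers, so `M` must have a constant fraction of |F| fewer centers
than `L`; `T` itself will not do. Centers x of `T` and y of `L` form a pair if all but an η-fraction
of the clients of either belong to the other. `M` contains y in place of a paired x, so pairs do not
count in F. An unpaired center of `T` either dominates two centers of `L`, which is rare by
counting, or is removable, and averaging shows that a κ-fraction of the removable ones can be closed
cheaply (`exists_removal`, `exists_intermediate`).

The regional exchanges with this `M` settle all clients except those whose two centers are both
paired. For these, groups of partners are exchanged for the paired centers of `T`; only an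
η-fraction of the clients concerned has to be rerouted (`sum_pairedClients_le`, `sum_reroute_le`).
All parameters are polynomial in 1/ε with exponents depending on p and the excluded clique only
(`exists_parameters`). -/

/-! ### Clique models and minors -/

/-- Any two vertices of `B` are joined by a walk inside `B`. -/
def ConnOn {V : Type u} (G : SimpleGraph V) (B : Set V) : Prop :=
  ∀ x ∈ B, ∀ y ∈ B, Relation.ReflTransGen (fun a b => G.Adj a b ∧ a ∈ B ∧ b ∈ B) x y

/-- A model of the complete graph on `ι`: disjoint, nonempty, connected, pairwise adjacent branch
sets. -/
structure CliqueModel {V : Type u} {ι : Type*} (G : SimpleGraph V) (B : ι → Set V) : Prop where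
  nonempty : ∀ i, (B i).Nonempty
  conn : ∀ i, ConnOn G (B i)
  disj : ∀ i j, i ≠ j → Disjoint (B i) (B j)
  adj : ∀ i j, i ≠ j → ∃ x ∈ B i, ∃ y ∈ B j, G.Adj x y

lemma ConnOn.singleton {V : Type u} (G : SimpleGraph V) (v : V) : ConnOn G {v} := by
  rintro x rfl y rfl
  exact Relation.ReflTransGen.refl

/-- Union of connected sets through a common vertex. -/
lemma ConnOn.of_root {V : Type u} {G : SimpleGraph V} {B : Set V} (v : V)
    (h : ∀ x ∈ B, Relation.ReflTransGen (fun a b => G.Adj a b ∧ a ∈ B ∧ b ∈ B) x v) :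
    ConnOn G B := by
  intro x hx y hy
  refine (h x hx).trans ?_
  have : Std.Symm (fun a b => G.Adj a b ∧ a ∈ B ∧ b ∈ B) :=
    ⟨fun a b hab => ⟨hab.1.symm, hab.2.2, hab.2.1⟩⟩
  exact (Relation.ReflTransGen.stdSymm (r := fun a b => G.Adj a b ∧ a ∈ B ∧ b ∈ B)).symm _ _
    (h y hy)

lemma ConnOn.mono_rel {V : Type u} {G : SimpleGraph V} {B B' : Set V} (hB : B ⊆ B') {x y : V}
    (h : Relation.ReflTransGen (fun a b => G.Adj a b ∧ a ∈ B ∧ b ∈ B) x y) :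
    Relation.ReflTransGen (fun a b => G.Adj a b ∧ a ∈ B' ∧ b ∈ B') x y :=
  Relation.ReflTransGen.mono (fun _ _ h => ⟨h.1, hB h.2.1, hB h.2.2⟩) _ _ h

lemma ConnOn.biUnion {V : Type u} {ι : Type*} {G : SimpleGraph V} {I : Set ι} {B : ι → Set V}
    (v : V) (hv : ∀ i ∈ I, v ∈ B i) (h : ∀ i ∈ I, ConnOn G (B i)) :
    ConnOn G (⋃ i ∈ I, B i) := by
  refine ConnOn.of_root v fun x hx => ?_
  simp only [Set.mem_iUnion] at hx
  obtain ⟨i, hi, hx⟩ := hx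
  exact ConnOn.mono_rel (Set.subset_biUnion_of_mem hi) (h i hi x hx v (hv i hi))

lemma ConnOn.insert_adj {V : Type u} {G : SimpleGraph V} {B : Set V} {x y : V} (h : ConnOn G B)
    (hx : x ∈ B) (hxy : G.Adj x y) : ConnOn G (insert y B) := by
  refine ConnOn.of_root x fun z hz => ?_
  rcases hz with rfl | hz
  · exact Relation.ReflTransGen.single
      ⟨hxy.symm, Set.mem_insert _ _, Set.mem_insert_of_mem _ hx⟩
  · exact ConnOn.mono_rel (Set.subset_insert _ _) (h z hz x hx)

lemma isMinorOf_of_le {V W : Type u} [Finite W] {G : SimpleGraph V} {H₀ : SimpleGraph W} :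
    ∀ (n : ℕ) (H : SimpleGraph W), (H.edgeSet \ H₀.edgeSet).ncard = n → H₀ ≤ H →
      IsMinorOf G H → IsMinorOf G H₀ := by
  intro n
  induction n with
  | zero =>
    intro H hn hle hm
    have : H.edgeSet \ H₀.edgeSet = ∅ := (Set.ncard_eq_zero (Set.toFinite _)).1 hn
    have h2 : H = H₀ := by
      apply le_antisymm _ hle
      rw [← SimpleGraph.edgeSet_subset_edgeSet]
      exact Set.sdiff_eq_empty.1 this
    exact h2 ▸ hm
  | succ n ih =>
    intro H hn hle hm
    have hne : (H.edgeSet \ H₀.edgeSet).Nonempty := by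
      rw [← Set.ncard_pos (Set.toFinite _)]; omega
    obtain ⟨e, he⟩ := hne
    refine ih (H.deleteEdges {e}) ?_ ?_ (hm.deleteEdge e)
    · rw [SimpleGraph.edgeSet_deleteEdges]
      have : (H.edgeSet \ {e}) \ H₀.edgeSet = (H.edgeSet \ H₀.edgeSet) \ {e} := by
        ext; simp; tauto
      rw [this, Set.ncard_sdiff_singleton_of_mem he, hn]; rfl
    · rw [← SimpleGraph.edgeSet_subset_edgeSet, SimpleGraph.edgeSet_deleteEdges]
      intro f hf
      refine ⟨SimpleGraph.edgeSet_subset_edgeSet.2 hle hf, ?_⟩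
      rintro rfl
      exact he.2 hf

/-- A graph all of whose vertices are covered by connected fibres over `H₀` contracts to `H₀`. -/
lemma isMinorOf_of_map {V W : Type u} {G : SimpleGraph V} {H₀ : SimpleGraph W} :
    ∀ (n : ℕ) (U : Type u) [Finite U] (H : SimpleGraph U), Nat.card U = n → IsMinorOf G H →
      ∀ φ : U → W, Function.Surjective φ →
      (∀ x y, φ x = φ y → Relation.ReflTransGen (fun a b => H.Adj a b ∧ φ a = φ b) x y) →
      (∀ a b, H₀.Adj a b → ∃ x y, φ x = a ∧ φ y = b ∧ H.Adj x y) → IsMinorOf G H₀ := by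
  intro n
  induction n with
  | zero =>
    intro U _ H hn hm φ hs hc ha
    have : IsEmpty U := by
      rcases Nat.card_eq_zero.1 hn with h | h
      · exact h
      · exact absurd ‹Finite U› (not_finite_iff_infinite.2 h)
    have hW : IsEmpty W := ⟨fun w => (hs w).elim fun x _ => this.elim x⟩
    exact hm.iso ⟨⟨φ, fun w => hW.elim w, fun x => this.elim x, fun w => hW.elim w⟩,
      fun {a} => this.elim a⟩
  | succ n ih =>
    intro U _ H hn hm φ hs hc ha
    by_cases hinj : Function.Injective φ
    · let e := Equiv.ofBijective φ ⟨hinj, hs⟩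
      have : Finite W := Finite.of_equiv U e
      have h1 : IsMinorOf G (H.map e.toEmbedding) := hm.iso (SimpleGraph.Iso.map e H)
      refine isMinorOf_of_le _ _ rfl ?_ h1
      intro a b hab
      obtain ⟨x, y, rfl, rfl, hxy⟩ := ha a b hab
      exact (SimpleGraph.map_adj _ _ _ _).2 ⟨x, y, hxy, rfl, rfl⟩
    · simp only [Function.Injective, not_forall] at hinj
      obtain ⟨x, y, hxy, hne⟩ := hinj
      -- Two points of one fibre are connected inside it, so the fibre contains an edge; contracting
      -- it keeps all fibres connected and removes a vertex.
      obtain ⟨a, b, hab, hφ⟩ : ∃ a b, H.Adj a b ∧ φ a = φ b := by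
        rcases Relation.ReflTransGen.cases_head (hc x y hxy) with h | ⟨c, hc, -⟩
        · exact absurd h hne
        · exact ⟨x, c, hc⟩
      have hab' : a ≠ b := hab.ne
      classical
      let π : U → {z : U // z ≠ b} := fun z => if h : z = b then ⟨a, hab'⟩ else ⟨z, h⟩
      have hπ : ∀ z : {z : U // z ≠ b}, π z = z := fun z => by
        simp [π, z.2]
      have hπφ : ∀ z, φ (π z) = φ z := fun z => by
        by_cases h : z = b
        · subst h; simp [π, hφ]
        · simp [π, h]
      have hadj : ∀ z w, H.Adj z w → π z ≠ π w → (contractEdge H a b).Adj (π z) (π w) := by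
        intro z w hzw hne
        refine ⟨hne, ?_⟩
        by_cases h : z = b
        · subst h
          have h2 : w ≠ z := hzw.ne'
          right; left
          simp [π, h2, hzw]
        · by_cases h2 : w = b
          · subst h2
            right; right
            simp [π, h, hzw]
          · left
            simp [π, h, h2, hzw]
      refine ih {z : U // z ≠ b} (contractEdge H a b) ?_ (hm.contract hab) (fun z => φ z)
        ?_ ?_ ?_
      · let _ := Fintype.ofFinite U
        rw [Nat.card_eq_fintype_card, Fintype.card_subtype_compl, Fintype.card_subtype_eq,
          ← Nat.card_eq_fintype_card, hn]
        rfl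
      · intro w
        obtain ⟨z, rfl⟩ := hs w
        exact ⟨π z, hπφ z⟩
      · intro z w hzw
        have := Relation.ReflTransGen.lift' (p := fun (a' b' : {z : U // z ≠ b}) =>
          (contractEdge H a b).Adj a' b' ∧ φ a' = φ b') π (fun s t hst => ?_) _ _ (hc z w hzw)
        · simpa only [Function.onFun, hπ] using this
        · by_cases h : π s = π t
          · rw [Function.onFun, h]
          · exact Relation.ReflTransGen.single ⟨hadj s t hst.1 h, by rw [hπφ, hπφ]; exact hst.2⟩
      · intro s t hst
        obtain ⟨z, w, rfl, rfl, hzw⟩ := ha s t hst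
        refine ⟨π z, π w, hπφ z, hπφ w, hadj z w hzw ?_⟩
        intro h
        have := hπφ z
        rw [h, hπφ] at this
        exact hst.ne this.symm

/-- In a connected graph a clique model can be extended to one that covers all vertices. -/
lemma CliqueModel.exists_cover {V : Type u} [Fintype V] {ι : Type*} {G : SimpleGraph V}
    (hG : G.Connected) (hι : Nonempty ι) : ∀ (n : ℕ) (B : ι → Set V), CliqueModel G B →
    (⋃ i, B i)ᶜ.ncard = n → ∃ B' : ι → Set V, CliqueModel G B' ∧ ∀ v, ∃ i, v ∈ B' i := by
  intro n
  induction n with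
  | zero =>
    intro B hB hn
    refine ⟨B, hB, fun v => ?_⟩
    have := (Set.ncard_eq_zero (Set.toFinite _)).1 hn
    rw [Set.compl_empty_iff] at this
    exact Set.mem_iUnion.1 (this ▸ Set.mem_univ v)
  | succ n ih =>
    intro B hB hn
    have hne : ((⋃ i, B i)ᶜ).Nonempty := by
      rw [← Set.ncard_pos (Set.toFinite _)]; omega
    obtain ⟨v, hv⟩ := hne
    obtain ⟨i₀⟩ := hι
    obtain ⟨u, hu⟩ := hB.nonempty i₀
    obtain ⟨q⟩ := hG.preconnected u v
    -- Vertices cannot be deleted, so each must end up in a branch set. A walk leaving the union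
    -- yields an edge from some `B i` to an uncovered vertex, which `B i` absorbs.
    obtain ⟨d, -, hd1, hd2⟩ := q.exists_boundary_dart (⋃ i, B i) (Set.mem_iUnion.2 ⟨i₀, hu⟩) hv
    obtain ⟨i, hi⟩ := Set.mem_iUnion.1 hd1
    classical
    have hy : ∀ j, d.snd ∉ B j := fun j hj => hd2 (Set.mem_iUnion.2 ⟨j, hj⟩)
    have hsub : ∀ j, B j ⊆ Function.update B i (insert d.snd (B i)) j := by
      intro j
      by_cases h : j = i
      · subst h; simp
      · simp [h]
    refine ih (Function.update B i (insert d.snd (B i))) ⟨?_, ?_, ?_, ?_⟩ ?_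
    · exact fun j => (hB.nonempty j).mono (hsub j)
    · intro j
      by_cases h : j = i
      · subst h
        simpa using (hB.conn j).insert_adj hi d.adj
      · simpa [h] using hB.conn j
    · intro j k hjk
      by_cases h : j = i
      · subst h
        simp only [Function.update_self, Function.update_of_ne hjk.symm]
        exact Set.disjoint_insert_left.2 ⟨hy k, hB.disj _ _ hjk⟩
      · by_cases h' : k = i
        · subst h'
          simp only [Function.update_self, Function.update_of_ne h]
          exact Set.disjoint_insert_right.2 ⟨hy j, hB.disj _ _ hjk⟩
        · simpa [h, h'] using hB.disj _ _ hjk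
    · intro j k hjk
      obtain ⟨x, hx, y, hy, hxy⟩ := hB.adj j k hjk
      exact ⟨x, hsub j hx, y, hsub k hy, hxy⟩
    · have : (⋃ j, Function.update B i (insert d.snd (B i)) j) = insert d.snd (⋃ j, B j) := by
        ext z
        simp only [Set.mem_iUnion, Set.mem_insert_iff]
        constructor
        · rintro ⟨j, hj⟩
          by_cases h : j = i
          · subst h
            simp only [Function.update_self, Set.mem_insert_iff] at hj
            exact hj.imp_right fun h => ⟨_, h⟩
          · simp only [Function.update_of_ne h] at hj
            exact Or.inr ⟨j, hj⟩
        · rintro (rfl | ⟨j, hj⟩)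
          · exact ⟨i, by simp⟩
          · exact ⟨j, hsub j hj⟩
      rw [this]
      have h3 : (insert d.snd (⋃ j, B j))ᶜ = (⋃ j, B j)ᶜ \ {d.snd} := by
        ext; simp; tauto
      rw [h3, Set.ncard_sdiff_singleton_of_mem hd2, hn]; rfl

/-- A connected graph with a clique model contains every graph on the index type as a minor. -/
lemma CliqueModel.isMinorOf {V W : Type u} [Fintype V] [Nonempty W] {G : SimpleGraph V}
    (hG : G.Connected) {B : W → Set V} (hB : CliqueModel G B) (H₀ : SimpleGraph W) :
    IsMinorOf G H₀ := by
  obtain ⟨B, hB, hcov⟩ := hB.exists_cover hG ‹_› _ _ rfl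
  choose φ hφ using hcov
  have hφ' : ∀ v i, v ∈ B i → φ v = i := by
    intro v i hv
    by_contra h
    exact (Set.disjoint_left.1 (hB.disj _ _ h)) (hφ v) hv
  refine isMinorOf_of_map _ V G rfl IsMinorOf.refl φ ?_ ?_ ?_
  · intro w
    obtain ⟨x, hx⟩ := hB.nonempty w
    exact ⟨x, hφ' _ _ hx⟩
  · intro x y hxy
    refine Relation.ReflTransGen.mono ?_ _ _ (hB.conn (φ x) x (hφ x) y (hxy ▸ hφ y))
    intro a b hab
    exact ⟨hab.1, by rw [hφ' a _ hab.2.1, hφ' b _ hab.2.2]⟩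
  · intro a b hab
    obtain ⟨x, hx, y, hy, hxy⟩ := hB.adj a b hab.ne
    exact ⟨x, y, hφ' _ _ hx, hφ' _ _ hy, hxy⟩

/-- The connected finite graphs of a nontrivial minor-closed family exclude a clique model. -/
lemma exists_excluded_cliqueModel (K : GraphFamily.{u}) (hK : MinorClosed K)
    (hK' : NontrivialFamily K) :
    ∃ h : ℕ, ∀ (V : Type u) [Fintype V] (G : SimpleGraph V), K V G → G.Connected →
      ∀ B : Fin h → Set V, ¬ CliqueModel G B := by
  obtain ⟨W, _, _, H₀, hH⟩ := hK'
  refine ⟨Nat.card W, fun V _ G hKG hG B hB => hH ?_⟩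
  let e := Finite.equivFin W
  have hB' : CliqueModel G (fun w => B (e w)) :=
    ⟨fun i => hB.nonempty _, fun i => hB.conn _,
      fun i j hij => hB.disj _ _ fun h => hij (e.injective h),
      fun i j hij => hB.adj _ _ fun h => hij (e.injective h)⟩
  exact hK V W G H₀ hKG (hB'.isMinorOf hG H₀)

/-! ### Balanced separators from shallow clique models -/

section Separator
open scoped Classical

/-- The ball of radius `n` around `B` in the subgraph induced on `R`. -/
noncomputable def ballIn {V : Type u} (H : SimpleGraph V) (R B : Finset V) : ℕ → Finset V
  | 0 => B
  | n + 1 => ballIn H R B n ∪ R.filter (fun y => ∃ x ∈ ballIn H R B n, H.Adj x y)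

variable {V : Type u} {H : SimpleGraph V} {R B : Finset V}

lemma ballIn_subset (hB : B ⊆ R) (n : ℕ) : ballIn H R B n ⊆ R := by
  induction n with
  | zero => exact hB
  | succ n ih => exact Finset.union_subset ih (Finset.filter_subset _ _)

lemma ballIn_subset_succ (n : ℕ) : ballIn H R B n ⊆ ballIn H R B (n + 1) :=
  Finset.subset_union_left

lemma ballIn_mono {n m : ℕ} (h : n ≤ m) : ballIn H R B n ⊆ ballIn H R B m :=
  monotone_nat_of_le_succ (f := ballIn H R B) (fun n => ballIn_subset_succ n) h

lemma mem_ballIn_succ {n : ℕ} {x y : V} (hx : x ∈ ballIn H R B n) (hy : y ∈ R)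
    (h : H.Adj x y) : y ∈ ballIn H R B (n + 1) :=
  Finset.mem_union_right _ (Finset.mem_filter.2 ⟨hy, x, hx, h⟩)

/-- Otherwise each of the first ρ layers enlarges the ball by a factor above 1 + x, and the ball of
radius ρ outgrows `R`. An empty `B` already satisfies the bound at radius 0. -/
lemma exists_small_layer (hB : B ⊆ R) {x : ℝ} (hx : 0 < x) {ρ : ℕ}
    (hρ : (R.card : ℝ) < (1 + x) ^ ρ) (hρ0 : 0 < ρ) :
    ∃ a < ρ, ((ballIn H R B (a + 1) \ ballIn H R B a).card : ℝ)
      ≤ x * (ballIn H R B a).card := by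
  by_contra! hcon
  have hpos : 0 < B.card := by
    rcases B.eq_empty_or_nonempty with h | h
    · have := hcon 0 hρ0
      have he : ballIn H R B 1 = ∅ := by
        simp [ballIn, h]
      simp [he] at this
      exact absurd this (by simp [ballIn, h])
    · exact h.card_pos
  have hgrow : ∀ a ≤ ρ, (1 + x) ^ a ≤ ((ballIn H R B a).card : ℝ) := by
    intro a
    induction a with
    | zero => intro _; simpa [ballIn] using hpos
    | succ a ih =>
      intro ha
      have h1 := ih (by omega)
      have h2 := hcon a (by omega)
      have h3 := Finset.card_sdiff_add_card_eq_card (ballIn_subset_succ (H := H) (R := R) (B := B) a)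
      have h4 : ((ballIn H R B (a + 1)).card : ℝ) =
          ((ballIn H R B (a + 1) \ ballIn H R B a).card : ℝ) + (ballIn H R B a).card := by
        exact_mod_cast h3.symm
      rw [h4, pow_succ]
      nlinarith
  have h1 := hgrow ρ le_rfl
  have h2 : ((ballIn H R B ρ).card : ℝ) ≤ R.card :=
    Nat.cast_le.2 (Finset.card_le_card (ballIn_subset hB ρ))
  linarith

lemma exists_mem_ballIn_add (hB : B ⊆ R) {v : V} (b : ℕ) : ∀ (a : ℕ) (y : V),
    y ∈ ballIn H R B b → y ∈ ballIn H R {v} a → ∃ s ∈ B, s ∈ ballIn H R {v} (a + b) := by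
  induction b with
  | zero => exact fun a y h1 h2 => ⟨y, h1, h2⟩
  | succ b ih =>
    intro a y h1 h2
    rcases Finset.mem_union.1 h1 with h1 | h1
    · obtain ⟨s, hs, h⟩ := ih a y h1 h2
      exact ⟨s, hs, ballIn_mono (by omega) h⟩
    · obtain ⟨hy, z, hz, hzy⟩ := Finset.mem_filter.1 h1
      obtain ⟨s, hs, h⟩ := ih (a + 1) z hz (mem_ballIn_succ h2 (ballIn_subset hB _ hz) hzy.symm)
      exact ⟨s, hs, by rwa [show a + (b + 1) = a + 1 + b by ring]⟩

lemma exists_connOn_of_mem_ballIn {v : V} (hv : v ∈ R) (a : ℕ) : ∀ y ∈ ballIn H R {v} a,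
    ∃ P ⊆ R, v ∈ P ∧ y ∈ P ∧ ConnOn H (P : Set V) ∧ P.card ≤ a + 1 := by
  induction a with
  | zero =>
    intro y hy
    have : y = v := by simpa [ballIn] using hy
    subst this
    exact ⟨{y}, by simpa using hv, by simp, by simp, by simpa using ConnOn.singleton H y, by simp⟩
  | succ a ih =>
    intro y hy
    rcases Finset.mem_union.1 hy with hy | hy
    · obtain ⟨P, h1, h2, h3, h4, h5⟩ := ih y hy
      exact ⟨P, h1, h2, h3, h4, by omega⟩
    · obtain ⟨hy, z, hz, hzy⟩ := Finset.mem_filter.1 hy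
      obtain ⟨P, h1, h2, h3, h4, h5⟩ := ih z hz
      refine ⟨insert y P, Finset.insert_subset hy h1, by simp [h2], by simp, ?_, ?_⟩
      · rw [Finset.coe_insert]
        exact h4.insert_adj h3 hzy
      · exact (Finset.card_insert_le _ _).trans (by omega)

/-- A partial separation of `A`: the part `R` is cut off by the set `Z`, which is small, and by
pairwise adjacent small connected sets `T i`, `i ∈ I`. -/
structure PartialSeparation (H : SimpleGraph V) (A : Finset V) (h τ : ℕ) (x : ℝ)
    (R Z : Finset V) (I : Finset (Fin h)) (T : Fin h → Finset V) : Prop where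
  subR : R ⊆ A
  subZ : Z ⊆ A
  subT : ∀ i ∈ I, T i ⊆ A
  disjZ : Disjoint R Z
  disjR : ∀ i ∈ I, Disjoint R (T i)
  disjT : ∀ i ∈ I, ∀ j ∈ I, i ≠ j → Disjoint (T i) (T j)
  nonempty : ∀ i ∈ I, (T i).Nonempty
  conn : ∀ i ∈ I, ConnOn H (T i : Set V)
  adj : ∀ i ∈ I, ∀ j ∈ I, i ≠ j → ∃ a ∈ T i, ∃ b ∈ T j, H.Adj a b
  cardT : ∀ i ∈ I, (T i).card ≤ τ
  cardZ : (Z.card : ℝ) ≤ x * (A.card - R.card)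
  nbr : ∀ u ∈ R, ∀ w ∈ A, H.Adj u w → w ∈ R ∨ w ∈ Z ∨ ∃ i ∈ I, w ∈ T i
  low : (A.card : ℝ) / 4 ≤ R.card

variable {A Z : Finset V} {h τ : ℕ} {x : ℝ} {I : Finset (Fin h)} {T : Fin h → Finset V}

/-- The ball and its outer layer leave `R` and the layer joins `Z`, so `Z` stays charged to vertices
that left. The ball has at most |R|/2 elements and the layer at most |R|/8, so at least 3|R|/8 >
|A|/4 remains. An index may be dropped once all neighbours of its `T i` in `R` lie in `B`. -/
lemma PartialSeparation.cut (hS : PartialSeparation H A h τ x R Z I T) (hx : 0 < x)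
    (hx4 : x ≤ 1 / 4) (hbig : (2 / 3 : ℝ) * A.card < R.card) {B : Finset V} (hB : B ⊆ R) (a : ℕ)
    (hlayer : ((ballIn H R B (a + 1) \ ballIn H R B a).card : ℝ) ≤ x * (ballIn H R B a).card)
    (hhalf : 2 * (ballIn H R B a).card ≤ R.card) {I' : Finset (Fin h)} (hI : I' ⊆ I)
    (hdrop : ∀ i ∈ I, i ∉ I' → ∀ u ∈ R, ∀ w ∈ T i, H.Adj u w → u ∈ B) :
    PartialSeparation H A h τ x (R \ ballIn H R B (a + 1))
      (Z ∪ (ballIn H R B (a + 1) \ ballIn H R B a)) I' T := by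
  have hsub1 : ballIn H R B (a + 1) ⊆ R := ballIn_subset hB _
  have hsub2 : ballIn H R B a ⊆ ballIn H R B (a + 1) := ballIn_subset_succ a
  have hcard1 : ((R \ ballIn H R B (a + 1)).card : ℝ) + (ballIn H R B (a + 1)).card = R.card := by
    exact_mod_cast Finset.card_sdiff_add_card_eq_card hsub1
  have hcard2 : ((ballIn H R B (a + 1) \ ballIn H R B a).card : ℝ) + (ballIn H R B a).card
      = (ballIn H R B (a + 1)).card := by
    exact_mod_cast Finset.card_sdiff_add_card_eq_card hsub2
  have hhalf' : 2 * ((ballIn H R B a).card : ℝ) ≤ R.card := by exact_mod_cast hhalf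
  have h0 : (0 : ℝ) ≤ (ballIn H R B a).card := Nat.cast_nonneg _
  have h0' : (0 : ℝ) ≤ (ballIn H R B (a + 1) \ ballIn H R B a).card := Nat.cast_nonneg _
  refine ⟨Finset.sdiff_subset.trans hS.subR, ?_, fun i hi => hS.subT i (hI hi), ?_, ?_, ?_,
    fun i hi => hS.nonempty i (hI hi), fun i hi => hS.conn i (hI hi), ?_,
    fun i hi => hS.cardT i (hI hi), ?_, ?_, ?_⟩
  · exact Finset.union_subset hS.subZ ((Finset.sdiff_subset.trans hsub1).trans hS.subR)
  · rw [Finset.disjoint_union_right]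
    refine ⟨hS.disjZ.mono_left Finset.sdiff_subset, ?_⟩
    exact Finset.sdiff_disjoint.mono_right Finset.sdiff_subset
  · exact fun i hi => (hS.disjR i (hI hi)).mono_left Finset.sdiff_subset
  · exact fun i hi j hj => hS.disjT i (hI hi) j (hI hj)
  · exact fun i hi j hj => hS.adj i (hI hi) j (hI hj)
  · have h1 : ((Z ∪ (ballIn H R B (a + 1) \ ballIn H R B a)).card : ℝ) ≤
        Z.card + (ballIn H R B (a + 1) \ ballIn H R B a).card := by
      exact_mod_cast Finset.card_union_le _ _
    have := hS.cardZ
    nlinarith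
  · intro u hu w hw huw
    obtain ⟨huR, huB⟩ := Finset.mem_sdiff.1 hu
    rcases hS.nbr u huR w hw huw with h | h | ⟨i, hi, h⟩
    · by_cases hwB : w ∈ ballIn H R B (a + 1)
      · by_cases hwB' : w ∈ ballIn H R B a
        · exact absurd (mem_ballIn_succ hwB' huR huw.symm) huB
        · exact Or.inr (Or.inl (Finset.mem_union_right _ (Finset.mem_sdiff.2 ⟨hwB, hwB'⟩)))
      · exact Or.inl (Finset.mem_sdiff.2 ⟨h, hwB⟩)
    · exact Or.inr (Or.inl (Finset.mem_union_left _ h))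
    · by_cases hi' : i ∈ I'
      · exact Or.inr (Or.inr ⟨i, hi', h⟩)
      · exact absurd (ballIn_mono (Nat.zero_le _) (hdrop i hi hi' u huR w h huw)) huB
  · have hA : (0 : ℝ) ≤ A.card := Nat.cast_nonneg _
    nlinarith

/-- Fix v in `R`. If every `T i` has a neighbour within distance 2ρ of v in `R`, the union of the
connections is a new branch set; a free index exists because a full set of indices would be an
excluded clique model. Otherwise some `N i` is farther away, the balls around v and `N i` up to
small layers are disjoint, and the one with at most half of `R` is cut off; if it surrounds `N i`,
the index i is dropped. The weight h + 1 per vertex of `R` outweighs the gain of an index. -/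
lemma PartialSeparation.step (hH : ∀ B : Fin h → Set V, ¬ CliqueModel H B)
    (hS : PartialSeparation H A h τ x R Z I T) (hx : 0 < x)
    (hx4 : x ≤ 1 / 4) {ρ : ℕ} (hρ0 : 0 < ρ) (hρ : (A.card : ℝ) < (1 + x) ^ ρ)
    (hτ : h * (2 * ρ + 1) + 1 ≤ τ) (hτA : 12 * τ ≤ 5 * A.card)
    (hbig : (2 / 3 : ℝ) * A.card < R.card) :
    ∃ R' Z' I' T', PartialSeparation H A h τ x R' Z' I' T' ∧
      R'.card * (h + 1) + I'.card < R.card * (h + 1) + I.card := by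
  have hRpos : 0 < R.card := by
    have : (0 : ℝ) ≤ A.card := Nat.cast_nonneg _
    exact_mod_cast (lt_of_le_of_lt (by positivity) hbig : (0 : ℝ) < R.card)
  obtain ⟨v, hv⟩ := Finset.card_pos.1 hRpos
  have hρR : (R.card : ℝ) < (1 + x) ^ ρ :=
    lt_of_le_of_lt (Nat.cast_le.2 (Finset.card_le_card hS.subR)) hρ
  let N : Fin h → Finset V := fun i => R.filter fun u => ∃ w ∈ T i, H.Adj u w
  have hN : ∀ i, N i ⊆ R := fun i => Finset.filter_subset _ _
  by_cases hall : ∀ i ∈ I, ∃ y ∈ N i, y ∈ ballIn H R {v} (2 * ρ)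
  · have hex : ∃ i₀, i₀ ∉ I := by
      by_contra! hcon
      refine hH (fun i => (T i : Set V)) ⟨fun i => hS.nonempty i (hcon i), fun i => hS.conn i (hcon i),
        fun i j hij => ?_, fun i j hij => hS.adj i (hcon i) j (hcon j) hij⟩
      exact Finset.disjoint_coe.2 (hS.disjT i (hcon i) j (hcon j) hij)
    obtain ⟨i₀, hi₀⟩ := hex
    have hP : ∀ i : Fin h, ∃ P ⊆ R, v ∈ P ∧ ConnOn H (P : Set V) ∧ P.card ≤ 2 * ρ + 1 ∧
        (i ∈ I → ∃ y ∈ P, ∃ w ∈ T i, H.Adj y w) := by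
      intro i
      by_cases hi : i ∈ I
      · obtain ⟨y, hy, hyb⟩ := hall i hi
        obtain ⟨P, h1, h2, h3, h4, h5⟩ := exists_connOn_of_mem_ballIn hv _ y hyb
        exact ⟨P, h1, h2, h4, h5, fun _ => ⟨y, h3, (Finset.mem_filter.1 hy).2⟩⟩
      · exact ⟨{v}, by simpa using hv, by simp, by simpa using ConnOn.singleton H v, by simp,
          fun h => absurd h hi⟩
    choose P hPR hPv hPc hPcard hPadj using hP
    let Q : Finset V := Finset.univ.biUnion P
    have hQR : Q ⊆ R := Finset.biUnion_subset.2 fun i _ => hPR i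
    have hPQ : ∀ i, P i ⊆ Q := fun i => Finset.subset_biUnion_of_mem P (Finset.mem_univ i)
    have hQne : v ∈ Q := hPQ i₀ (hPv i₀)
    have hQc : ConnOn H (Q : Set V) := by
      have := ConnOn.biUnion (G := H) (I := Set.univ) (B := fun i => (P i : Set V)) v
        (fun i _ => hPv i) (fun i _ => hPc i)
      simpa [Q] using this
    have hQcard : Q.card ≤ h * (2 * ρ + 1) := by
      refine (Finset.card_biUnion_le_card_mul _ _ _ fun i _ => hPcard i).trans ?_
      simp
    have hcard : (R \ Q).card + Q.card = R.card := Finset.card_sdiff_add_card_eq_card hQR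
    have hQpos : 0 < Q.card := Finset.card_pos.2 ⟨v, hQne⟩
    have hT : ∀ i ∈ I, Function.update T i₀ Q i = T i := fun i hi =>
      Function.update_of_ne (by rintro rfl; exact hi₀ hi) _ _
    have hT0 : Function.update T i₀ Q i₀ = Q := Function.update_self _ _ _
    refine ⟨R \ Q, Z, insert i₀ I, Function.update T i₀ Q,
      ⟨Finset.sdiff_subset.trans hS.subR, hS.subZ, ?_, hS.disjZ.mono_left Finset.sdiff_subset,
        ?_, ?_, ?_, ?_, ?_, ?_, ?_, ?_, ?_⟩, ?_⟩
    · intro i hi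
      rcases Finset.mem_insert.1 hi with rfl | hi
      · rw [hT0]; exact hQR.trans hS.subR
      · rw [hT i hi]; exact hS.subT i hi
    · intro i hi
      rcases Finset.mem_insert.1 hi with rfl | hi
      · rw [hT0]; exact Finset.sdiff_disjoint
      · rw [hT i hi]; exact (hS.disjR i hi).mono_left Finset.sdiff_subset
    · intro i hi j hj hij
      rcases Finset.mem_insert.1 hi with rfl | hi' <;> rcases Finset.mem_insert.1 hj with rfl | hj'
      · exact absurd rfl hij
      · rw [hT0, hT j hj']; exact (hS.disjR j hj').mono_left hQR
      · rw [hT0, hT i hi']; exact ((hS.disjR i hi').mono_left hQR).symm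
      · rw [hT i hi', hT j hj']; exact hS.disjT i hi' j hj' hij
    · intro i hi
      rcases Finset.mem_insert.1 hi with rfl | hi
      · rw [hT0]; exact ⟨v, hQne⟩
      · rw [hT i hi]; exact hS.nonempty i hi
    · intro i hi
      rcases Finset.mem_insert.1 hi with rfl | hi
      · rw [hT0]; exact hQc
      · rw [hT i hi]; exact hS.conn i hi
    · intro i hi j hj hij
      rcases Finset.mem_insert.1 hi with rfl | hi' <;> rcases Finset.mem_insert.1 hj with rfl | hj'
      · exact absurd rfl hij
      · rw [hT0, hT j hj']
        obtain ⟨y, hy, w, hw, hyw⟩ := hPadj j hj'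
        exact ⟨y, hPQ _ hy, w, hw, hyw⟩
      · rw [hT0, hT i hi']
        obtain ⟨y, hy, w, hw, hyw⟩ := hPadj i hi'
        exact ⟨w, hw, y, hPQ _ hy, hyw.symm⟩
      · rw [hT i hi', hT j hj']; exact hS.adj i hi' j hj' hij
    · intro i hi
      rcases Finset.mem_insert.1 hi with rfl | hi
      · rw [hT0]; omega
      · rw [hT i hi]; exact hS.cardT i hi
    · refine hS.cardZ.trans (mul_le_mul_of_nonneg_left ?_ hx.le)
      have : ((R \ Q).card : ℝ) ≤ R.card := Nat.cast_le.2 (Finset.card_le_card Finset.sdiff_subset)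
      linarith
    · intro u hu w hw huw
      rcases hS.nbr u (Finset.mem_sdiff.1 hu).1 w hw huw with h | h | ⟨i, hi, h⟩
      · by_cases hwQ : w ∈ Q
        · exact Or.inr (Or.inr ⟨i₀, Finset.mem_insert_self _ _, by rwa [hT0]⟩)
        · exact Or.inl (Finset.mem_sdiff.2 ⟨h, hwQ⟩)
      · exact Or.inr (Or.inl h)
      · exact Or.inr (Or.inr ⟨i, Finset.mem_insert_of_mem hi, by rwa [hT i hi]⟩)
    -- `Q` takes at most τ ≤ 5|A|/12, and 2/3 − 5/12 = 1/4.
    · have h1 : ((R \ Q).card : ℝ) + Q.card = R.card := by exact_mod_cast hcard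
      have h2 : (Q.card : ℝ) ≤ τ := by exact_mod_cast (by omega : Q.card ≤ τ)
      have h3 : (12 : ℝ) * τ ≤ 5 * A.card := by exact_mod_cast hτA
      linarith
    · rw [Finset.card_insert_of_notMem hi₀]
      have hle : I.card ≤ h := by simpa using Finset.card_le_univ I
      have : (R \ Q).card + 1 ≤ R.card := by omega
      have := Nat.mul_le_mul_right (h + 1) this
      have hh : 0 < h := Fin.pos i₀
      have : I.card < h := by
        have := Finset.card_lt_univ_of_notMem hi₀
        simpa using this
      nlinarith
  · push Not at hall
    obtain ⟨i, hi, hfar⟩ := hall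
    have hvR : ({v} : Finset V) ⊆ R := by simpa using hv
    obtain ⟨a, ha, hla⟩ := exists_small_layer (H := H) hvR hx hρR hρ0
    obtain ⟨b, hb, hlb⟩ := exists_small_layer (H := H) (hN i) hx hρR hρ0
    have hdisj : Disjoint (ballIn H R {v} a) (ballIn H R (N i) b) := by
      rw [Finset.disjoint_left]
      intro y hy1 hy2
      obtain ⟨s, hs, h⟩ := exists_mem_ballIn_add (hN i) b a y hy2 hy1
      exact hfar s hs (ballIn_mono (by omega) h)
    have hle : (ballIn H R {v} a).card + (ballIn H R (N i) b).card ≤ R.card := by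
      rw [← Finset.card_union_of_disjoint hdisj]
      exact Finset.card_le_card (Finset.union_subset (ballIn_subset hvR a) (ballIn_subset (hN i) b))
    by_cases hhalf : 2 * (ballIn H R {v} a).card ≤ R.card
    · refine ⟨_, _, _, _, hS.cut hx hx4 hbig hvR a hla hhalf (Finset.Subset.refl I)
        (fun i hi hi' => absurd hi hi'), ?_⟩
      have h1 : (R \ ballIn H R {v} (a + 1)).card < R.card := by
        refine Finset.card_lt_card (Finset.sdiff_ssubset (ballIn_subset hvR _) ?_)
        exact ⟨v, ballIn_mono (Nat.zero_le _) (by simp [ballIn])⟩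
      have := Nat.mul_lt_mul_of_pos_right h1 (Nat.succ_pos h)
      simp only [Nat.succ_eq_add_one] at this
      omega
    · refine ⟨_, _, _, _, hS.cut hx hx4 hbig (hN i) b hlb (by omega) (Finset.erase_subset i I)
        ?_, ?_⟩
      · intro j hj hj' u hu w hw huw
        have : j = i := by
          by_contra h
          exact hj' (Finset.mem_erase.2 ⟨h, hj⟩)
        subst this
        exact Finset.mem_filter.2 ⟨hu, w, hw, huw⟩
      · have h1 : (R \ ballIn H R (N i) (b + 1)).card ≤ R.card :=
          Finset.card_le_card Finset.sdiff_subset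
        have := Nat.mul_le_mul_right (h + 1) h1
        have h2 := Finset.card_erase_lt_of_mem hi
        omega

lemma PartialSeparation.exists_balanced (hH : ∀ B : Fin h → Set V, ¬ CliqueModel H B)
    (hx : 0 < x) (hx4 : x ≤ 1 / 4) {ρ : ℕ} (hρ0 : 0 < ρ) (hρ : (A.card : ℝ) < (1 + x) ^ ρ)
    (hτ : h * (2 * ρ + 1) + 1 ≤ τ) (hτA : 12 * τ ≤ 5 * A.card) :
    ∀ (n : ℕ) (R Z : Finset V) (I : Finset (Fin h)) (T : Fin h → Finset V),
      R.card * (h + 1) + I.card = n → PartialSeparation H A h τ x R Z I T →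
      ∃ R' Z' I' T', PartialSeparation H A h τ x R' Z' I' T' ∧
        (R'.card : ℝ) ≤ (2 / 3 : ℝ) * A.card := by
  intro n
  induction n using Nat.strong_induction_on with
  | _ n ih =>
    intro R Z I T hn hS
    by_cases hbig : (2 / 3 : ℝ) * A.card < R.card
    · obtain ⟨R', Z', I', T', hS', hlt⟩ := hS.step hH hx hx4 hρ0 hρ hτ hτA hbig
      exact ih _ (hn ▸ hlt) R' Z' I' T' rfl hS'
    · exact ⟨R, Z, I, T, hS, not_lt.1 hbig⟩

/-- Balanced separation of a graph without a clique model on `h` vertices. -/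
lemma exists_separation (hH : ∀ B : Fin h → Set V, ¬ CliqueModel H B)
    (hx : 0 < x) (hx4 : x ≤ 1 / 4) {ρ : ℕ} (hρ0 : 0 < ρ) (hρ : (A.card : ℝ) < (1 + x) ^ ρ)
    (hτ : h * (2 * ρ + 1) + 1 ≤ τ) (hτA : 12 * τ ≤ 5 * A.card) :
    ∃ A₁ A₂ : Finset V, A₁ ∪ A₂ = A ∧
      (∀ u ∈ A, ∀ w ∈ A, H.Adj u w → (u ∈ A₁ ∧ w ∈ A₁) ∨ (u ∈ A₂ ∧ w ∈ A₂)) ∧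
      ((A₁ ∩ A₂).card : ℝ) ≤ x * A.card + h * τ ∧
      (A₁.card : ℝ) ≤ 2 / 3 * A.card + (x * A.card + h * τ) ∧
      (A₂.card : ℝ) ≤ 3 / 4 * A.card := by
  have hinit : PartialSeparation H A h τ x A ∅ ∅ (fun _ => ∅) := by
    have h0 : (0 : ℝ) ≤ A.card := Nat.cast_nonneg _
    refine ⟨by simp, by simp, by simp, by simp, by simp, by simp, by simp, by simp, by simp,
      by simp, by simp, ?_, by linarith⟩
    intro u _ w hw _
    exact Or.inl hw
  obtain ⟨R, Z, I, T, hS, hR⟩ :=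
    PartialSeparation.exists_balanced hH hx hx4 hρ0 hρ hτ hτA _ _ _ _ _ rfl hinit
  let X : Finset V := Z ∪ I.biUnion T
  have hXA : X ⊆ A := Finset.union_subset hS.subZ (Finset.biUnion_subset.2 hS.subT)
  have hRX : Disjoint R X := by
    rw [Finset.disjoint_union_right, Finset.disjoint_biUnion_right]
    exact ⟨hS.disjZ, hS.disjR⟩
  have hXcard : (X.card : ℝ) ≤ x * A.card + h * τ := by
    have h1 : (X.card : ℝ) ≤ Z.card + (I.biUnion T).card := by
      exact_mod_cast Finset.card_union_le _ _
    have h2 : (I.biUnion T).card ≤ I.card * τ :=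
      Finset.card_biUnion_le_card_mul _ _ _ hS.cardT
    have h3 : I.card ≤ h := by simpa using Finset.card_le_univ I
    have h4 : ((I.biUnion T).card : ℝ) ≤ h * τ := by
      exact_mod_cast h2.trans (Nat.mul_le_mul_right τ h3)
    have h5 := hS.cardZ
    have h6 : (0 : ℝ) ≤ R.card := Nat.cast_nonneg _
    nlinarith
  have hint : (R ∪ X) ∩ (A \ R) = X := by
    ext y
    have h1 : y ∈ X → y ∈ A := fun h => hXA h
    have h2 : y ∈ R → y ∉ X := fun h => Finset.disjoint_left.1 hRX h
    simp only [Finset.mem_inter, Finset.mem_union, Finset.mem_sdiff]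
    tauto
  refine ⟨R ∪ X, A \ R, ?_, ?_, ?_, ?_, ?_⟩
  · ext y
    have h1 : y ∈ X → y ∈ A := fun h => hXA h
    have h2 : y ∈ R → y ∈ A := fun h => hS.subR h
    simp only [Finset.mem_union, Finset.mem_sdiff]
    tauto
  · have key : ∀ u ∈ R, ∀ w ∈ A, H.Adj u w → w ∈ R ∪ X := by
      intro u hu w hw huw
      rcases hS.nbr u hu w hw huw with h | h | ⟨i, hi, h⟩
      · exact Finset.mem_union_left _ h
      · exact Finset.mem_union_right _ (Finset.mem_union_left _ h)
      · exact Finset.mem_union_right _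
          (Finset.mem_union_right _ (Finset.mem_biUnion.2 ⟨i, hi, h⟩))
    intro u hu w hw huw
    by_cases huR : u ∈ R
    · exact Or.inl ⟨Finset.mem_union_left _ huR, key u huR w hw huw⟩
    · by_cases hwR : w ∈ R
      · exact Or.inl ⟨key w hwR u hu huw.symm, Finset.mem_union_left _ hwR⟩
      · exact Or.inr ⟨Finset.mem_sdiff.2 ⟨hu, huR⟩, Finset.mem_sdiff.2 ⟨hw, hwR⟩⟩
  · rw [hint]; exact hXcard
  · have : ((R ∪ X).card : ℝ) ≤ R.card + X.card := by exact_mod_cast Finset.card_union_le _ _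
    linarith
  · have h1 : ((A \ R).card : ℝ) + R.card = A.card := by
      exact_mod_cast Finset.card_sdiff_add_card_eq_card hS.subR
    have := hS.low
    linarith

end Separator

/-! ### Divisions into bounded regions with small overlap -/

section Division
open scoped Classical

variable {V : Type u} {H : SimpleGraph V} {h : ℕ}

/-- The constant in the separator bound for graphs without a clique model on `h` vertices. -/
def sepConst (h : ℕ) : ℕ := 36 * (h + 1) ^ 2

/-- With m = ⌊t⌋ and x = 1/m the layers contribute |A|/m. The radius 4m(m + 1) suffices because (1 +
1/m)^m ≥ 2 and 2^(4(m+1)) > |A|. The h branch sets have size O(h m²), and m² ≤ |A|/m, so the whole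
overlap is O(|A|^(3/4)). -/
lemma exists_separation_rate (hH : ∀ B : Fin h → Set V, ¬ CliqueModel H B) (A : Finset V)
    {t : ℝ} (htA : t ^ 4 = A.card) (ht : 8 * (sepConst h : ℝ) ≤ t) :
    ∃ A₁ A₂ : Finset V, A₁ ∪ A₂ = A ∧
      (∀ u ∈ A, ∀ w ∈ A, H.Adj u w → (u ∈ A₁ ∧ w ∈ A₁) ∨ (u ∈ A₂ ∧ w ∈ A₂)) ∧
      (A₁.card : ℝ) + A₂.card ≤ A.card + sepConst h * (A.card / t) ∧
      (A₁.card : ℝ) ≤ 4 / 5 * A.card ∧ (A₂.card : ℝ) ≤ 4 / 5 * A.card := by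
  have hc : (sepConst h : ℝ) = 36 * ((h : ℝ) + 1) ^ 2 := by simp [sepConst]
  have hh0 : (0 : ℝ) ≤ h := Nat.cast_nonneg h
  have hc1 : (36 : ℝ) * (h + 1) ≤ sepConst h := by rw [hc]; nlinarith
  have ht0 : 0 < t := by nlinarith
  obtain ⟨m, hm⟩ : ∃ m, m = ⌊t⌋₊ := ⟨_, rfl⟩
  have hmt : (m : ℝ) ≤ t := hm ▸ Nat.floor_le ht0.le
  have htm : t < m + 1 := hm ▸ Nat.lt_floor_add_one t
  have hm1 : (200 : ℝ) * (h + 1) ≤ m := by nlinarith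
  have hm0 : (200 : ℝ) ≤ m := by nlinarith
  have hmN : 200 ≤ m := by exact_mod_cast hm0
  have hmpos : (0 : ℝ) < m := by linarith
  have hn : (A.card : ℝ) = t ^ 4 := htA.symm
  have hnm : (m : ℝ) ^ 4 ≤ A.card := by rw [hn]; gcongr
  have hρ : (A.card : ℝ) < (1 + 1 / (m : ℝ)) ^ (m * (4 * (m + 1))) := by
    have h1 : (2 : ℝ) ≤ (1 + 1 / (m : ℝ)) ^ m := by
      have := one_add_mul_le_pow (a := 1 / (m : ℝ))
        (by have : (0 : ℝ) ≤ 1 / m := by positivity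
            linarith) m
      rw [mul_one_div_cancel hmpos.ne'] at this
      linarith
    have h2 : ((m : ℝ) + 1) < 2 ^ (m + 1) := by
      exact_mod_cast (Nat.lt_two_pow_self (n := m + 1))
    calc (A.card : ℝ) = t ^ 4 := hn
      _ < ((m : ℝ) + 1) ^ 4 := by gcongr
      _ ≤ (2 ^ (m + 1)) ^ 4 := by gcongr
      _ = 2 ^ (4 * (m + 1)) := by rw [← pow_mul]; ring_nf
      _ ≤ ((1 + 1 / (m : ℝ)) ^ m) ^ (4 * (m + 1)) := by gcongr
      _ = _ := by rw [← pow_mul]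
  have hx : (0 : ℝ) < 1 / m := by positivity
  have hx4 : (1 / (m : ℝ)) ≤ 1 / 4 := by
    apply one_div_le_one_div_of_le <;> linarith
  obtain ⟨τ, hτ⟩ : ∃ τ, τ = h * (2 * (m * (4 * (m + 1))) + 1) + 1 := ⟨_, rfl⟩
  have hτ1 : (τ : ℝ) ≤ 17 * (h + 1) * m ^ 2 := by
    rw [hτ]; push_cast
    have : 2 * ((m : ℝ) * (4 * (m + 1))) + 1 ≤ 17 * m ^ 2 := by nlinarith
    have := mul_le_mul_of_nonneg_left this hh0
    nlinarith
  have hτA : 12 * τ ≤ 5 * A.card := by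
    have h1 : (12 : ℝ) * τ ≤ 5 * A.card := by
      have h2 : (41 : ℝ) * (h + 1) ≤ m ^ 2 := by nlinarith
      have h3 : (12 * 17 * (h + 1) : ℝ) * m ^ 2 ≤ (5 * m ^ 2) * m ^ 2 :=
        mul_le_mul_of_nonneg_right (by linarith) (sq_nonneg _)
      calc (12 : ℝ) * τ ≤ 12 * (17 * (h + 1) * m ^ 2) := by gcongr
        _ = (12 * 17 * (h + 1) : ℝ) * m ^ 2 := by ring
        _ ≤ (5 * m ^ 2) * m ^ 2 := h3
        _ = 5 * m ^ 4 := by ring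
        _ ≤ 5 * A.card := by gcongr
    exact_mod_cast h1
  obtain ⟨A₁, A₂, h1, h2, h3, h4, h5⟩ := exists_separation hH hx hx4 (by positivity) hρ
    (τ := τ) (by omega) hτA
  have hX : 1 / (m : ℝ) * A.card + h * τ ≤ sepConst h * (A.card / t) := by
    have e1 : (m : ℝ) ^ 2 ≤ A.card / m := by
      rw [le_div_iff₀ hmpos]
      refine le_trans ?_ hnm
      have : (m : ℝ) ^ 2 * m * 1 ≤ m ^ 2 * m * m := by gcongr; linarith
      nlinarith
    have e2 : (h : ℝ) * τ ≤ 17 * (h + 1) ^ 2 * (A.card / m) := by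
      calc (h : ℝ) * τ ≤ (h + 1) * (17 * (h + 1) * m ^ 2) := by gcongr; linarith
        _ = 17 * (h + 1) ^ 2 * m ^ 2 := by ring
        _ ≤ _ := by gcongr
    have e3 : (A.card : ℝ) / m ≤ 2 * (A.card / t) := by
      rw [← mul_div_assoc, div_le_div_iff₀ hmpos ht0]
      have : (0 : ℝ) ≤ A.card := Nat.cast_nonneg _
      nlinarith
    have e4 : (0 : ℝ) ≤ A.card / t := by positivity
    have e5 : (1 : ℝ) ≤ (h + 1) ^ 2 := by nlinarith
    rw [hc]
    calc 1 / (m : ℝ) * A.card + h * τ ≤ A.card / m + 17 * (h + 1) ^ 2 * (A.card / m) := by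
          rw [one_div_mul_eq_div]; gcongr
      _ = (1 + 17 * (h + 1) ^ 2) * (A.card / m) := by ring
      _ ≤ (18 * (h + 1) ^ 2) * (2 * (A.card / t)) := by
          gcongr
          linarith
      _ = _ := by ring
  have hX2 : (sepConst h : ℝ) * (A.card / t) ≤ A.card / 8 := by
    rw [← mul_div_assoc, div_le_div_iff₀ ht0 (by norm_num)]
    have : (0 : ℝ) ≤ A.card := Nat.cast_nonneg _
    nlinarith
  refine ⟨A₁, A₂, h1, h2, ?_, by linarith, by linarith⟩
  have : (A₁.card : ℝ) + A₂.card = A.card + (A₁ ∩ A₂).card := by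
    rw [← h1]
    exact_mod_cast (Finset.card_union_add_card_inter A₁ A₂).symm
  linarith

/-- Regions of size at most `r` that cover `A` and all edges inside `A`. -/
structure IsDivision (H : SimpleGraph V) (A : Finset V) (r : ℕ) (𝓡 : Finset (Finset V)) : Prop where
  subset : ∀ R ∈ 𝓡, R ⊆ A
  card_le : ∀ R ∈ 𝓡, R.card ≤ r
  cover : ∀ v ∈ A, ∃ R ∈ 𝓡, v ∈ R
  edge : ∀ u ∈ A, ∀ w ∈ A, H.Adj u w → ∃ R ∈ 𝓡, u ∈ R ∧ w ∈ R

lemma IsDivision.singleton {A : Finset V} {r : ℕ} (h : A.card ≤ r) : IsDivision H A r {A} :=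
  ⟨by simp, by simpa using h, fun v hv => ⟨A, by simp, hv⟩,
    fun u hu w hw _ => ⟨A, by simp, hu, hw⟩⟩

lemma IsDivision.union {A A₁ A₂ : Finset V} {r : ℕ} {𝓡₁ 𝓡₂ : Finset (Finset V)}
    (h₁ : IsDivision H A₁ r 𝓡₁) (h₂ : IsDivision H A₂ r 𝓡₂) (hA : A₁ ∪ A₂ = A)
    (hE : ∀ u ∈ A, ∀ w ∈ A, H.Adj u w → (u ∈ A₁ ∧ w ∈ A₁) ∨ (u ∈ A₂ ∧ w ∈ A₂)) :
    IsDivision H A r (𝓡₁ ∪ 𝓡₂) := by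
  subst hA
  refine ⟨fun R hR => ?_, fun R hR => ?_, fun v hv => ?_, fun u hu w hw huw => ?_⟩
  · rcases Finset.mem_union.1 hR with hR | hR
    · exact (h₁.subset R hR).trans Finset.subset_union_left
    · exact (h₂.subset R hR).trans Finset.subset_union_right
  · rcases Finset.mem_union.1 hR with hR | hR
    · exact h₁.card_le R hR
    · exact h₂.card_le R hR
  · rcases Finset.mem_union.1 hv with hv | hv
    · obtain ⟨R, hR, h⟩ := h₁.cover v hv
      exact ⟨R, Finset.mem_union_left _ hR, h⟩
    · obtain ⟨R, hR, h⟩ := h₂.cover v hv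
      exact ⟨R, Finset.mem_union_right _ hR, h⟩
  · rcases hE u hu w hw huw with ⟨h, h'⟩ | ⟨h, h'⟩
    · obtain ⟨R, hR, h⟩ := h₁.edge u h w h' huw
      exact ⟨R, Finset.mem_union_left _ hR, h⟩
    · obtain ⟨R, hR, h⟩ := h₂.edge u h w h' huw
      exact ⟨R, Finset.mem_union_right _ hR, h⟩

lemma exists_fourth_root (n : ℕ) : ∃ t : ℝ, 0 ≤ t ∧ t ^ 4 = n := by
  refine ⟨Real.sqrt (Real.sqrt n), Real.sqrt_nonneg _, ?_⟩
  rw [show 4 = 2 * 2 by rfl, pow_mul, Real.sq_sqrt (Real.sqrt_nonneg _),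
    Real.sq_sqrt (Nat.cast_nonneg _)]

/-- The subtracted multiple of n/t = n^(3/4) pays for future overlaps. Both parts have at least n/5
and at most 4n/5 elements, and (19/20)^4 > 4/5, so their 3/4-th powers add up to at least 20/19 of
that of n. The surplus 40/19 > 2 ≥ 1 + δ covers the new overlap. The condition t ≥ Λ bounds the
subtracted term by δn when the recursion stops, and r ≥ 5Λ^4 keeps both parts above Λ^4. -/
lemma exists_division_aux (hH : ∀ B : Fin h → Set V, ¬ CliqueModel H B) {δ : ℝ} (hδ : 0 < δ)
    (hδ1 : δ ≤ 1) {Λ : ℝ} (hΛ : Λ * δ = 40 * sepConst h) {r : ℕ} (hr : 5 * Λ ^ 4 ≤ r) :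
    ∀ (n : ℕ) (A : Finset V) (t : ℝ), A.card = n → Λ ≤ t → t ^ 4 = n →
      ∃ 𝓡, IsDivision H A r 𝓡 ∧
        (∑ R ∈ 𝓡, (R.card : ℝ)) ≤ (1 + δ) * n - 40 * sepConst h * (n / t) := by
  have hcpos : (0 : ℝ) < sepConst h := by
    have : 0 < sepConst h := by simp [sepConst]
    exact_mod_cast this
  have hΛc : 40 * (sepConst h : ℝ) ≤ Λ := by
    rw [← hΛ]
    have : 0 < Λ := by
      by_contra hcon
      have := mul_nonpos_of_nonpos_of_nonneg (not_lt.1 hcon) hδ.le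
      linarith
    nlinarith
  have hΛ0 : 0 < Λ := by linarith
  intro n
  induction n using Nat.strong_induction_on with
  | _ n ih =>
    intro A t hAn hΛt htn
    have ht0 : 0 < t := by linarith
    by_cases hnr : n ≤ r
    · refine ⟨{A}, IsDivision.singleton (hAn ▸ hnr), ?_⟩
      rw [Finset.sum_singleton, hAn]
      have h1 : 40 * (sepConst h : ℝ) * (n / t) ≤ δ * n := by
        rw [← hΛ, ← mul_div_assoc, div_le_iff₀ ht0]
        have : (0 : ℝ) ≤ δ * n := by positivity
        nlinarith
      linarith
    · obtain ⟨A₁, A₂, hA, hE, hsum, hA1, hA2⟩ := exists_separation_rate hH A (t := t)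
        (by rw [htn, hAn]) (by linarith)
      rw [hAn] at hsum hA1 hA2
      have hnr' : (r : ℝ) < n := by exact_mod_cast not_le.1 hnr
      have hn0 : (0 : ℝ) < n := by
        have : (0 : ℝ) ≤ r := Nat.cast_nonneg _
        linarith
      have hAle : (n : ℝ) ≤ A₁.card + A₂.card := by
        rw [← hAn, ← hA]
        exact_mod_cast Finset.card_union_le A₁ A₂
      have key : ∀ B : Finset V, (B.card : ℝ) ≤ 4 / 5 * n → (n : ℝ) / 5 ≤ B.card →
          ∃ 𝓡, IsDivision H B r 𝓡 ∧ (∑ R ∈ 𝓡, (R.card : ℝ)) ≤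
            (1 + δ) * B.card - 40 * sepConst h * (20 / 19 * (B.card / t)) := by
        intro B hB1 hB2
        obtain ⟨t', ht', htB⟩ := exists_fourth_root B.card
        have hlt : B.card < n := by
          have : (B.card : ℝ) < n := by linarith
          exact_mod_cast this
        have hΛt' : Λ ≤ t' := by
          by_contra hcon
          have : t' ^ 4 < Λ ^ 4 := by
            have := not_le.1 hcon
            gcongr
          linarith
        obtain ⟨𝓡, h1, h2⟩ := ih B.card hlt B t' rfl hΛt' htB
        refine ⟨𝓡, h1, h2.trans ?_⟩
        have ht't : t' ≤ 19 / 20 * t := by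
          by_contra hcon
          have h3 : (19 / 20 * t) ^ 4 < t' ^ 4 := by
            have := not_le.1 hcon
            gcongr
          rw [htB, mul_pow, htn] at h3
          have : (0 : ℝ) < n := hn0
          norm_num at h3
          linarith
        have ht'0 : 0 < t' := by linarith
        have : 20 / 19 * ((B.card : ℝ) / t) ≤ B.card / t' := by
          rw [← mul_div_assoc, div_le_div_iff₀ ht0 ht'0]
          have : (0 : ℝ) ≤ B.card := Nat.cast_nonneg _
          nlinarith
        have := mul_le_mul_of_nonneg_left this (by positivity : (0 : ℝ) ≤ 40 * sepConst h)
        linarith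
      obtain ⟨𝓡₁, hd1, hs1⟩ := key A₁ hA1 (by linarith)
      obtain ⟨𝓡₂, hd2, hs2⟩ := key A₂ hA2 (by linarith)
      refine ⟨𝓡₁ ∪ 𝓡₂, hd1.union hd2 hA hE, ?_⟩
      have hun : ∑ R ∈ 𝓡₁ ∪ 𝓡₂, (R.card : ℝ) ≤
          ∑ R ∈ 𝓡₁, (R.card : ℝ) + ∑ R ∈ 𝓡₂, (R.card : ℝ) := by
        rw [← Finset.sum_union_inter]
        have : 0 ≤ ∑ R ∈ 𝓡₁ ∩ 𝓡₂, (R.card : ℝ) := Finset.sum_nonneg fun _ _ => Nat.cast_nonneg _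
        linarith
      have e1 : (n : ℝ) / t ≤ A₁.card / t + A₂.card / t := by
        rw [← add_div]; gcongr
      obtain ⟨y, hy⟩ : ∃ y : ℝ, y = n / t := ⟨_, rfl⟩
      have hy0 : 0 ≤ sepConst h * y := by rw [hy]; positivity
      have e2 := mul_le_mul_of_nonneg_left e1 (by positivity : (0 : ℝ) ≤ 40 * sepConst h)
      have e3 := mul_le_mul_of_nonneg_left hsum (by positivity : (0 : ℝ) ≤ 1 + δ)
      rw [← hy] at e2 e3 ⊢
      nlinarith

/-- Divisions into regions of bounded size with small total overlap. -/
lemma exists_division (hH : ∀ B : Fin h → Set V, ¬ CliqueModel H B) {δ : ℝ} (hδ : 0 < δ)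
    (hδ1 : δ ≤ 1) {r : ℕ} (hr : 5 * (40 * sepConst h / δ) ^ 4 ≤ (r : ℝ)) (A : Finset V) :
    ∃ 𝓡, IsDivision H A r 𝓡 ∧ (∑ R ∈ 𝓡, (R.card : ℝ)) ≤ (1 + δ) * A.card := by
  by_cases hA : A.card ≤ r
  · refine ⟨{A}, IsDivision.singleton hA, ?_⟩
    rw [Finset.sum_singleton]
    have : (0 : ℝ) ≤ δ * A.card := by positivity
    linarith
  · obtain ⟨t, ht, htA⟩ := exists_fourth_root A.card
    obtain ⟨Λ, hΛ⟩ : ∃ Λ : ℝ, Λ = 40 * sepConst h / δ := ⟨_, rfl⟩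
    have hΛ0 : 0 ≤ Λ := by rw [hΛ]; positivity
    rw [← hΛ] at hr
    have hAr : (r : ℝ) < A.card := by exact_mod_cast not_le.1 hA
    have hΛt : Λ ≤ t := by
      by_contra hcon
      have : t ^ 4 < Λ ^ 4 := by
        have := not_le.1 hcon
        gcongr
      have : 0 ≤ Λ ^ 4 := by positivity
      linarith
    obtain ⟨𝓡, h1, h2⟩ := exists_division_aux hH hδ hδ1 (by rw [hΛ]; field_simp) hr _ A t rfl hΛt htA
    refine ⟨𝓡, h1, h2.trans ?_⟩
    have : (0 : ℝ) ≤ 40 * sepConst h * (A.card / t) := by positivity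
    linarith

end Division

/-! ### Pseudometrics and distance to a set -/

section Metric

/-- Pseudometrics, as bare functions. -/
structure IsPseudometric {X : Type u} (d : X → X → ℝ) : Prop where
  nonneg : ∀ a b, 0 ≤ d a b
  self : ∀ a, d a a = 0
  symm : ∀ a b, d a b = d b a
  tri : ∀ a b c, d a c ≤ d a b + d b c

/-- Distance to the nearest element of `S`. -/
noncomputable def nearDist {X : Type u} (d : X → X → ℝ) (S : Finset X) (c : X) : ℝ :=
  ⨅ x : {x // x ∈ S}, d c x

variable {X : Type u} {d : X → X → ℝ} {S : Finset X} {c : X}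

lemma nearDist_le {x : X} (hx : x ∈ S) : nearDist d S c ≤ d c x :=
  ciInf_le (Set.finite_range _).bddBelow (⟨x, hx⟩ : {x // x ∈ S})

lemma exists_nearDist_eq (hS : S.Nonempty) (c : X) : ∃ x ∈ S, nearDist d S c = d c x := by
  have : Nonempty {x // x ∈ S} := hS.to_subtype
  obtain ⟨x, hx⟩ := exists_eq_ciInf_of_finite (f := fun x : {x // x ∈ S} => d c x)
  exact ⟨x, x.2, hx.symm⟩

lemma IsPseudometric.nearDist_nonneg (hd : IsPseudometric d) : 0 ≤ nearDist d S c :=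
  Real.iInf_nonneg fun _ => hd.nonneg _ _

end Metric

/-! ### Shortest-path distance as an infimum over walks -/

section ShortestPath

variable {V : Type u} {G : SimpleGraph V} {w : Sym2 V → ℝ}

lemma walkLength_cons {a b c : V} (h : G.Adj a b) (q : G.Walk b c) :
    walkLength w (SimpleGraph.Walk.cons h q) = w s(a, b) + walkLength w q := by
  simp [walkLength]

lemma walkLength_append {a b c : V} (q : G.Walk a b) (q' : G.Walk b c) :
    walkLength w (q.append q') = walkLength w q + walkLength w q' := by
  simp [walkLength]

lemma walkLength_reverse {a b : V} (q : G.Walk a b) :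
    walkLength w q.reverse = walkLength w q := by
  simp [walkLength, List.sum_reverse]

lemma walkLength_nonneg (hw : ∀ e ∈ G.edgeSet, 0 ≤ w e) {a b : V} (q : G.Walk a b) :
    0 ≤ walkLength w q := by
  refine List.sum_nonneg fun x hx => ?_
  obtain ⟨e, he, rfl⟩ := List.mem_map.1 hx
  exact hw e (q.edges_subset_edgeSet he)

/-- Removing detours from a walk only deletes edges of nonnegative weight. With
`le_shortestPathDist`, paths can be replaced by arbitrary walks from here on. -/
lemma shortestPathDist_le (hw : ∀ e ∈ G.edgeSet, 0 ≤ w e) {a b : V} (q : G.Walk a b) :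
    shortestPathDist G w a b ≤ walkLength w q := by
  classical
  have h1 : walkLength w q.bypass ≤ walkLength w q := by
    refine List.Sublist.sum_le_sum (q.edges_bypass_sublist_edges.map w) fun x hx => ?_
    obtain ⟨e, he, rfl⟩ := List.mem_map.1 hx
    exact hw e (q.edges_subset_edgeSet he)
  refine (ciInf_le ⟨0, ?_⟩ (⟨q.bypass, q.bypass_isPath⟩ : G.Path a b)).trans h1
  rintro _ ⟨q, rfl⟩
  exact walkLength_nonneg hw _

lemma le_shortestPathDist (hG : G.Connected) {a b : V} {x : ℝ}
    (h : ∀ q : G.Walk a b, x ≤ walkLength w q) : x ≤ shortestPathDist G w a b := by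
  classical
  obtain ⟨q⟩ := hG.preconnected a b
  have : Nonempty (G.Path a b) := ⟨⟨q.bypass, q.bypass_isPath⟩⟩
  exact le_ciInf fun q => h q

lemma isPseudometric_shortestPathDist (hG : G.Connected) (hw : ∀ e ∈ G.edgeSet, 0 ≤ w e) :
    IsPseudometric (shortestPathDist G w) := by
  have hsymm : ∀ a b, shortestPathDist G w a b ≤ shortestPathDist G w b a := fun a b =>
    le_shortestPathDist hG fun q => (shortestPathDist_le hw q.reverse).trans
      (walkLength_reverse q).le
  have hnn : ∀ a b, 0 ≤ shortestPathDist G w a b := fun a b =>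
    le_shortestPathDist hG fun q => walkLength_nonneg hw q
  refine ⟨hnn, fun a => le_antisymm ?_ (hnn a a), fun a b => le_antisymm (hsymm a b) (hsymm b a),
    fun a b c => ?_⟩
  · exact (shortestPathDist_le hw (SimpleGraph.Walk.nil : G.Walk a a)).trans
      (by simp [walkLength])
  · rw [← sub_le_iff_le_add]
    refine le_shortestPathDist hG fun q => ?_
    rw [sub_le_iff_le_add, ← sub_le_iff_le_add']
    refine le_shortestPathDist hG fun q' => ?_
    rw [sub_le_iff_le_add', ← walkLength_append]
    exact shortestPathDist_le hw _

lemma shortestPathDist_adj_le (hG : G.Connected) (hw : ∀ e ∈ G.edgeSet, 0 ≤ w e) {a b : V}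
    (h : G.Adj a b) (c : V) :
    shortestPathDist G w a c ≤ w s(a, b) + shortestPathDist G w b c := by
  rw [← sub_le_iff_le_add']
  refine le_shortestPathDist hG fun q => ?_
  rw [sub_le_iff_le_add', ← walkLength_cons h]
  exact shortestPathDist_le hw _

end ShortestPath

/-! ### Voronoi cells and the contracted graph -/

section Voronoi
open scoped Classical

variable {V : Type u} {G : SimpleGraph V} {w : Sym2 V → ℝ} {d : V → V → ℝ}
  {F : Finset V} {cell : V → V}

/-- A Voronoi partition on the set `A` of vertices, with connected cells. -/
structure IsVoronoiOn (G : SimpleGraph V) (d : V → V → ℝ) (F A : Finset V) (cell : V → V) :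
    Prop where
  mem : ∀ v ∈ A, cell v ∈ F
  self : ∀ f ∈ F, cell f = f
  near : ∀ v ∈ A, ∀ f ∈ F, d v (cell v) ≤ d v f
  conn : ∀ f ∈ F, ConnOn G {v | v ∈ A ∧ cell v = f}

/-- Dijkstra's algorithm: the edge x–a leaving `A` that minimizes its weight plus the distance from
a to its center adds x to the cell of a. Growing cells along edges keeps them connected even in the
presence of ties and zero weights. -/
lemma IsVoronoiOn.exists_extension [Fintype V] (hG : G.Connected)
    (hw : ∀ e ∈ G.edgeSet, 0 ≤ w e) (hF : F.Nonempty) :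
    ∀ (n : ℕ) (A : Finset V) (cell : V → V), Aᶜ.card = n → F ⊆ A →
      IsVoronoiOn G (shortestPathDist G w) F A cell →
      ∃ cell, IsVoronoiOn G (shortestPathDist G w) F Finset.univ cell := by
  intro n
  induction n with
  | zero =>
    intro A cell hA hFA hv
    have : A = Finset.univ := by
      rwa [Finset.card_eq_zero, Finset.compl_eq_empty_iff] at hA
    exact ⟨cell, this ▸ hv⟩
  | succ n ih =>
    intro A cell hA hFA hv
    obtain ⟨x₀, hx₀⟩ := Finset.card_pos.1 (by omega : 0 < Aᶜ.card)
    have hx₀A : x₀ ∉ A := Finset.mem_compl.1 hx₀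
    let E : Finset (V × V) := Finset.univ.filter fun e => e.1 ∈ A ∧ e.2 ∉ A ∧ G.Adj e.2 e.1
    have hE : E.Nonempty := by
      obtain ⟨f, hf⟩ := hF
      obtain ⟨q⟩ := hG.preconnected f x₀
      obtain ⟨e, -, h1, h2⟩ := q.exists_boundary_dart (A : Set V) (hFA hf) hx₀A
      exact ⟨(e.fst, e.snd), Finset.mem_filter.2 ⟨Finset.mem_univ _, h1, h2, e.adj.symm⟩⟩
    obtain ⟨⟨a, x⟩, hax, hmin⟩ := E.exists_min_image
      (fun e => w s(e.2, e.1) + shortestPathDist G w e.1 (cell e.1)) hE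
    obtain ⟨-, haA, hxA, hadj⟩ := Finset.mem_filter.1 hax
    simp only at haA hxA hadj hmin
    -- The first edge of the walk that enters `A` takes part in the minimum, and from its end in `A`
    -- the rest of the walk is at least as long as the distance to the center of the cell.
    have hwalk : ∀ f ∈ F, ∀ {y z : V} (q : G.Walk y z), z = f → y ∉ A →
        w s(x, a) + shortestPathDist G w a (cell a) ≤ walkLength w q := by
      intro f hf y z q
      induction q with
      | nil => rintro rfl h; exact absurd (hFA hf) h
      | @cons y y' z hyy' q ihq =>
        intro hz hy
        rw [walkLength_cons]
        by_cases hy' : y' ∈ A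
        · have h1 := hmin (y', y) (Finset.mem_filter.2 ⟨Finset.mem_univ _, hy', hy, hyy'⟩)
          have h2 := hv.near y' hy' f hf
          have h3 := shortestPathDist_le hw q
          subst hz
          simp only at h1
          linarith
        · have h1 := ihq hz hy'
          have h2 : 0 ≤ w s(y, y') := hw _ hyy'
          linarith
    have hxF : ∀ f ∈ F, f ≠ x := fun f hf h => hxA (h ▸ hFA hf)
    have hne : ∀ v ∈ A, Function.update cell x (cell a) v = cell v := fun v hv =>
      Function.update_of_ne (by rintro rfl; exact hxA hv) _ _
    have hupx : Function.update cell x (cell a) x = cell a := Function.update_self _ _ _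
    refine ih (insert x A) (Function.update cell x (cell a)) ?_ (hFA.trans (Finset.subset_insert _ _))
      ⟨?_, ?_, ?_, ?_⟩
    · rw [Finset.compl_insert, Finset.card_erase_of_mem (Finset.mem_compl.2 hxA), hA]; rfl
    · intro v hv'
      rcases Finset.mem_insert.1 hv' with rfl | hv'
      · rw [hupx]; exact hv.mem a haA
      · rw [hne v hv']; exact hv.mem v hv'
    · intro f hf
      rw [hne f (hFA hf)]; exact hv.self f hf
    · intro v hv' f hf
      rcases Finset.mem_insert.1 hv' with rfl | hv'
      · rw [hupx]
        refine (shortestPathDist_adj_le hG hw hadj _).trans ?_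
        exact le_shortestPathDist hG fun q => hwalk f hf q rfl hxA
      · rw [hne v hv']; exact hv.near v hv' f hf
    · intro f hf
      by_cases hfa : cell a = f
      · have : {v | v ∈ insert x A ∧ Function.update cell x (cell a) v = f} =
            insert x {v | v ∈ A ∧ cell v = f} := by
          ext v
          simp only [Finset.mem_insert, Set.mem_ofPred_eq, Set.mem_insert_iff]
          by_cases h : v = x
          · subst h; simp [hfa]
          · simp [h]
        rw [this]
        exact (hv.conn f hf).insert_adj (x := a) ⟨haA, hfa⟩ hadj.symm
      · have : {v | v ∈ insert x A ∧ Function.update cell x (cell a) v = f} =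
            {v | v ∈ A ∧ cell v = f} := by
          ext v
          simp only [Finset.mem_insert, Set.mem_ofPred_eq]
          by_cases h : v = x
          · subst h; simp [hfa, hxA]
          · simp [h]
        rw [this]
        exact hv.conn f hf

lemma exists_isVoronoiOn [Fintype V] (hG : G.Connected) (hw : ∀ e ∈ G.edgeSet, 0 ≤ w e)
    (hF : F.Nonempty) : ∃ cell, IsVoronoiOn G (shortestPathDist G w) F Finset.univ cell := by
  have hd := isPseudometric_shortestPathDist hG hw
  refine IsVoronoiOn.exists_extension hG hw hF _ F id rfl (Finset.Subset.refl F)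
    ⟨fun v hv => hv, fun f _ => rfl, fun v _ f _ => ?_, fun f hf => ?_⟩
  · rw [id, hd.self]; exact hd.nonneg _ _
  · have : {v | v ∈ F ∧ id v = f} = {f} := by
      ext v
      simp only [id, Set.mem_ofPred_eq, Set.mem_singleton_iff]
      exact ⟨fun h => h.2, fun h => ⟨h ▸ hf, h⟩⟩
    rw [this]
    exact ConnOn.singleton G f

/-- The graph obtained by contracting the cells. -/
def cellGraph (G : SimpleGraph V) (cell : V → V) : SimpleGraph V where
  Adj f f' := f ≠ f' ∧ ∃ x y, G.Adj x y ∧ cell x = f ∧ cell y = f'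
  symm := ⟨fun _ _ ⟨h, x, y, hxy, hx, hy⟩ => ⟨h.symm, y, x, hxy.symm, hy, hx⟩⟩
  loopless := ⟨fun _ h => h.1 rfl⟩

/-- Cells are connected, so preimages of connected sets under `cell` are connected and a model in
the contracted graph lifts to `G`. -/
lemma cellGraph_no_cliqueModel [Fintype V] [Nonempty V]
    (hv : IsVoronoiOn G d F Finset.univ cell) {h : ℕ}
    (hG : ∀ B : Fin h → Set V, ¬ CliqueModel G B) (B : Fin h → Set V) :
    ¬ CliqueModel (cellGraph G cell) B := by
  intro hB
  -- A branch set might consist of vertices that name no cell. With two indices, adjacency makes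
  -- every preimage nonempty; with at most one index a single vertex is already a model in `G`.
  by_cases hsub : ∀ i j : Fin h, i = j
  · obtain ⟨v⟩ := ‹Nonempty V›
    exact hG (fun _ => {v}) ⟨fun _ => ⟨v, rfl⟩, fun _ => ConnOn.singleton G v,
      fun i j hij => absurd (hsub i j) hij, fun i j hij => absurd (hsub i j) hij⟩
  push Not at hsub
  obtain ⟨i₁, i₂, h12⟩ := hsub
  have hcellconn : ∀ f x y, cell x = f → cell y = f →
      Relation.ReflTransGen (fun a b => G.Adj a b ∧ cell a = f ∧ cell b = f) x y := by
    intro f x y hx hy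
    have hf : f ∈ F := hx ▸ hv.mem x (Finset.mem_univ x)
    have := hv.conn f hf x ⟨Finset.mem_univ _, hx⟩ y ⟨Finset.mem_univ _, hy⟩
    exact Relation.ReflTransGen.mono (fun a b h => ⟨h.1, h.2.1.2, h.2.2.2⟩) _ _ this
  refine hG (fun i => cell ⁻¹' (B i)) ⟨fun i => ?_, fun i => ?_, fun i j hij => ?_, fun i j hij => ?_⟩
  · have : ∃ j, i ≠ j := by
      by_cases h : i = i₁
      · exact ⟨i₂, h ▸ h12⟩
      · exact ⟨i₁, h⟩
    obtain ⟨j, hj⟩ := this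
    obtain ⟨f, hf, f', -, -, x, y, -, hx, -⟩ := hB.adj i j hj
    exact ⟨x, by rw [Set.mem_preimage, hx]; exact hf⟩
  · intro x hx y hy
    have key : ∀ f', Relation.ReflTransGen
        (fun a b => (cellGraph G cell).Adj a b ∧ a ∈ B i ∧ b ∈ B i) (cell x) f' →
        ∀ z, cell z = f' → Relation.ReflTransGen
          (fun a b => G.Adj a b ∧ a ∈ cell ⁻¹' (B i) ∧ b ∈ cell ⁻¹' (B i)) x z := by
      intro f' hf'
      have inner : ∀ f ∈ B i, ∀ s t, cell s = f → cell t = f → Relation.ReflTransGen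
          (fun a b => G.Adj a b ∧ a ∈ cell ⁻¹' (B i) ∧ b ∈ cell ⁻¹' (B i)) s t := by
        intro f hf s t hs ht
        refine Relation.ReflTransGen.mono (fun a b h => ⟨h.1, ?_, ?_⟩) _ _ (hcellconn f s t hs ht)
        · rw [Set.mem_preimage, h.2.1]; exact hf
        · rw [Set.mem_preimage, h.2.2]; exact hf
      induction hf' with
      | refl => exact fun z hz => inner _ hx x z rfl hz
      | tail _ hst ih =>
        intro z hz
        obtain ⟨⟨-, s, t, hadj, hs, ht⟩, hB1, hB2⟩ := hst
        refine (ih s hs).trans (Relation.ReflTransGen.head ⟨hadj, ?_, ?_⟩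
          (inner _ hB2 t z ht hz))
        · rw [Set.mem_preimage, hs]; exact hB1
        · rw [Set.mem_preimage, ht]; exact hB2
    exact key (cell y) (hB.conn i _ hx _ hy) y rfl
  · exact (hB.disj i j hij).preimage cell
  · obtain ⟨f, hf, f', hf', -, x, y, hxy, rfl, rfl⟩ := hB.adj i j hij
    exact ⟨x, hf, y, hf', hxy⟩

end Voronoi

/-! ### Exchanging centers region by region -/

section Exchange
open scoped Classical

variable {V : Type u} {G : SimpleGraph V} {w : Sym2 V → ℝ} {F L M : Finset V} {cell : V → V}
  {r : ℕ} {𝓡 J : Finset (Finset V)}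

/-- Vertices that lie in at least two regions. -/
noncomputable def boundaryOf (𝓡 : Finset (Finset V)) : Finset V :=
  (𝓡.biUnion id).filter fun v => ∃ R ∈ 𝓡, ∃ R' ∈ 𝓡, R ≠ R' ∧ v ∈ R ∧ v ∈ R'

lemma eq_of_notMem_boundaryOf {R R' : Finset V} (hR : R ∈ 𝓡) (hR' : R' ∈ 𝓡) {v : V} (hv : v ∈ R)
    (hv' : v ∈ R') (hb : v ∉ boundaryOf 𝓡) : R = R' := by
  by_contra h
  exact hb (Finset.mem_filter.2 ⟨Finset.mem_biUnion.2 ⟨R, hR, hv⟩, R, hR, R', hR', h, hv, hv'⟩)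

/-- A walk that ends outside the interior of a region passes by its boundary. -/
lemma exists_boundary_of_walk_out [Fintype V]
    (hG : G.Connected) (hw : ∀ e ∈ G.edgeSet, 0 ≤ w e)
    (hv : IsVoronoiOn G (shortestPathDist G w) F Finset.univ cell)
    (hdiv : IsDivision (cellGraph G cell) F r 𝓡) {R : Finset V} (hR : R ∈ 𝓡) {x z : V}
    (q : G.Walk x z) : z ∈ F → (z ∈ R → z ∈ boundaryOf 𝓡) → cell x ∈ R →
    ∃ b ∈ R, b ∈ boundaryOf 𝓡 ∧ shortestPathDist G w x b ≤ walkLength w q := by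
  induction q with
  | @nil x =>
    intro hz hzR hx
    rw [hv.self x hz] at hx
    exact ⟨x, hx, hzR hx, shortestPathDist_le hw _⟩
  | @cons x y z hxy q ih =>
    intro hz hzR hx
    -- From inside the cell of a boundary vertex, that vertex is no farther than z by the Voronoi
    -- property. Before such a cell is met, no edge of the walk leaves `R`, as a non-boundary vertex
    -- lies in one region only.
    by_cases hb : cell x ∈ boundaryOf 𝓡
    · exact ⟨cell x, hx, hb, (hv.near x (Finset.mem_univ _) z hz).trans
        (shortestPathDist_le hw _)⟩
    · have hy : cell y ∈ R := by
        by_cases h : cell x = cell y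
        · exact h ▸ hx
        · obtain ⟨R', hR', h1, h2⟩ := hdiv.edge _ (hv.mem x (Finset.mem_univ _)) _
            (hv.mem y (Finset.mem_univ _)) ⟨h, x, y, hxy, rfl, rfl⟩
          rwa [eq_of_notMem_boundaryOf hR hR' hx h1 hb]
      obtain ⟨b, h1, h2, h3⟩ := ih hz hzR hy
      refine ⟨b, h1, h2, (shortestPathDist_adj_le hG hw hxy b).trans ?_⟩
      rw [walkLength_cons]
      linarith

/-- A walk into the interior of a region passes by its boundary. -/
lemma exists_boundary_of_walk_in [Fintype V]
    (hG : G.Connected) (hw : ∀ e ∈ G.edgeSet, 0 ≤ w e)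
    (hv : IsVoronoiOn G (shortestPathDist G w) F Finset.univ cell)
    (hdiv : IsDivision (cellGraph G cell) F r 𝓡) {R : Finset V} (hR : R ∈ 𝓡) {x z : V}
    (q : G.Walk x z) : z ∈ F → z ∈ R → z ∉ boundaryOf 𝓡 → (cell x ∈ R → cell x ∈ boundaryOf 𝓡) →
    ∃ b ∈ R, b ∈ boundaryOf 𝓡 ∧ shortestPathDist G w x b ≤ walkLength w q := by
  induction q with
  | @nil x =>
    intro hz hzR hzb hx
    rw [hv.self x hz] at hx
    exact absurd (hx hzR) hzb
  | @cons x y z hxy q ih =>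
    intro hz hzR hzb hx
    -- A first entry into `R` is through a boundary vertex: an edge of the cell graph from outside
    -- `R` to a vertex of no other region would be contained in no region.
    by_cases hxR : cell x ∈ R
    · exact ⟨cell x, hxR, hx hxR, (hv.near x (Finset.mem_univ _) z hz).trans
        (shortestPathDist_le hw _)⟩
    · have hy : cell y ∈ R → cell y ∈ boundaryOf 𝓡 := by
        intro hyR
        by_contra hb
        by_cases h : cell x = cell y
        · exact hxR (h ▸ hyR)
        · obtain ⟨R', hR', h1, h2⟩ := hdiv.edge _ (hv.mem x (Finset.mem_univ _)) _
            (hv.mem y (Finset.mem_univ _)) ⟨h, x, y, hxy, rfl, rfl⟩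
          rw [eq_of_notMem_boundaryOf hR hR' hyR h2 hb] at hxR
          exact hxR h1
      obtain ⟨b, h1, h2, h3⟩ := ih hz hzR hzb hy
      refine ⟨b, h1, h2, (shortestPathDist_adj_le hG hw hxy b).trans ?_⟩
      rw [walkLength_cons]
      linarith

/-- The solution obtained from `L` by exchange with `M` in the regions of `J`. -/
noncomputable def exchangeSet (L M : Finset V) (𝓡 J : Finset (Finset V)) : Finset V :=
  (L \ J.biUnion id) ∪ (J.biUnion id ∩ (M ∪ boundaryOf 𝓡))

/-- Only a center m of `M` outside `L` and outside the exchanged regions is missing from the new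
solution. The walk to it leaves `R`, and the boundary vertex it passes is open. -/
lemma exists_mem_exchangeSet_of_mem [Fintype V]
    (hG : G.Connected) (hw : ∀ e ∈ G.edgeSet, 0 ≤ w e)
    (hv : IsVoronoiOn G (shortestPathDist G w) ((L \ M) ∪ (M \ L)) Finset.univ cell)
    (hdiv : IsDivision (cellGraph G cell) ((L \ M) ∪ (M \ L)) r 𝓡) (hJ : J ⊆ 𝓡)
    {R : Finset V} (hR : R ∈ J) {c m : V} (hc : cell c ∈ R) (hm : m ∈ M) (q : G.Walk c m) :
    ∃ b ∈ exchangeSet L M 𝓡 J, shortestPathDist G w c b ≤ walkLength w q := by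
  by_cases hmU : m ∈ J.biUnion id
  · exact ⟨m, Finset.mem_union_right _ (Finset.mem_inter.2
      ⟨hmU, Finset.mem_union_left _ hm⟩), shortestPathDist_le hw q⟩
  by_cases hmL : m ∈ L
  · exact ⟨m, Finset.mem_union_left _ (Finset.mem_sdiff.2 ⟨hmL, hmU⟩), shortestPathDist_le hw q⟩
  · obtain ⟨b, h1, h2, h3⟩ := exists_boundary_of_walk_out hG hw hv hdiv (hJ hR) q
      (Finset.mem_union_right _ (Finset.mem_sdiff.2 ⟨hm, hmL⟩))
      (fun h => absurd (Finset.mem_biUnion.2 ⟨R, hR, h⟩) hmU) hc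
    exact ⟨b, Finset.mem_union_right _ (Finset.mem_inter.2
      ⟨Finset.mem_biUnion.2 ⟨R, hR, h1⟩, Finset.mem_union_right _ h2⟩), h3⟩

/-- Only centers of `L` in the interior of an exchanged region are closed. A walk to one of them
starts outside that interior and passes an open boundary vertex. -/
lemma exists_mem_exchangeSet_of_notMem [Fintype V]
    (hG : G.Connected) (hw : ∀ e ∈ G.edgeSet, 0 ≤ w e)
    (hv : IsVoronoiOn G (shortestPathDist G w) ((L \ M) ∪ (M \ L)) Finset.univ cell)
    (hdiv : IsDivision (cellGraph G cell) ((L \ M) ∪ (M \ L)) r 𝓡) (hJ : J ⊆ 𝓡)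
    {c l : V} (hc : ∀ R ∈ J, cell c ∈ R → cell c ∈ boundaryOf 𝓡) (hl : l ∈ L) (q : G.Walk c l) :
    ∃ b ∈ exchangeSet L M 𝓡 J, shortestPathDist G w c b ≤ walkLength w q := by
  by_cases hlU : l ∈ J.biUnion id
  · by_cases hlb : l ∈ M ∪ boundaryOf 𝓡
    · exact ⟨l, Finset.mem_union_right _ (Finset.mem_inter.2 ⟨hlU, hlb⟩), shortestPathDist_le hw q⟩
    · simp only [Finset.mem_union, not_or] at hlb
      obtain ⟨R, hR, hlR⟩ := Finset.mem_biUnion.1 hlU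
      obtain ⟨b, h1, h2, h3⟩ := exists_boundary_of_walk_in hG hw hv hdiv (hJ hR) q
        (Finset.mem_union_left _ (Finset.mem_sdiff.2 ⟨hl, hlb.1⟩)) hlR hlb.2 (hc R hR)
      exact ⟨b, Finset.mem_union_right _ (Finset.mem_inter.2
        ⟨Finset.mem_biUnion.2 ⟨R, hR, h1⟩, Finset.mem_union_right _ h2⟩), h3⟩
  · exact ⟨l, Finset.mem_union_left _ (Finset.mem_sdiff.2 ⟨hl, hlU⟩), shortestPathDist_le hw q⟩

/-- Change of the number of centers caused by the exchange in a region. -/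
noncomputable def regionExcess (L M : Finset V) (𝓡 : Finset (Finset V)) (R : Finset V) : ℤ :=
  (R ∩ M).card + (R ∩ boundaryOf 𝓡).card - ((R \ boundaryOf 𝓡) ∩ L).card

/-- Non-boundary parts of distinct regions are disjoint, so each center of `L` is subtracted at most
once; counting opened centers repeatedly only weakens the bound. -/
lemma card_exchangeSet_le (hJ : J ⊆ 𝓡) :
    ((exchangeSet L M 𝓡 J).card : ℤ) ≤ L.card + ∑ R ∈ J, regionExcess L M 𝓡 R := by
  have hdisj : ∀ R ∈ J, ∀ R' ∈ J, R ≠ R' →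
      Disjoint ((R \ boundaryOf 𝓡) ∩ L) ((R' \ boundaryOf 𝓡) ∩ L) := by
    intro R hR R' hR' hne
    rw [Finset.disjoint_left]
    intro v hv hv'
    simp only [Finset.mem_inter, Finset.mem_sdiff] at hv hv'
    exact hne (eq_of_notMem_boundaryOf (hJ hR) (hJ hR') hv.1.1 hv'.1.1 hv.1.2)
  have h1 : exchangeSet L M 𝓡 J ⊆
      ((L \ J.biUnion fun R => (R \ boundaryOf 𝓡) ∩ L) ∪ J.biUnion fun R => R ∩ M) ∪
        J.biUnion fun R => R ∩ boundaryOf 𝓡 := by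
    intro v hv
    rcases Finset.mem_union.1 hv with hv | hv
    · obtain ⟨hvL, hvU⟩ := Finset.mem_sdiff.1 hv
      refine Finset.mem_union_left _ (Finset.mem_union_left _ (Finset.mem_sdiff.2 ⟨hvL, fun h => ?_⟩))
      obtain ⟨R, hR, h⟩ := Finset.mem_biUnion.1 h
      exact hvU (Finset.mem_biUnion.2
        ⟨R, hR, (Finset.mem_sdiff.1 (Finset.mem_inter.1 h).1).1⟩)
    · obtain ⟨hvU, hv⟩ := Finset.mem_inter.1 hv
      obtain ⟨R, hR, hvR⟩ := Finset.mem_biUnion.1 hvU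
      rcases Finset.mem_union.1 hv with hv | hv
      · exact Finset.mem_union_left _ (Finset.mem_union_right _
          (Finset.mem_biUnion.2 ⟨R, hR, Finset.mem_inter.2 ⟨hvR, hv⟩⟩))
      · exact Finset.mem_union_right _
          (Finset.mem_biUnion.2 ⟨R, hR, Finset.mem_inter.2 ⟨hvR, hv⟩⟩)
  have h2 : (L \ J.biUnion fun R => (R \ boundaryOf 𝓡) ∩ L).card +
      ∑ R ∈ J, ((R \ boundaryOf 𝓡) ∩ L).card = L.card := by
    rw [← Finset.card_biUnion hdisj]
    exact Finset.card_sdiff_add_card_eq_card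
      (Finset.biUnion_subset.2 fun R _ => Finset.inter_subset_right)
  have h3 := Finset.card_le_card h1
  have h4 := Finset.card_union_le
    ((L \ J.biUnion fun R => (R \ boundaryOf 𝓡) ∩ L) ∪ J.biUnion fun R => R ∩ M)
    (J.biUnion fun R => R ∩ boundaryOf 𝓡)
  have h5 := Finset.card_union_le (L \ J.biUnion fun R => (R \ boundaryOf 𝓡) ∩ L)
    (J.biUnion fun R => R ∩ M)
  have h6 : (J.biUnion fun R => R ∩ M).card ≤ ∑ R ∈ J, (R ∩ M).card := Finset.card_biUnion_le
  have h7 : (J.biUnion fun R => R ∩ boundaryOf 𝓡).card ≤ ∑ R ∈ J, (R ∩ boundaryOf 𝓡).card :=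
    Finset.card_biUnion_le
  have h8 : ∑ R ∈ J, regionExcess L M 𝓡 R = ((∑ R ∈ J, (R ∩ M).card : ℕ) : ℤ) +
      ((∑ R ∈ J, (R ∩ boundaryOf 𝓡).card : ℕ) : ℤ) -
      ((∑ R ∈ J, ((R \ boundaryOf 𝓡) ∩ L).card : ℕ) : ℤ) := by
    simp only [regionExcess, Finset.sum_sub_distrib, Finset.sum_add_distrib]
    push_cast
    rfl
  rw [h8]
  omega

/-- The bound holds vertex by vertex, with `μ v` the number of regions containing v. Interior
vertices have `μ v` = 1 and contribute exactly ±1. Boundary vertices contribute 2μ (in `M`) or μ (in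
`L`), at most ±1 + 4(μ − 1) since μ ≥ 2. -/
lemma sum_regionExcess_le (hsub : ∀ R ∈ 𝓡, R ⊆ (L \ M) ∪ (M \ L))
    (hcov : ∀ v ∈ (L \ M) ∪ (M \ L), ∃ R ∈ 𝓡, v ∈ R) :
    ∑ R ∈ 𝓡, regionExcess L M 𝓡 R ≤
      M.card - L.card + 4 * (∑ R ∈ 𝓡, (R.card : ℤ) - ((L \ M) ∪ (M \ L)).card) := by
  set F := (L \ M) ∪ (M \ L) with hF
  have hcard : ∀ R ∈ 𝓡, ∀ P : Finset V, ((R ∩ P).card : ℤ) =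
      ∑ v ∈ F, if v ∈ R then (if v ∈ P then (1 : ℤ) else 0) else 0 := by
    intro R hR P
    have : R ∩ P = F.filter fun v => v ∈ R ∧ v ∈ P := by
      ext v
      simp only [Finset.mem_inter, Finset.mem_filter]
      exact ⟨fun h => ⟨hsub R hR h.1, h⟩, fun h => h.2⟩
    rw [this, Finset.card_filter]
    push_cast
    refine Finset.sum_congr rfl fun v _ => ?_
    split_ifs <;> tauto
  have hcard' : ∀ R ∈ 𝓡, (((R \ boundaryOf 𝓡) ∩ L).card : ℤ) =
      ∑ v ∈ F, if v ∈ R then (if v ∈ L \ boundaryOf 𝓡 then (1 : ℤ) else 0) else 0 := by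
    intro R hR
    rw [← hcard R hR]
    congr 2
    ext v
    simp only [Finset.mem_inter, Finset.mem_sdiff]
    tauto
  have hcard1 : ∀ R ∈ 𝓡, (R.card : ℤ) = ∑ v ∈ F, if v ∈ R then (1 : ℤ) else 0 := by
    intro R hR
    have := hcard R hR R
    rw [Finset.inter_self] at this
    rw [this]
    refine Finset.sum_congr rfl fun v _ => ?_
    split_ifs <;> rfl
  let g : V → ℤ := fun v => (if v ∈ M then (1 : ℤ) else 0) +
    (if v ∈ boundaryOf 𝓡 then (1 : ℤ) else 0) - if v ∈ L \ boundaryOf 𝓡 then (1 : ℤ) else 0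
  let μ : V → ℤ := fun v => ∑ R ∈ 𝓡, if v ∈ R then (1 : ℤ) else 0
  have h1 : ∑ R ∈ 𝓡, regionExcess L M 𝓡 R = ∑ v ∈ F, μ v * g v := by
    have : ∀ R ∈ 𝓡, regionExcess L M 𝓡 R = ∑ v ∈ F, (if v ∈ R then (1 : ℤ) else 0) * g v := by
      intro R hR
      rw [regionExcess, hcard R hR, hcard R hR, hcard' R hR, ← Finset.sum_add_distrib,
        ← Finset.sum_sub_distrib]
      refine Finset.sum_congr rfl fun v _ => ?_
      by_cases h : v ∈ R <;> simp [h, g]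
    rw [Finset.sum_congr rfl this, Finset.sum_comm]
    simp only [μ, Finset.sum_mul]
  have h2 : ∑ R ∈ 𝓡, (R.card : ℤ) = ∑ v ∈ F, μ v := by
    rw [Finset.sum_congr rfl hcard1, Finset.sum_comm]
  have h3 : (M.card : ℤ) - L.card =
      ∑ v ∈ F, ((if v ∈ M then (1 : ℤ) else 0) - if v ∈ L then (1 : ℤ) else 0) := by
    have e1 : F.filter (fun v => v ∈ M) = M \ L := by
      ext v; simp only [hF, Finset.mem_filter, Finset.mem_union, Finset.mem_sdiff]; tauto
    have e2 : F.filter (fun v => v ∈ L) = L \ M := by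
      ext v; simp only [hF, Finset.mem_filter, Finset.mem_union, Finset.mem_sdiff]; tauto
    rw [Finset.sum_sub_distrib, Finset.sum_boole, Finset.sum_boole, e1, e2]
    have a1 := Finset.card_sdiff_add_card_inter M L
    have a2 := Finset.card_sdiff_add_card_inter L M
    rw [Finset.inter_comm] at a2
    omega
  have h4 : (F.card : ℤ) = ∑ v ∈ F, (1 : ℤ) := by simp
  rw [h1, h2, h3, h4, ← Finset.sum_sub_distrib, Finset.mul_sum, ← Finset.sum_add_distrib]
  refine Finset.sum_le_sum fun v hv => ?_
  obtain ⟨R, hR, hvR⟩ := hcov v hv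
  have hμ1 : 1 ≤ μ v := by
    have := Finset.single_le_sum (f := fun R => if v ∈ R then (1 : ℤ) else 0)
      (fun R _ => by split_ifs <;> norm_num) hR
    simp only [hvR, if_true] at this
    exact this
  have hLM : (v ∈ L ∧ v ∉ M) ∨ (v ∈ M ∧ v ∉ L) := by
    simpa [hF] using hv
  by_cases hb : v ∈ boundaryOf 𝓡
  · have hμ2 : 2 ≤ μ v := by
      obtain ⟨-, R, hR, R', hR', hne, h1, h2⟩ := Finset.mem_filter.1 hb
      have := Finset.sum_le_sum_of_subset_of_nonneg (f := fun R => if v ∈ R then (1 : ℤ) else 0)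
        (Finset.insert_subset hR (Finset.singleton_subset_iff.2 hR'))
        (fun R _ _ => by split_ifs <;> norm_num)
      rw [Finset.sum_pair hne] at this
      simp only [h1, h2, if_true] at this
      exact this
    rcases hLM with ⟨h1, h2⟩ | ⟨h1, h2⟩ <;> simp [g, h1, h2, hb] <;> omega
  · have hμ : μ v = 1 := by
      have : ∀ R' ∈ 𝓡, R' ≠ R → (if v ∈ R' then (1 : ℤ) else 0) = 0 := by
        intro R' hR' hne
        rw [if_neg fun h => hne (eq_of_notMem_boundaryOf hR' hR h hvR hb)]
      simp only [μ]
      rw [Finset.sum_eq_single_of_mem R hR this, if_pos hvR]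
    rcases hLM with ⟨h1, h2⟩ | ⟨h1, h2⟩ <;> simp [g, h1, h2, hb, hμ]

/-- A system of exchanges between `L` and `M`, indexed by sets of regions. -/
structure ExchangeSystem (d : V → V → ℝ) (L M : Finset V) (r : ℕ) (δ : ℝ)
    (𝓡 : Finset (Finset V)) (e : Finset V → ℤ) (S : Finset (Finset V) → Finset V)
    (ρ : V → Finset V) : Prop where
  mem : ∀ c, ρ c ∈ 𝓡
  abs_le : ∀ R ∈ 𝓡, |e R| ≤ 2 * r
  sum_le : ((∑ R ∈ 𝓡, e R : ℤ) : ℝ) ≤ M.card - L.card + 4 * δ * ((L \ M) ∪ (M \ L)).card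
  card_le : 𝓡.card ≤ 2 * ((L \ M) ∪ (M \ L)).card
  nonempty : ∀ J ⊆ 𝓡, (S J).Nonempty
  card_set : ∀ J ⊆ 𝓡, ((S J).card : ℤ) ≤ L.card + ∑ R ∈ J, e R
  near : ∀ J ⊆ 𝓡, (L \ S J).card + (S J \ L).card ≤ J.card * r
  dist_in : ∀ J ⊆ 𝓡, ∀ c, ρ c ∈ J → nearDist d (S J) c ≤ nearDist d M c
  dist_out : ∀ J ⊆ 𝓡, ∀ c, ρ c ∉ J → nearDist d (S J) c ≤ nearDist d L c

lemma exists_exchangeSystem [Fintype V] {h : ℕ}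
    (hH : ∀ B : Fin h → Set V, ¬ CliqueModel G B)
    (hG : G.Connected) (hw : ∀ e ∈ G.edgeSet, 0 ≤ w e) (hL : L.Nonempty) (hM : M.Nonempty)
    (hne : ((L \ M) ∪ (M \ L)).Nonempty) {δ : ℝ} (hδ : 0 < δ)
    (hδ1 : δ ≤ 1) (hr : 5 * (40 * sepConst h / δ) ^ 4 ≤ (r : ℝ)) :
    ∃ 𝓡 e S ρ, ExchangeSystem (shortestPathDist G w) L M r δ 𝓡 e S ρ := by
  obtain ⟨cell, hv⟩ := exists_isVoronoiOn (w := w) hG hw hne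
  have : Nonempty V := hL.to_type
  obtain ⟨𝓡', hdiv', hsum'⟩ := exists_division (cellGraph_no_cliqueModel hv hH) hδ hδ1 hr
    ((L \ M) ∪ (M \ L))
  -- Without the empty region, each region contributes at least 1 to the sum of sizes, which bounds
  -- the number of regions.
  obtain ⟨𝓡, h𝓡⟩ : ∃ 𝓡, 𝓡 = 𝓡'.erase ∅ := ⟨_, rfl⟩
  have hmem : ∀ R, R ∈ 𝓡 ↔ R ≠ ∅ ∧ R ∈ 𝓡' := fun R => by rw [h𝓡, Finset.mem_erase]
  have hdiv : IsDivision (cellGraph G cell) ((L \ M) ∪ (M \ L)) r 𝓡 := by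
    refine ⟨fun R hR => hdiv'.subset R ((hmem R).1 hR).2,
      fun R hR => hdiv'.card_le R ((hmem R).1 hR).2, fun v hv => ?_, fun u hu w hw huw => ?_⟩
    · obtain ⟨R, hR, h⟩ := hdiv'.cover v hv
      exact ⟨R, (hmem R).2 ⟨Finset.ne_empty_of_mem h, hR⟩, h⟩
    · obtain ⟨R, hR, h⟩ := hdiv'.edge u hu w hw huw
      exact ⟨R, (hmem R).2 ⟨Finset.ne_empty_of_mem h.1, hR⟩, h⟩
  have hsum : ∑ R ∈ 𝓡, (R.card : ℝ) ≤ (1 + δ) * ((L \ M) ∪ (M \ L)).card := by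
    refine le_trans (Finset.sum_le_sum_of_subset_of_nonneg ?_ fun _ _ _ => Nat.cast_nonneg _) hsum'
    rw [h𝓡]; exact Finset.erase_subset _ _
  -- One region is fixed for each client. If it is not exchanged but the cell lies in an exchanged
  -- region, then the cell is a boundary vertex, which is what the second distance bound requires.
  have hρ : ∀ c, ∃ R ∈ 𝓡, cell c ∈ R := fun c => hdiv.cover _ (hv.mem c (Finset.mem_univ c))
  choose ρ hρ𝓡 hρc using hρ
  have hout : ∀ J ⊆ 𝓡, ∀ c, ρ c ∉ J → ∀ R ∈ J, cell c ∈ R → cell c ∈ boundaryOf 𝓡 := by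
    intro J hJ c hc R hR hcR
    by_contra hb
    exact hc (eq_of_notMem_boundaryOf (hJ hR) (hρ𝓡 c) hcR (hρc c) hb ▸ hR)
  have hin : ∀ J ⊆ 𝓡, ∀ c, ρ c ∈ J → ∀ m ∈ M, ∀ q : G.Walk c m,
      ∃ b ∈ exchangeSet L M 𝓡 J, shortestPathDist G w c b ≤ walkLength w q :=
    fun J hJ c hc m hm q => exists_mem_exchangeSet_of_mem hG hw hv hdiv hJ hc (hρc c) hm q
  have hin' : ∀ J ⊆ 𝓡, ∀ c, ρ c ∉ J → ∀ l ∈ L, ∀ q : G.Walk c l,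
      ∃ b ∈ exchangeSet L M 𝓡 J, shortestPathDist G w c b ≤ walkLength w q :=
    fun J hJ c hc l hl q => exists_mem_exchangeSet_of_notMem hG hw hv hdiv hJ (hout J hJ c hc) hl q
  refine ⟨𝓡, regionExcess L M 𝓡, exchangeSet L M 𝓡, ρ, hρ𝓡, ?_, ?_, ?_, ?_, ?_, ?_, ?_, ?_⟩
  · intro R hR
    have h0 := hdiv.card_le R hR
    have h1 : (R ∩ M).card ≤ R.card := Finset.card_le_card Finset.inter_subset_left
    have h2 : (R ∩ boundaryOf 𝓡).card ≤ R.card := Finset.card_le_card Finset.inter_subset_left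
    have h3 : ((R \ boundaryOf 𝓡) ∩ L).card ≤ R.card :=
      Finset.card_le_card (Finset.inter_subset_left.trans Finset.sdiff_subset)
    rw [regionExcess, abs_le]
    constructor <;> omega
  · have h1 : ((∑ R ∈ 𝓡, regionExcess L M 𝓡 R : ℤ) : ℝ) ≤
        ((M.card - L.card + 4 * (∑ R ∈ 𝓡, (R.card : ℤ) - ((L \ M) ∪ (M \ L)).card) : ℤ) : ℝ) :=
      Int.cast_le.2 (sum_regionExcess_le hdiv.subset hdiv.cover)
    refine h1.trans ?_
    push_cast
    linarith
  · have h1 : (𝓡.card : ℝ) ≤ ∑ R ∈ 𝓡, (R.card : ℝ) := by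
      rw [Finset.card_eq_sum_ones]
      push_cast
      refine Finset.sum_le_sum fun R hR => ?_
      exact_mod_cast Finset.card_pos.2 (Finset.nonempty_iff_ne_empty.2 ((hmem R).1 hR).1)
    have h2 : (𝓡.card : ℝ) ≤ 2 * ((L \ M) ∪ (M \ L)).card := by
      have : (0 : ℝ) ≤ ((L \ M) ∪ (M \ L)).card := Nat.cast_nonneg _
      nlinarith
    exact_mod_cast h2
  · intro J hJ
    obtain ⟨c⟩ := ‹Nonempty V›
    by_cases hc : ρ c ∈ J
    · obtain ⟨m, hm⟩ := hM
      obtain ⟨q⟩ := hG.preconnected c m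
      obtain ⟨b, hb, -⟩ := hin J hJ c hc m hm q
      exact ⟨b, hb⟩
    · obtain ⟨l, hl⟩ := hL
      obtain ⟨q⟩ := hG.preconnected c l
      obtain ⟨b, hb, -⟩ := hin' J hJ c hc l hl q
      exact ⟨b, hb⟩
  · exact fun J hJ => card_exchangeSet_le hJ
  · intro J hJ
    have hdisj : Disjoint (L \ exchangeSet L M 𝓡 J) (exchangeSet L M 𝓡 J \ L) := by
      rw [Finset.disjoint_left]
      intro v h1 h2
      exact (Finset.mem_sdiff.1 h2).2 (Finset.mem_sdiff.1 h1).1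
    rw [← Finset.card_union_of_disjoint hdisj]
    have hsub : (L \ exchangeSet L M 𝓡 J) ∪ (exchangeSet L M 𝓡 J \ L) ⊆ J.biUnion id := by
      intro v hv
      simp only [exchangeSet, Finset.mem_union, Finset.mem_sdiff, Finset.mem_inter] at hv
      tauto
    refine (Finset.card_le_card hsub).trans (Finset.card_biUnion_le_card_mul _ _ _ fun R hR => ?_)
    exact hdiv.card_le R (hJ hR)
  · intro J hJ c hc
    obtain ⟨m, hm, hmd⟩ := exists_nearDist_eq (d := shortestPathDist G w) hM c
    rw [hmd]
    refine le_shortestPathDist hG fun q => ?_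
    obtain ⟨b, hb, hle⟩ := hin J hJ c hc m hm q
    exact (nearDist_le hb).trans hle
  · intro J hJ c hc
    obtain ⟨l, hl, hld⟩ := exists_nearDist_eq (d := shortestPathDist G w) hL c
    rw [hld]
    refine le_shortestPathDist hG fun q => ?_
    obtain ⟨b, hb, hle⟩ := hin' J hJ c hc l hl q
    exact (nearDist_le hb).trans hle

end Exchange

/-! ### Grouping bounded integers with nonpositive sum -/

section Grouping
open scoped Classical

variable {ι : Type*} {I : Finset ι} {e : ι → ℤ} {r : ℕ}

/-- Elements are added one by one so that partial sums stay in [−r, r]: a negative element follows a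
positive sum, a positive element a nonpositive sum. The first choice is always possible as the total
is nonpositive. If the second fails, the current prefix, or a singleton when it is empty, is a
group. -/
lemma exists_chain_or_group (hr : ∀ i ∈ I, |e i| ≤ r) (hsum : ∑ i ∈ I, e i ≤ 0)
    (hI : I.Nonempty) (j : ℕ) :
    (∃ B ⊆ I, B.Nonempty ∧ B.card ≤ j ∧ ∑ i ∈ B, e i ≤ 0 ∧ ∑ i ∈ I \ B, e i ≤ 0) ∨
    ∃ P : ℕ → Finset ι, (∀ i ≤ j, P i ⊆ I ∧ (P i).card = i ∧ |∑ x ∈ P i, e x| ≤ r) ∧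
      ∀ i < j, P i ⊆ P (i + 1) := by
  induction j with
  | zero =>
    right
    refine ⟨fun _ => ∅, fun i hi => ?_, fun i hi => by omega⟩
    simp only [Nat.le_zero] at hi
    simp [hi]
  | succ j ih =>
    rcases ih with ⟨B, h1, h2, h3, h4⟩ | ⟨P, hP, hmono⟩
    · exact Or.inl ⟨B, h1, h2, by omega, h4⟩
    obtain ⟨hPI, hPc, hPs⟩ := hP j le_rfl
    have hsplit := Finset.sum_sdiff (f := e) hPI
    have extend : ∀ x ∈ I \ P j, |∑ i ∈ P j, e i + e x| ≤ r →
        ∃ P : ℕ → Finset ι, (∀ i ≤ j + 1, P i ⊆ I ∧ (P i).card = i ∧ |∑ x ∈ P i, e x| ≤ r) ∧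
          ∀ i < j + 1, P i ⊆ P (i + 1) := by
      intro x hx hxs
      obtain ⟨hxI, hxP⟩ := Finset.mem_sdiff.1 hx
      refine ⟨Function.update P (j + 1) (insert x (P j)), fun i hi => ?_, fun i hi => ?_⟩
      · rcases Nat.lt_or_eq_of_le hi with h | rfl
        · rw [Function.update_of_ne (by omega)]
          exact hP i (by omega)
        · rw [Function.update_self]
          refine ⟨Finset.insert_subset hxI hPI, by rw [Finset.card_insert_of_notMem hxP, hPc], ?_⟩
          rw [Finset.sum_insert hxP, add_comm]
          exact hxs
      · rcases Nat.lt_or_eq_of_le (Nat.lt_succ_iff.1 hi) with h | rfl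
        · rw [Function.update_of_ne (by omega), Function.update_of_ne (by omega)]
          exact hmono i h
        · rw [Function.update_of_ne (by omega), Function.update_self]
          exact Finset.subset_insert _ _
    rw [abs_le] at hPs
    by_cases hpos : 0 < ∑ i ∈ P j, e i
    · obtain ⟨x, hx, hxe⟩ : ∃ x ∈ I \ P j, e x < 0 := by
        by_contra! hcon
        have := Finset.sum_nonneg hcon
        linarith
      have h1 := abs_le.1 (hr x (Finset.mem_sdiff.1 hx).1)
      exact Or.inr (extend x hx (abs_le.2 ⟨by linarith, by linarith⟩))
    · by_cases hex : ∃ x ∈ I \ P j, 0 < e x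
      · obtain ⟨x, hx, hxe⟩ := hex
        have h1 := abs_le.1 (hr x (Finset.mem_sdiff.1 hx).1)
        exact Or.inr (extend x hx (abs_le.2 ⟨by linarith, by linarith⟩))
      · push Not at hex
        left
        by_cases hj : j = 0
        · have hP0 : P j = ∅ := Finset.card_eq_zero.1 (hPc.trans hj)
          rw [hP0, Finset.sdiff_empty] at hex
          obtain ⟨x, hx⟩ := hI
          refine ⟨{x}, by simpa using hx, by simp, by simp, by simpa using hex x hx, ?_⟩
          exact Finset.sum_nonpos fun i hi => hex i (Finset.mem_sdiff.1 hi).1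
        · refine ⟨P j, hPI, ?_, by omega, not_lt.1 hpos, Finset.sum_nonpos hex⟩
          rw [← Finset.card_pos, hPc]; omega

/-- A family of bounded integers with nonpositive sum has a small subfamily with nonpositive sum
such that the sum over its complement is nonpositive as well. -/
lemma exists_group (hr : ∀ i ∈ I, |e i| ≤ r) (hsum : ∑ i ∈ I, e i ≤ 0) (hI : I.Nonempty) :
    ∃ B ⊆ I, B.Nonempty ∧ B.card ≤ 2 * r + 1 ∧ ∑ i ∈ B, e i ≤ 0 ∧ ∑ i ∈ I \ B, e i ≤ 0 := by
  rcases exists_chain_or_group hr hsum hI (2 * r + 1) with h | ⟨P, hP, hmono⟩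
  · exact h
  have hmono' : ∀ i j, i ≤ j → j ≤ 2 * r + 1 → P i ⊆ P j := by
    intro i j hij
    induction j, hij using Nat.le_induction with
    | base => exact fun _ => Finset.Subset.refl _
    | succ j hij ih => exact fun hj => (ih (by omega)).trans (hmono j (by omega))
  -- Among 2r + 2 partial sums in [−r, r] two agree, and the block between them has sum 0.
  have hpig := Finset.exists_ne_map_eq_of_card_lt_of_maps_to
    (s := Finset.range (2 * r + 2)) (t := Finset.Icc (-(r : ℤ)) r)
    (f := fun i => ∑ x ∈ P i, e x) (by simp; omega) (by
      intro i hi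
      have hi' : i < 2 * r + 2 := by simpa using hi
      have := abs_le.1 (hP i (by omega)).2.2
      exact Finset.mem_coe.2 (Finset.mem_Icc.2 this))
  obtain ⟨i, hi, j, hj, hne, heq⟩ := hpig
  simp only [Finset.mem_range] at hi hj
  have main : ∀ i j, i < j → j < 2 * r + 2 → ∑ x ∈ P i, e x = ∑ x ∈ P j, e x →
      ∃ B ⊆ I, B.Nonempty ∧ B.card ≤ 2 * r + 1 ∧ ∑ i ∈ B, e i ≤ 0 ∧ ∑ i ∈ I \ B, e i ≤ 0 := by
    intro i j hij hj heq
    have hsub := hmono' i j hij.le (by omega)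
    have hPj := hP j (by omega)
    have hPi := hP i (by omega)
    have hBI : P j \ P i ⊆ I := Finset.sdiff_subset.trans hPj.1
    have hc := Finset.card_sdiff_add_card_eq_card hsub
    have hs := Finset.sum_sdiff (f := e) hsub
    have hs' := Finset.sum_sdiff (f := e) hBI
    refine ⟨P j \ P i, hBI, Finset.card_pos.1 (by omega), by omega, by omega, by omega⟩
  rcases Nat.lt_or_gt_of_ne hne with h | h
  · exact main i j h hj heq
  · exact main j i h hi heq.symm

/-- The lower bound on the size limits the number of groups, and hence the number of exchanges that
each lose a share of the cost. -/
lemma exists_group_ge (hr : ∀ i ∈ I, |e i| ≤ r) (hsum : ∑ i ∈ I, e i ≤ 0) (q : ℕ) :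
    ∃ B ⊆ I, B.card ≤ q + 2 * r + 1 ∧ ∑ i ∈ B, e i ≤ 0 ∧ ∑ i ∈ I \ B, e i ≤ 0 ∧
      (q ≤ B.card ∨ B = I) := by
  induction q with
  | zero => exact ⟨∅, by simp, by simp, by simp, by simpa using hsum, by simp⟩
  | succ q ih =>
    obtain ⟨B, hBI, hB1, hB2, hB3, hB4⟩ := ih
    by_cases h1 : q + 1 ≤ B.card ∨ B = I
    · exact ⟨B, hBI, by omega, hB2, hB3, h1⟩
    · push Not at h1
      have hBq : B.card = q := by
        rcases hB4 with h | h
        · omega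
        · exact absurd h h1.2
      have hne : (I \ B).Nonempty := by
        rw [Finset.sdiff_nonempty]
        exact fun h => h1.2 (Finset.Subset.antisymm hBI h)
      obtain ⟨B', hB'I, hB'ne, hB'c, hB's, hB't⟩ := exists_group (I := I \ B)
        (fun i hi => hr i (Finset.mem_sdiff.1 hi).1) hB3 hne
      have hdisj : Disjoint B B' := Finset.disjoint_sdiff.mono_right hB'I
      have hc := Finset.card_union_of_disjoint hdisj
      have hpos := hB'ne.card_pos
      refine ⟨B ∪ B', Finset.union_subset hBI (hB'I.trans Finset.sdiff_subset), by omega, ?_, ?_,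
        Or.inl (by omega)⟩
      · rw [Finset.sum_union hdisj]; omega
      · rwa [← Finset.sup_eq_union, ← sdiff_sdiff_left]

/-- A family of bounded integers with nonpositive sum splits into groups of bounded size with
nonpositive sums. -/
lemma exists_grouping {q : ℕ} (hq : 0 < q) : ∀ (n : ℕ) (I : Finset ι), I.card = n →
    (∀ i ∈ I, |e i| ≤ r) → ∑ i ∈ I, e i ≤ 0 →
    ∃ 𝓖 : Finset (Finset ι), (∀ J ∈ 𝓖, J ⊆ I ∧ J.card ≤ q + 2 * r + 1 ∧ ∑ i ∈ J, e i ≤ 0) ∧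
      (∀ i ∈ I, ∃ J ∈ 𝓖, i ∈ J) ∧ (∀ J ∈ 𝓖, ∀ J' ∈ 𝓖, ∀ i ∈ J, i ∈ J' → J = J') ∧
      𝓖.card * q ≤ I.card + q := by
  intro n
  induction n using Nat.strong_induction_on with
  | _ n ih =>
    intro I hn hr hsum
    by_cases hI : I = ∅
    · subst hI
      exact ⟨∅, by simp, by simp, by simp, by simp⟩
    obtain ⟨B, hBI, hB1, hB2, hB3, hB4⟩ := exists_group_ge hr hsum q
    by_cases hBe : B = I
    · subst hBe
      refine ⟨{B}, ?_, ?_, ?_, by simp⟩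
      · intro J hJ
        rw [Finset.mem_singleton.1 hJ]
        exact ⟨Finset.Subset.refl _, hB1, hB2⟩
      · exact fun i hi => ⟨B, by simp, hi⟩
      · intro J hJ J' hJ' _ _ _
        rw [Finset.mem_singleton.1 hJ, Finset.mem_singleton.1 hJ']
    · have hBq : q ≤ B.card := hB4.resolve_right hBe
      have hc := Finset.card_sdiff_add_card_eq_card hBI
      obtain ⟨𝓖, h1, h2, h3, h4⟩ := ih (I \ B).card (by omega) (I \ B) rfl
        (fun i hi => hr i (Finset.mem_sdiff.1 hi).1) hB3
      refine ⟨insert B 𝓖, ?_, ?_, ?_, ?_⟩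
      · intro J hJ
        rcases Finset.mem_insert.1 hJ with rfl | hJ
        · exact ⟨hBI, hB1, hB2⟩
        · exact ⟨(h1 J hJ).1.trans Finset.sdiff_subset, (h1 J hJ).2⟩
      · intro i hi
        by_cases hiB : i ∈ B
        · exact ⟨B, Finset.mem_insert_self _ _, hiB⟩
        · obtain ⟨J, hJ, hiJ⟩ := h2 i (Finset.mem_sdiff.2 ⟨hi, hiB⟩)
          exact ⟨J, Finset.mem_insert_of_mem hJ, hiJ⟩
      · intro J hJ J' hJ' i hi hi'
        rcases Finset.mem_insert.1 hJ with h | h <;> rcases Finset.mem_insert.1 hJ' with h' | h'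
        · rw [h, h']
        · exact absurd (h ▸ hi) (Finset.mem_sdiff.1 ((h1 J' h').1 hi')).2
        · exact absurd (h' ▸ hi') (Finset.mem_sdiff.1 ((h1 J h).1 hi)).2
        · exact h3 J h J' h' i hi hi'
      · have := Finset.card_insert_le B 𝓖
        have := Nat.mul_le_mul_right q this
        rw [add_mul] at this
        omega

end Grouping

/-! ### Local optima against regional exchanges -/

section LocalOptimum
open scoped Classical

variable {X : Type u} {d : X → X → ℝ} {p : ℕ} {C L M : Finset X} {k s r : ℕ} {ε δ : ℝ}

/-- No solution near `L` is substantially cheaper than `L`. -/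
def LocallyOptimal (d : X → X → ℝ) (p : ℕ) (C : Finset X) (k s : ℕ) (ε : ℝ) (L : Finset X) :
    Prop :=
  ∀ S : Finset X, S.Nonempty → S.card ≤ k → (L \ S).card + (S \ L).card ≤ s →
    (1 - ε / C.card) * clusterCost d p C L ≤ clusterCost d p C S

lemma clusterCost_eq (S : Finset X) : clusterCost d p C S = ∑ c ∈ C, nearDist d S c ^ p := rfl

lemma clusterCost_nonneg (hd : IsPseudometric d) (S : Finset X) : 0 ≤ clusterCost d p C S :=
  Finset.sum_nonneg fun _ _ => pow_nonneg hd.nearDist_nonneg p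

/-- The total gain of a family of exchanges at a local optimum. -/
lemma LocallyOptimal.sum_gain_le (h : LocallyOptimal d p C k s ε L) {ι : Type*} (𝓖 : Finset ι)
    (S : ι → Finset X)
    (hS : ∀ J ∈ 𝓖, (S J).Nonempty ∧ (S J).card ≤ k ∧ (L \ S J).card + (S J \ L).card ≤ s) :
    ∑ c ∈ C, ∑ J ∈ 𝓖, (nearDist d L c ^ p - nearDist d (S J) c ^ p) ≤
      𝓖.card * (ε / C.card * clusterCost d p C L) := by
  rw [Finset.sum_comm, ← nsmul_eq_mul]
  refine Finset.sum_le_card_nsmul _ _ _ fun J hJ => ?_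
  rw [Finset.sum_sub_distrib, ← clusterCost_eq, ← clusterCost_eq]
  have := h (S J) (hS J hJ).1 (hS J hJ).2.1 (hS J hJ).2.2
  linarith

/-- Region exchanges bound the cost of a local optimum. -/
lemma LocallyOptimal.cost_sub_le_of_exchangeSystem (hd : IsPseudometric d)
    (h : LocallyOptimal d p C k s ε L) {𝓡 : Finset (Finset X)} {e : Finset X → ℤ}
    {S : Finset (Finset X) → Finset X} {ρ : X → Finset X}
    (hE : ExchangeSystem d L M r δ 𝓡 e S ρ) (hLk : L.card = k) (hsum : ∑ R ∈ 𝓡, e R ≤ 0)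
    {q : ℕ} (hq : 0 < q) (hs : (q + 4 * r + 1) * r ≤ s) :
    ∃ t : ℕ, t * q ≤ 𝓡.card + q ∧
      clusterCost d p C L - clusterCost d p C M ≤ t * (ε / C.card * clusterCost d p C L) := by
  obtain ⟨𝓖, h1, h2, h3, h4⟩ := exists_grouping (r := 2 * r) hq _ 𝓡 rfl
    (by exact_mod_cast hE.abs_le) hsum
  refine ⟨𝓖.card, h4, le_trans ?_ (h.sum_gain_le 𝓖 S fun J hJ => ⟨hE.nonempty J (h1 J hJ).1, ?_,
    (hE.near J (h1 J hJ).1).trans (le_trans (Nat.mul_le_mul_right r ?_) hs)⟩)⟩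
  · rw [clusterCost_eq, clusterCost_eq, ← Finset.sum_sub_distrib]
    refine Finset.sum_le_sum fun c _ => ?_
    -- The group containing the region of c gains the full difference between `L` and `M` at c; no
    -- other group makes c worse than under `L`.
    obtain ⟨J₀, hJ₀, hc⟩ := h2 (ρ c) (hE.mem c)
    rw [← Finset.add_sum_erase _ _ hJ₀]
    have e1 : nearDist d L c ^ p - nearDist d M c ^ p ≤
        nearDist d L c ^ p - nearDist d (S J₀) c ^ p :=
      sub_le_sub_left (pow_le_pow_left₀ hd.nearDist_nonneg (hE.dist_in J₀ (h1 J₀ hJ₀).1 c hc) p) _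
    have e2 : 0 ≤ ∑ J ∈ 𝓖.erase J₀, (nearDist d L c ^ p - nearDist d (S J) c ^ p) := by
      refine Finset.sum_nonneg fun J hJ => ?_
      obtain ⟨hne, hJ⟩ := Finset.mem_erase.1 hJ
      refine sub_nonneg.2 (pow_le_pow_left₀ hd.nearDist_nonneg (hE.dist_out J (h1 J hJ).1 c ?_) p)
      exact fun hcJ => hne (h3 J hJ J₀ hJ₀ _ hcJ hc)
    linarith
  · have := hE.card_set J (h1 J hJ).1
    have := (h1 J hJ).2.2
    omega
  · have := (h1 J hJ).2.1
    omega

end LocalOptimum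

/-! ### Dominated, paired and removable centers -/

section Pairs
open scoped Classical

variable {X : Type u} {C L T : Finset X} {l f : X → X} {η : ℝ} {x x' y : X}

/-- The clients of `y` under the assignment `g`. -/
noncomputable def cluster (C : Finset X) (g : X → X) (y : X) : Finset X := C.filter fun c => g c = y

lemma mem_cluster {g : X → X} {c : X} : c ∈ cluster C g y ↔ c ∈ C ∧ g c = y := Finset.mem_filter

/-- Almost all clients of `y` under `l` are clients of `x` under `f`. -/
def Dominates (C : Finset X) (l f : X → X) (η : ℝ) (x y : X) : Prop :=
  (∃ c ∈ C, f c = x ∧ l c = y) ∧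
    (((cluster C l y).filter fun c => f c ≠ x).card : ℝ) ≤ η * (cluster C l y).card

lemma Dominates.card_le (h : Dominates C l f η x y) (hη : η ≤ 1 / 4) :
    ((cluster C l y).card : ℝ) ≤ 2 * ((cluster C l y).filter fun c => f c = x).card := by
  have h1 : (((cluster C l y).filter fun c => f c = x).card : ℝ) +
      ((cluster C l y).filter fun c => ¬ f c = x).card = (cluster C l y).card := by
    exact_mod_cast Finset.card_filter_add_card_filter_not (s := cluster C l y) (fun c => f c = x)
  have h2 := h.2
  have h3 : (0 : ℝ) ≤ (cluster C l y).card := Nat.cast_nonneg _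
  simp only [ne_eq] at h2
  nlinarith

/-- Two different centers cannot each own at least 3/4 of a nonempty cluster. -/
lemma Dominates.unique (h : Dominates C l f η x y) (h' : Dominates C l f η x' y)
    (hη : η ≤ 1 / 4) : x = x' := by
  by_contra hne
  obtain ⟨c, hc, hcx, hcy⟩ := h.1
  have h0 : 0 < (cluster C l y).card := Finset.card_pos.2 ⟨c, mem_cluster.2 ⟨hc, hcy⟩⟩
  have h0' : (0 : ℝ) < (cluster C l y).card := by exact_mod_cast h0
  have h1 := h.card_le hη
  have h2 : (((cluster C l y).filter fun c => f c = x).card : ℝ) ≤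
      ((cluster C l y).filter fun c => f c ≠ x').card := by
    refine Nat.cast_le.2 (Finset.card_le_card fun c hc => ?_)
    rw [Finset.mem_filter] at hc ⊢
    exact ⟨hc.1, hc.2.symm ▸ hne⟩
  have h3 := h'.2
  have h4 := mul_le_mul_of_nonneg_right hη h0'.le
  have h5 : 2 * η * ((cluster C l y).card : ℝ) ≤ 2 * (1 / 4) * (cluster C l y).card := by linarith
  linarith

/-- Centers with almost the same clients. -/
def IsPair (C : Finset X) (l f : X → X) (η : ℝ) (x y : X) : Prop :=
  Dominates C l f η x y ∧ Dominates C f l η y x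

noncomputable def pairedCenters (C : Finset X) (l f : X → X) (η : ℝ) (T : Finset X) : Finset X :=
  T.filter fun x => ∃ y, IsPair C l f η x y

noncomputable def partner (C : Finset X) (l f : X → X) (η : ℝ) (x : X) : X :=
  if h : ∃ y, IsPair C l f η x y then h.choose else x

/-- An η-fraction of the clients of such a center x go, in `L`, to centers that x does not dominate.
There they meet many clients with another center in `T`, which provides alternatives to x. -/
noncomputable def removableCenters (C : Finset X) (l f : X → X) (η : ℝ) (T : Finset X) :
    Finset X :=
  (T \ pairedCenters C l f η T).filter fun x => η * (cluster C f x).card ≤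
    ((cluster C f x).filter fun c => ¬ Dominates C l f η x (l c)).card

lemma isPair_partner (hx : x ∈ pairedCenters C l f η T) :
    IsPair C l f η x (partner C l f η x) := by
  have h := (Finset.mem_filter.1 hx).2
  rw [partner, dif_pos h]
  exact h.choose_spec

lemma partner_mem (hl : ∀ c, l c ∈ L) (hx : x ∈ pairedCenters C l f η T) :
    partner C l f η x ∈ L := by
  obtain ⟨c, -, -, hc⟩ := (isPair_partner hx).1.1
  exact hc ▸ hl c

lemma partner_injOn (hη : η ≤ 1 / 4) :
    Set.InjOn (partner C l f η) (pairedCenters C l f η T : Set X) := by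
  intro x hx x' hx' h
  have h1 := (isPair_partner hx).1
  have h2 := (isPair_partner hx').1
  rw [← h] at h2
  exact h1.unique h2 hη

/-- Centers that are neither paired nor removable dominate at least two centers of `L`. -/
lemma two_le_card_dominated (hη : η ≤ 1 / 4) (hl : ∀ c, l c ∈ L) (hxT : x ∈ T)
    (hx : x ∉ pairedCenters C l f η T) (hx' : x ∉ removableCenters C l f η T) :
    2 ≤ (L.filter fun y => Dominates C l f η x y).card := by
  have h1 : (((cluster C f x).filter fun c => ¬ Dominates C l f η x (l c)).card : ℝ) <
      η * (cluster C f x).card := by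
    by_contra hcon
    exact hx' (Finset.mem_filter.2 ⟨Finset.mem_sdiff.2 ⟨hxT, hx⟩, not_lt.1 hcon⟩)
  have hex : ∃ c ∈ cluster C f x, Dominates C l f η x (l c) := by
    by_contra! hcon
    rw [Finset.filter_true_of_mem hcon] at h1
    have : (0 : ℝ) ≤ (cluster C f x).card := Nat.cast_nonneg _
    nlinarith
  obtain ⟨c, hc, hdom⟩ := hex
  by_contra hlt
  have hone : ∀ y ∈ L, Dominates C l f η x y → y = l c := by
    intro y hy hxy
    have : (L.filter fun y => Dominates C l f η x y).card ≤ 1 := by omega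
    exact Finset.card_le_one.1 this _ (Finset.mem_filter.2 ⟨hy, hxy⟩) _
      (Finset.mem_filter.2 ⟨hl c, hdom⟩)
  refine hx (Finset.mem_filter.2 ⟨hxT, l c, hdom, ?_, ?_⟩)
  · exact ⟨c, (mem_cluster.1 hc).1, rfl, (mem_cluster.1 hc).2⟩
  · refine le_trans (Nat.cast_le.2 (Finset.card_le_card fun c' hc' => ?_)) h1.le
    rw [Finset.mem_filter] at hc' ⊢
    exact ⟨hc'.1, fun h => hc'.2 (hone _ (hl c') h)⟩

/-- Distinct centers dominate disjoint subsets of `L`: a paired one at least its partner, an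
unpaired non-removable one at least two. Hence removable centers are plentiful among the unpaired
ones when |T| = |L|. -/
lemma card_paired_add_le (hη : η ≤ 1 / 4) (hl : ∀ c, l c ∈ L) :
    (pairedCenters C l f η T).card +
      2 * ((T \ pairedCenters C l f η T) \ removableCenters C l f η T).card ≤ L.card := by
  set P := pairedCenters C l f η T with hP
  set Q := (T \ P) \ removableCenters C l f η T with hQ
  have hdisj : Disjoint P Q := Finset.disjoint_sdiff.mono_right Finset.sdiff_subset
  have h1 : ((P ∪ Q).biUnion fun x => L.filter fun y => Dominates C l f η x y).card =
      ∑ x ∈ P ∪ Q, (L.filter fun y => Dominates C l f η x y).card := by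
    refine Finset.card_biUnion fun x _ x' _ hne => ?_
    rw [Function.onFun, Finset.disjoint_left]
    intro y hy hy'
    exact hne ((Finset.mem_filter.1 hy).2.unique (Finset.mem_filter.1 hy').2 hη)
  have h2 : ((P ∪ Q).biUnion fun x => L.filter fun y => Dominates C l f η x y).card ≤ L.card :=
    Finset.card_le_card (Finset.biUnion_subset.2 fun x _ => Finset.filter_subset _ _)
  rw [h1, Finset.sum_union hdisj] at h2
  have h3 : P.card ≤ ∑ x ∈ P, (L.filter fun y => Dominates C l f η x y).card := by
    rw [Finset.card_eq_sum_ones]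
    refine Finset.sum_le_sum fun x hx => Finset.card_pos.2 ?_
    exact ⟨partner C l f η x, Finset.mem_filter.2 ⟨partner_mem hl hx, (isPair_partner hx).1⟩⟩
  have h4 : 2 * Q.card ≤ ∑ x ∈ Q, (L.filter fun y => Dominates C l f η x y).card := by
    rw [mul_comm, ← smul_eq_mul]
    refine Finset.card_nsmul_le_sum _ _ _ fun x hx => ?_
    obtain ⟨h5, h6⟩ := Finset.mem_sdiff.1 hx
    obtain ⟨h7, h8⟩ := Finset.mem_sdiff.1 h5
    exact two_le_card_dominated hη hl h7 h8 h6
  omega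

/-- Sums over the clusters of some centers. -/
lemma sum_cluster_le {g : X → X} (S : Finset X) {φ : X → ℝ} (hφ : ∀ c ∈ C, 0 ≤ φ c) :
    ∑ y ∈ S, ∑ c ∈ cluster C g y, φ c ≤ ∑ c ∈ C, φ c := by
  have hdisj : ∀ y ∈ S, ∀ y' ∈ S, y ≠ y' → Disjoint (cluster C g y) (cluster C g y') := by
    intro y _ y' _ hne
    rw [Finset.disjoint_left]
    intro c h1 h2
    exact hne ((mem_cluster.1 h1).2.symm.trans (mem_cluster.1 h2).2)
  rw [← Finset.sum_biUnion hdisj]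
  exact Finset.sum_le_sum_of_subset_of_nonneg
    (Finset.biUnion_subset.2 fun y _ => Finset.filter_subset _ _) fun c hc _ => hφ c hc

end Pairs

/-! ### Two selection principles -/

section FunctionalGraph
open scoped Classical

/-- A set of vertices of a functional graph contains an independent set of a third of its size. -/
lemma exists_indep_of_map {X : Type u} (τ : X → X) : ∀ (n : ℕ) (A : Finset X), A.card = n →
    ∃ B ⊆ A, A.card ≤ 3 * B.card ∧ ∀ x ∈ B, τ x ∈ B → τ x = x := by
  intro n
  induction n using Nat.strong_induction_on with
  | _ n ih =>
    intro A hn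
    rcases A.eq_empty_or_nonempty with rfl | hA
    · exact ⟨∅, by simp, by simp, by simp⟩
    -- The average in-degree is at most 1. Removing x, its image and its only possible preimage
    -- costs three points and leaves nothing in conflict with x.
    obtain ⟨x, hx, hdeg⟩ : ∃ x ∈ A, (A.filter fun y => τ y = x).card ≤ 1 := by
      by_contra! hcon
      have h1 : A.card * 2 ≤ ∑ x ∈ A, (A.filter fun y => τ y = x).card := by
        rw [← smul_eq_mul]
        exact Finset.card_nsmul_le_sum _ _ _ fun x hx => hcon x hx
      have h2 : ∑ x ∈ A, (A.filter fun y => τ y = x).card ≤ A.card := by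
        rw [← Finset.card_biUnion]
        · exact Finset.card_le_card (Finset.biUnion_subset.2 fun _ _ => Finset.filter_subset _ _)
        · intro y _ y' _ hne
          rw [Function.onFun, Finset.disjoint_left]
          intro c h1 h2
          exact hne ((Finset.mem_filter.1 h1).2.symm.trans (Finset.mem_filter.1 h2).2)
      have := hA.card_pos
      omega
    obtain ⟨N, hN⟩ : ∃ N, N = insert x (insert (τ x) (A.filter fun y => τ y = x)) := ⟨_, rfl⟩
    have hNcard : N.card ≤ 3 := by
      rw [hN]
      have h1 := Finset.card_insert_le x (insert (τ x) (A.filter fun y => τ y = x))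
      have h2 := Finset.card_insert_le (τ x) (A.filter fun y => τ y = x)
      omega
    have hxN : x ∈ N := hN ▸ Finset.mem_insert_self _ _
    have hlt : (A \ N).card < n := by
      rw [← hn]
      refine Finset.card_lt_card ⟨Finset.sdiff_subset, fun h => ?_⟩
      exact (Finset.mem_sdiff.1 (h hx)).2 hxN
    obtain ⟨B, hB, hBc, hBi⟩ := ih _ hlt (A \ N) rfl
    have hxB : x ∉ B := fun h => (Finset.mem_sdiff.1 (hB h)).2 hxN
    refine ⟨insert x B, Finset.insert_subset hx (hB.trans Finset.sdiff_subset), ?_, ?_⟩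
    · rw [Finset.card_insert_of_notMem hxB]
      have := Finset.le_card_sdiff N A
      omega
    · intro y hy hτ
      rcases Finset.mem_insert.1 hy with rfl | hy
      · rcases Finset.mem_insert.1 hτ with h | h
        · exact h
        · exact absurd (hN ▸ Finset.mem_insert_of_mem (Finset.mem_insert_self _ _))
            (Finset.mem_sdiff.1 (hB h)).2
      · rcases Finset.mem_insert.1 hτ with h | h
        · have h1 := Finset.mem_sdiff.1 (hB hy)
          exact absurd (hN ▸ Finset.mem_insert_of_mem (Finset.mem_insert_of_mem
            (Finset.mem_filter.2 ⟨h1.1, h⟩))) h1.2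
        · exact hBi y hy h

/-- A cheap subset of prescribed size. -/
lemma exists_cheap_subset {X : Type u} {A : Finset X} {W : X → ℝ} (hW : ∀ x ∈ A, 0 ≤ W x) {m : ℕ}
    (hm : 2 * m ≤ A.card) :
    ∃ B ⊆ A, B.card = m ∧ A.card * ∑ x ∈ B, W x ≤ 2 * m * ∑ x ∈ A, W x := by
  have h0 : 0 ≤ ∑ x ∈ A, W x := Finset.sum_nonneg hW
  rcases A.eq_empty_or_nonempty with rfl | hA
  · have : m = 0 := by simpa using hm
    exact ⟨∅, by simp, by simp [this], by simp⟩
  have hA0 : (0 : ℝ) < A.card := by exact_mod_cast hA.card_pos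
  -- Markov's inequality: at least half of `A` lies at or below twice the average.
  have hm' : m ≤ (A.filter fun x => A.card * W x ≤ 2 * ∑ x ∈ A, W x).card := by
    by_contra hcon
    have h1 := Finset.card_filter_add_card_filter_not (s := A)
      (fun x => A.card * W x ≤ 2 * ∑ x ∈ A, W x)
    have h2 : A.card < 2 * (A.filter fun x => ¬ A.card * W x ≤ 2 * ∑ x ∈ A, W x).card := by omega
    have h3 : (A.filter fun x => ¬ A.card * W x ≤ 2 * ∑ x ∈ A, W x).card •
        (2 * ∑ x ∈ A, W x) ≤ ∑ x ∈ A.filter (fun x => ¬ A.card * W x ≤ 2 * ∑ x ∈ A, W x),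
          A.card * W x :=
      Finset.card_nsmul_le_sum _ _ _ fun x hx => (not_le.1 (Finset.mem_filter.1 hx).2).le
    have h4 : ∑ x ∈ A.filter (fun x => ¬ A.card * W x ≤ 2 * ∑ x ∈ A, W x), A.card * W x ≤
        A.card * ∑ x ∈ A, W x := by
      have hsub : A.filter (fun x => ¬ A.card * W x ≤ 2 * ∑ x ∈ A, W x) ⊆ A :=
        Finset.filter_subset _ _
      exact (Finset.sum_le_sum_of_subset_of_nonneg hsub
        fun x hx _ => mul_nonneg hA0.le (hW x hx)).trans (Finset.mul_sum _ _ _).ge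
    rw [nsmul_eq_mul] at h3
    have h5 : (A.card : ℝ) <
        2 * (A.filter fun x => ¬ A.card * W x ≤ 2 * ∑ x ∈ A, W x).card := by exact_mod_cast h2
    have h6 : ∑ x ∈ A, W x = 0 := by
      by_contra hne
      have : 0 < ∑ x ∈ A, W x := lt_of_le_of_ne h0 (Ne.symm hne)
      nlinarith
    have h7 : ∀ x ∈ A, W x = 0 := (Finset.sum_eq_zero_iff_of_nonneg hW).1 h6
    have h8 : (A.filter fun x => ¬ A.card * W x ≤ 2 * ∑ x ∈ A, W x) = ∅ := by
      rw [Finset.filter_eq_empty_iff]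
      intro x hx
      rw [h7 x hx, h6]; simp
    rw [h8] at h2
    simp at h2
  obtain ⟨B, hB, hBm⟩ := Finset.exists_subset_card_eq hm'
  refine ⟨B, fun x hx => (Finset.mem_filter.1 (hB hx)).1, hBm, ?_⟩
  rw [Finset.mul_sum]
  refine (Finset.sum_le_card_nsmul _ _ _ fun x hx => (Finset.mem_filter.1 (hB hx)).2).trans ?_
  rw [hBm, nsmul_eq_mul]
  linarith

end FunctionalGraph

/-! ### Averaging estimates for pairs and removable centers -/

section PairCosts
open scoped Classical

variable {X : Type u} {d : X → X → ℝ} {p : ℕ} {C L T : Finset X} {l f : X → X} {η θ K κ : ℝ}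
  {x y : X}

/-- `g` assigns to every point a nearest point of `S`. -/
structure IsNearest (d : X → X → ℝ) (S : Finset X) (g : X → X) : Prop where
  mem : ∀ c, g c ∈ S
  eq : ∀ c, d c (g c) = nearDist d S c

lemma exists_isNearest {S : Finset X} (hS : S.Nonempty) : ∃ g, IsNearest d S g := by
  choose g hg using fun c => exists_nearDist_eq (d := d) hS c
  exact ⟨g, fun c => (hg c).1, fun c => (hg c).2.symm⟩

lemma add_pow_le_two_pow {u v : ℝ} (hu : 0 ≤ u) (hv : 0 ≤ v) (p : ℕ) :
    (u + v) ^ p ≤ 2 ^ p * (u ^ p + v ^ p) := by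
  have h0 : 0 ≤ u ^ p := pow_nonneg hu p
  have h0' : 0 ≤ v ^ p := pow_nonneg hv p
  rcases le_total u v with h | h
  · calc (u + v) ^ p ≤ (2 * v) ^ p := pow_le_pow_left₀ (by positivity) (by linarith) p
      _ = 2 ^ p * v ^ p := mul_pow _ _ _
      _ ≤ _ := by gcongr; linarith
  · calc (u + v) ^ p ≤ (2 * u) ^ p := pow_le_pow_left₀ (by positivity) (by linarith) p
      _ = 2 ^ p * u ^ p := mul_pow _ _ _
      _ ≤ _ := by gcongr; linarith

lemma add_four_pow_le {u v s t : ℝ} (hu : 0 ≤ u) (hv : 0 ≤ v) (hs : 0 ≤ s) (ht : 0 ≤ t) (p : ℕ) :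
    (u + v + s + t) ^ p ≤ 4 ^ p * ((u ^ p + v ^ p) + (s ^ p + t ^ p)) := by
  have h1 := add_pow_le_two_pow (add_nonneg hu hv) (add_nonneg hs ht) p
  have h2 := add_pow_le_two_pow hu hv p
  have h3 := add_pow_le_two_pow hs ht p
  calc (u + v + s + t) ^ p = ((u + v) + (s + t)) ^ p := by ring
    _ ≤ 2 ^ p * ((u + v) ^ p + (s + t) ^ p) := h1
    _ ≤ 2 ^ p * (2 ^ p * (u ^ p + v ^ p) + 2 ^ p * (s ^ p + t ^ p)) := by gcongr
    _ = (2 * 2) ^ p * ((u ^ p + v ^ p) + (s ^ p + t ^ p)) := by rw [mul_pow]; ring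
    _ = _ := by norm_num

/-- Every common client c bounds d(x, y) by its two distances. Common clients are at least half of
the cluster, whence the extra factor 2. -/
lemma Dominates.card_mul_dist_le (hd : IsPseudometric d) (hl : IsNearest d L l)
    (hf : IsNearest d T f) (hη : η ≤ 1 / 4) (h : Dominates C l f η x y) :
    ((cluster C l y).card : ℝ) * d x y ^ p ≤
      2 ^ (p + 1) * ∑ c ∈ cluster C l y, (nearDist d L c ^ p + nearDist d T c ^ p) := by
  have hnn : ∀ c, 0 ≤ nearDist d L c ^ p + nearDist d T c ^ p := fun c =>
    add_nonneg (pow_nonneg hd.nearDist_nonneg p) (pow_nonneg hd.nearDist_nonneg p)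
  have h1 : (((cluster C l y).filter fun c => f c = x).card : ℝ) * d x y ^ p ≤
      ∑ c ∈ (cluster C l y).filter (fun c => f c = x),
        2 ^ p * (nearDist d L c ^ p + nearDist d T c ^ p) := by
    rw [← nsmul_eq_mul]
    refine Finset.card_nsmul_le_sum _ _ _ fun c hc => ?_
    obtain ⟨hc1, hc2⟩ := Finset.mem_filter.1 hc
    have hc3 := (mem_cluster.1 hc1).2
    have h2 : d x y ≤ nearDist d L c + nearDist d T c := by
      rw [← hl.eq, ← hf.eq, hc2, hc3, add_comm, hd.symm c x]
      exact hd.tri _ _ _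
    exact (pow_le_pow_left₀ (hd.nonneg _ _) h2 p).trans
      (add_pow_le_two_pow hd.nearDist_nonneg hd.nearDist_nonneg p)
  have h3 : ∑ c ∈ (cluster C l y).filter (fun c => f c = x),
        2 ^ p * (nearDist d L c ^ p + nearDist d T c ^ p) ≤
      ∑ c ∈ cluster C l y, 2 ^ p * (nearDist d L c ^ p + nearDist d T c ^ p) :=
    Finset.sum_le_sum_of_subset_of_nonneg (Finset.filter_subset _ _)
      fun c _ _ => mul_nonneg (by positivity) (hnn c)
  have h5 := h1.trans h3
  rw [← Finset.mul_sum] at h5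
  have h4 := mul_le_mul_of_nonneg_right (h.card_le hη) (pow_nonneg (hd.nonneg x y) p)
  rw [pow_succ]
  linarith

lemma sum_add_eq : ∑ c ∈ C, (nearDist d L c ^ p + nearDist d T c ^ p) =
    clusterCost d p C L + clusterCost d p C T := by
  rw [Finset.sum_add_distrib, clusterCost_eq, clusterCost_eq]

lemma sum_paired_dist_le (hd : IsPseudometric d) (hl : IsNearest d L l)
    (hf : IsNearest d T f) (hη : η ≤ 1 / 4) :
    ∑ x ∈ pairedCenters C l f η T, ((cluster C f x).card : ℝ) * d x (partner C l f η x) ^ p ≤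
      2 ^ (p + 1) * (clusterCost d p C L + clusterCost d p C T) := by
  calc _ ≤ ∑ x ∈ pairedCenters C l f η T, 2 ^ (p + 1) *
        ∑ c ∈ cluster C f x, (nearDist d T c ^ p + nearDist d L c ^ p) := by
        refine Finset.sum_le_sum fun x hx => ?_
        rw [hd.symm x]
        exact (isPair_partner hx).2.card_mul_dist_le hd hf hl hη
    _ ≤ 2 ^ (p + 1) * ∑ c ∈ C, (nearDist d T c ^ p + nearDist d L c ^ p) := by
        rw [← Finset.mul_sum]
        refine mul_le_mul_of_nonneg_left (sum_cluster_le _ fun c _ => ?_) (by positivity)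
        exact add_nonneg (pow_nonneg hd.nearDist_nonneg p) (pow_nonneg hd.nearDist_nonneg p)
    _ = _ := by rw [sum_add_eq, add_comm (clusterCost d p C T)]

lemma sum_paired_dist_le' (hd : IsPseudometric d) (hl : IsNearest d L l)
    (hf : IsNearest d T f) (hη : η ≤ 1 / 4) :
    ∑ x ∈ pairedCenters C l f η T,
      ((cluster C l (partner C l f η x)).card : ℝ) * d x (partner C l f η x) ^ p ≤
      2 ^ (p + 1) * (clusterCost d p C L + clusterCost d p C T) := by
  calc _ ≤ ∑ x ∈ pairedCenters C l f η T, 2 ^ (p + 1) *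
        ∑ c ∈ cluster C l (partner C l f η x), (nearDist d L c ^ p + nearDist d T c ^ p) :=
        Finset.sum_le_sum fun x hx => (isPair_partner hx).1.card_mul_dist_le hd hl hf hη
    _ ≤ 2 ^ (p + 1) * ∑ c ∈ C, (nearDist d L c ^ p + nearDist d T c ^ p) := by
        rw [← Finset.mul_sum, ← Finset.sum_image (g := partner C l f η)
          (f := fun y => ∑ c ∈ cluster C l y, (nearDist d L c ^ p + nearDist d T c ^ p))
          (partner_injOn hη)]
        refine mul_le_mul_of_nonneg_left (sum_cluster_le _ fun c _ => ?_) (by positivity)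
        exact add_nonneg (pow_nonneg hd.nearDist_nonneg p) (pow_nonneg hd.nearDist_nonneg p)
    _ = _ := by rw [sum_add_eq]

/-- Extra cost of the clients of the partner `partner x` that are rerouted to `x`. -/
lemma sum_reroute_le (hd : IsPseudometric d) (hl : IsNearest d L l)
    (hf : IsNearest d T f) (hη : η ≤ 1 / 4) (hη0 : 0 ≤ η) (hθ : 0 ≤ θ) (hK : 0 ≤ K)
    (hpow : ∀ u v : ℝ, 0 ≤ u → 0 ≤ v → (u + v) ^ p ≤ (1 + θ) * u ^ p + K * v ^ p) :
    ∑ x ∈ pairedCenters C l f η T,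
      ∑ c ∈ (cluster C l (partner C l f η x)).filter (fun c => f c ≠ x),
        ((nearDist d L c + d x (partner C l f η x)) ^ p - nearDist d L c ^ p) ≤
      θ * clusterCost d p C L +
        K * η * 2 ^ (p + 1) * (clusterCost d p C L + clusterCost d p C T) := by
  have h1 : ∀ x ∈ pairedCenters C l f η T,
      ∑ c ∈ (cluster C l (partner C l f η x)).filter (fun c => f c ≠ x),
        ((nearDist d L c + d x (partner C l f η x)) ^ p - nearDist d L c ^ p) ≤
      θ * ∑ c ∈ cluster C l (partner C l f η x), nearDist d L c ^ p + K * η *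
        (((cluster C l (partner C l f η x)).card : ℝ) * d x (partner C l f η x) ^ p) := by
    intro x hx
    have hδ : 0 ≤ d x (partner C l f η x) ^ p := pow_nonneg (hd.nonneg _ _) p
    calc _ ≤ ∑ c ∈ (cluster C l (partner C l f η x)).filter (fun c => f c ≠ x),
          (θ * nearDist d L c ^ p + K * d x (partner C l f η x) ^ p) := by
          refine Finset.sum_le_sum fun c _ => ?_
          have := hpow _ _ (hd.nearDist_nonneg (S := L) (c := c)) (hd.nonneg x (partner C l f η x))
          linarith
      _ = θ * ∑ c ∈ (cluster C l (partner C l f η x)).filter (fun c => f c ≠ x),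
            nearDist d L c ^ p +
          ((cluster C l (partner C l f η x)).filter (fun c => f c ≠ x)).card *
            (K * d x (partner C l f η x) ^ p) := by
          rw [Finset.sum_add_distrib, Finset.mul_sum, Finset.sum_const, nsmul_eq_mul]
      _ ≤ θ * ∑ c ∈ cluster C l (partner C l f η x), nearDist d L c ^ p +
          (η * (cluster C l (partner C l f η x)).card) * (K * d x (partner C l f η x) ^ p) := by
          refine add_le_add (mul_le_mul_of_nonneg_left ?_ hθ)
            (mul_le_mul_of_nonneg_right (isPair_partner hx).1.2 (mul_nonneg hK hδ))
          exact Finset.sum_le_sum_of_subset_of_nonneg (Finset.filter_subset _ _)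
            fun c _ _ => pow_nonneg hd.nearDist_nonneg p
      _ = _ := by ring
  refine (Finset.sum_le_sum h1).trans ?_
  rw [Finset.sum_add_distrib, ← Finset.mul_sum, ← Finset.mul_sum]
  have h2 := sum_paired_dist_le' (p := p) (C := C) hd hl hf hη
  have h3 : ∑ x ∈ pairedCenters C l f η T,
      ∑ c ∈ cluster C l (partner C l f η x), nearDist d L c ^ p ≤ clusterCost d p C L := by
    rw [← Finset.sum_image (g := partner C l f η)
      (f := fun y => ∑ c ∈ cluster C l y, nearDist d L c ^ p) (partner_injOn hη)]
    exact sum_cluster_le _ fun c _ => pow_nonneg hd.nearDist_nonneg p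
  have h4 := mul_le_mul_of_nonneg_left h2 (mul_nonneg hK hη0)
  have h5 := mul_le_mul_of_nonneg_left h3 hθ
  linarith

/-- Distance from a client to its center in `T` and from there to the partner. -/
noncomputable def throughDist (d : X → X → ℝ) (C : Finset X) (l f : X → X) (η : ℝ)
    (T : Finset X) (c : X) : ℝ :=
  nearDist d T c +
    if f c ∈ pairedCenters C l f η T then d (f c) (partner C l f η (f c)) else 0

lemma throughDist_nonneg (hd : IsPseudometric d) (c : X) : 0 ≤ throughDist d C l f η T c := by
  refine add_nonneg hd.nearDist_nonneg ?_
  split_ifs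
  · exact hd.nonneg _ _
  · exact le_rfl

lemma sum_ite_cluster {S : Finset X} {φ : X → X → ℝ} :
    ∑ c ∈ C, (if f c ∈ S then φ (f c) c else 0) = ∑ x ∈ S, ∑ c ∈ cluster C f x, φ x c := by
  rw [← Finset.sum_filter, ← Finset.sum_fiberwise_of_maps_to
    (g := f) (t := S) (fun c hc => (Finset.mem_filter.1 hc).2)]
  refine Finset.sum_congr rfl fun x hx => ?_
  have : (C.filter fun c => f c ∈ S).filter (fun c => f c = x) = cluster C f x := by
    ext c
    simp only [Finset.mem_filter, mem_cluster]
    exact ⟨fun h => ⟨h.1.1, h.2⟩, fun h => ⟨⟨h.1, h.2 ▸ hx⟩, h.2⟩⟩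
  rw [this]
  exact Finset.sum_congr rfl fun c hc => by rw [(mem_cluster.1 hc).2]

lemma sum_throughDist_le (hd : IsPseudometric d) (hl : IsNearest d L l)
    (hf : IsNearest d T f) (hη : η ≤ 1 / 4) :
    ∑ c ∈ C, throughDist d C l f η T c ^ p ≤
      2 ^ (2 * p + 2) * (clusterCost d p C L + clusterCost d p C T) := by
  have h1 : ∀ c ∈ C, throughDist d C l f η T c ^ p ≤ 2 ^ p * (nearDist d T c ^ p +
      if f c ∈ pairedCenters C l f η T then d (f c) (partner C l f η (f c)) ^ p else 0) := by
    intro c _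
    rw [throughDist]
    split_ifs
    · exact add_pow_le_two_pow hd.nearDist_nonneg (hd.nonneg _ _) p
    · rw [add_zero, add_zero]
      exact le_mul_of_one_le_left (pow_nonneg hd.nearDist_nonneg p) (one_le_pow₀ (by norm_num))
  refine (Finset.sum_le_sum h1).trans ?_
  rw [← Finset.mul_sum, Finset.sum_add_distrib, ← clusterCost_eq,
    sum_ite_cluster (φ := fun x _ => d x (partner C l f η x) ^ p)]
  simp only [Finset.sum_const, nsmul_eq_mul]
  have h2 := sum_paired_dist_le (p := p) (C := C) hd hl hf hη
  have hA := clusterCost_nonneg (p := p) (C := C) hd L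
  have hB := clusterCost_nonneg (p := p) (C := C) hd T
  have h3 : (1 : ℝ) ≤ 2 ^ (p + 1) := one_le_pow₀ (by norm_num)
  have h4 : clusterCost d p C T ≤
      2 ^ (p + 1) * (clusterCost d p C L + clusterCost d p C T) := by nlinarith
  calc _ ≤ (2 : ℝ) ^ p * (2 ^ (p + 1) * (clusterCost d p C L + clusterCost d p C T) +
        2 ^ (p + 1) * (clusterCost d p C L + clusterCost d p C T)) := by gcongr
    _ = _ := by rw [pow_add, pow_add, pow_mul']; ring

/-- Replacing values by their averages over clusters preserves the sum. -/
lemma sum_sum_cluster_div {φ : X → ℝ} :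
    ∑ c ∈ C, (∑ c' ∈ cluster C l (l c), φ c') / (cluster C l (l c)).card = ∑ c ∈ C, φ c := by
  simp only [Finset.sum_div]
  rw [Finset.sum_comm' (t' := C) (s' := fun c' => cluster C l (l c'))]
  · refine Finset.sum_congr rfl fun c' hc' => ?_
    have : ∀ c ∈ cluster C l (l c'), φ c' / (cluster C l (l c)).card =
        φ c' / (cluster C l (l c')).card := by
      intro c hc
      rw [(mem_cluster.1 hc).2]
    rw [Finset.sum_congr rfl this, Finset.sum_const, nsmul_eq_mul]
    have hpos : 0 < (cluster C l (l c')).card := Finset.card_pos.2 ⟨c', mem_cluster.2 ⟨hc', rfl⟩⟩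
    have hpos' : (0 : ℝ) < (cluster C l (l c')).card := by exact_mod_cast hpos
    field_simp
  · intro c c'
    simp only [mem_cluster]
    constructor
    · rintro ⟨h1, h2, h3⟩; exact ⟨⟨h1, h3.symm⟩, h2⟩
    · rintro ⟨⟨h1, h2⟩, h3⟩; exact ⟨h1, h3, h2.symm⟩

/-- Total cost of closing removable centers. -/
lemma sum_removable_le (hd : IsPseudometric d) (hl : IsNearest d L l)
    (hf : IsNearest d T f) (hη : η ≤ 1 / 4) (hη0 : 0 < η) {D : X → ℝ}
    (hD0 : ∀ x, 0 ≤ D x)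
    (hD : ∀ c ∈ C, ∀ c' ∈ C, l c' = l c → f c' ≠ f c →
      D (f c) ≤ nearDist d T c + nearDist d L c + nearDist d L c' + throughDist d C l f η T c') :
    η ^ 2 * ∑ x ∈ removableCenters C l f η T, ((cluster C f x).card : ℝ) * D x ^ p ≤
      2 ^ (4 * p + 3) * (clusterCost d p C L + clusterCost d p C T) := by
  let α : X → ℝ := fun c => nearDist d T c ^ p + nearDist d L c ^ p
  let β : X → ℝ := fun c => nearDist d L c ^ p + throughDist d C l f η T c ^ p
  have hα : ∀ c, 0 ≤ α c := fun c =>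
    add_nonneg (pow_nonneg hd.nearDist_nonneg p) (pow_nonneg hd.nearDist_nonneg p)
  have hβ : ∀ c, 0 ≤ β c := fun c =>
    add_nonneg (pow_nonneg hd.nearDist_nonneg p) (pow_nonneg (throughDist_nonneg hd c) p)
  let Z : X → ℝ := fun c =>
    4 ^ p * (α c + (∑ c' ∈ cluster C l (l c), β c') / (cluster C l (l c)).card)
  have hZ : ∀ c, 0 ≤ Z c := fun c => mul_nonneg (by positivity) (add_nonneg (hα c)
    (div_nonneg (Finset.sum_nonneg fun c' _ => hβ c') (Nat.cast_nonneg _)))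
  -- First average, costing one factor η: c is itself a common client, so failure of domination
  -- means that more than an η-fraction of the clients of `l c` have another center in `T`; each of
  -- them bounds `D`.
  have hfree : ∀ c ∈ C, ¬ Dominates C l f η (f c) (l c) → η * D (f c) ^ p ≤ Z c := by
    intro c hc hdom
    have hpos : 0 < (cluster C l (l c)).card := Finset.card_pos.2 ⟨c, mem_cluster.2 ⟨hc, rfl⟩⟩
    have hpos' : (0 : ℝ) < (cluster C l (l c)).card := by exact_mod_cast hpos
    have h1 : η * (cluster C l (l c)).card <
        ((cluster C l (l c)).filter fun c' => f c' ≠ f c).card := by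
      by_contra hcon
      exact hdom ⟨⟨c, hc, rfl, rfl⟩, not_lt.1 hcon⟩
    have h2 : (((cluster C l (l c)).filter fun c' => f c' ≠ f c).card : ℝ) * D (f c) ^ p ≤
        ∑ c' ∈ (cluster C l (l c)).filter (fun c' => f c' ≠ f c), 4 ^ p * (α c + β c') := by
      rw [← nsmul_eq_mul]
      refine Finset.card_nsmul_le_sum _ _ _ fun c' hc' => ?_
      obtain ⟨hc1, hc2⟩ := Finset.mem_filter.1 hc'
      obtain ⟨hc3, hc4⟩ := mem_cluster.1 hc1
      exact (pow_le_pow_left₀ (hD0 _) (hD c hc c' hc3 hc4 hc2) p).trans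
        (add_four_pow_le hd.nearDist_nonneg hd.nearDist_nonneg hd.nearDist_nonneg
          (throughDist_nonneg hd c') p)
    have h3 : ∑ c' ∈ (cluster C l (l c)).filter (fun c' => f c' ≠ f c), 4 ^ p * (α c + β c') ≤
        ∑ c' ∈ cluster C l (l c), 4 ^ p * (α c + β c') :=
      Finset.sum_le_sum_of_subset_of_nonneg (Finset.filter_subset _ _)
        fun c' _ _ => mul_nonneg (by positivity) (add_nonneg (hα c) (hβ c'))
    have h4 : ∑ c' ∈ cluster C l (l c), 4 ^ p * (α c + β c') =
        (cluster C l (l c)).card * Z c := by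
      rw [← Finset.mul_sum, Finset.sum_add_distrib, Finset.sum_const, nsmul_eq_mul]
      simp only [Z]
      field_simp
    have h5 := mul_le_mul_of_nonneg_right h1.le (pow_nonneg (hD0 (f c)) p)
    refine le_of_mul_le_mul_left ?_ hpos'
    linarith
  -- Second average and second factor η: removability supplies an η-fraction of clients of x to
  -- which the first average applies.
  have h1 : ∀ x ∈ removableCenters C l f η T,
      η ^ 2 * (((cluster C f x).card : ℝ) * D x ^ p) ≤ ∑ c ∈ cluster C f x, Z c := by
    intro x hx
    have h2 := (Finset.mem_filter.1 hx).2
    have h3 := mul_le_mul_of_nonneg_right h2 (mul_nonneg hη0.le (pow_nonneg (hD0 x) p))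
    have h4 : (((cluster C f x).filter fun c => ¬ Dominates C l f η x (l c)).card : ℝ) *
        (η * D x ^ p) ≤ ∑ c ∈ (cluster C f x).filter (fun c => ¬ Dominates C l f η x (l c)), Z c := by
      rw [← nsmul_eq_mul]
      refine Finset.card_nsmul_le_sum _ _ _ fun c hc => ?_
      obtain ⟨hc1, hc2⟩ := Finset.mem_filter.1 hc
      obtain ⟨hc3, rfl⟩ := mem_cluster.1 hc1
      exact hfree c hc3 hc2
    have h5 : ∑ c ∈ (cluster C f x).filter (fun c => ¬ Dominates C l f η x (l c)), Z c ≤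
        ∑ c ∈ cluster C f x, Z c :=
      Finset.sum_le_sum_of_subset_of_nonneg (Finset.filter_subset _ _) fun c _ _ => hZ c
    calc η ^ 2 * (((cluster C f x).card : ℝ) * D x ^ p) =
        η * (cluster C f x).card * (η * D x ^ p) := by ring
      _ ≤ _ := h3.trans (h4.trans h5)
  rw [Finset.mul_sum]
  refine (Finset.sum_le_sum h1).trans ((sum_cluster_le _ fun c _ => hZ c).trans ?_)
  simp only [Z]
  rw [← Finset.mul_sum, Finset.sum_add_distrib, sum_sum_cluster_div]
  simp only [α, β]
  rw [Finset.sum_add_distrib, Finset.sum_add_distrib, ← clusterCost_eq, ← clusterCost_eq]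
  have h6 := sum_throughDist_le (p := p) (C := C) hd hl hf hη
  have hA := clusterCost_nonneg (p := p) (C := C) hd L
  have hB := clusterCost_nonneg (p := p) (C := C) hd T
  have h7 : (2 : ℝ) ≤ 2 ^ (2 * p + 2) := by
    calc (2 : ℝ) = 2 ^ 1 := by norm_num
      _ ≤ _ := pow_le_pow_right₀ (by norm_num) (by omega)
  have h8 : clusterCost d p C T + clusterCost d p C L + clusterCost d p C L ≤
      2 ^ (2 * p + 2) * (clusterCost d p C L + clusterCost d p C T) := by nlinarith
  calc _ ≤ (4 : ℝ) ^ p * (2 ^ (2 * p + 2) * (clusterCost d p C L + clusterCost d p C T) +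
        2 ^ (2 * p + 2) * (clusterCost d p C L + clusterCost d p C T)) := by
        refine mul_le_mul_of_nonneg_left ?_ (by positivity)
        linarith
    _ = 4 ^ p * 2 ^ (2 * p + 3) * (clusterCost d p C L + clusterCost d p C T) := by
        rw [pow_succ]; ring
    _ = _ := by
        rw [show (4 : ℝ) = 2 ^ 2 by norm_num, ← pow_mul, ← pow_add]
        ring_nf

end PairCosts

/-! ### The intermediate solution and the exchange of pairs -/

section Intermediate
open scoped Classical

variable {X : Type u} {d : X → X → ℝ} {p k s : ℕ} {C L T : Finset X} {l f : X → X}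
  {η θ K κ ε : ℝ}

/-- Clients whose centers are both paired. -/
noncomputable def pairedClients (C : Finset X) (l f : X → X) (η : ℝ) (T : Finset X) : Finset X :=
  C.filter fun c => f c ∈ pairedCenters C l f η T ∧
    l c ∈ (pairedCenters C l f η T).image (partner C l f η)

/-- A cheap set of removable centers, each with a remaining center nearby. -/
lemma exists_removal (hd : IsPseudometric d) (hl : IsNearest d L l) (hf : IsNearest d T f)
    (hη : η ≤ 1 / 4) (hη0 : 0 < η) (hκ0 : 0 ≤ κ) (hκ : κ ≤ 1 / 6)
    (hκη : 6 * κ * 2 ^ (4 * p + 3) ≤ η ^ 3) :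
    ∃ (S₀ : Finset X) (D : X → ℝ), S₀ ⊆ removableCenters C l f η T ∧
      S₀.card = ⌊κ * (removableCenters C l f η T).card⌋₊ ∧ (∀ x, 0 ≤ D x) ∧
      (∀ x ∈ S₀, ∃ y ∈ (pairedCenters C l f η T).image (partner C l f η) ∪
        ((T \ pairedCenters C l f η T) \ S₀), d x y ≤ D x) ∧
      ∑ x ∈ S₀, ((cluster C f x).card : ℝ) * D x ^ p ≤
        η * (clusterCost d p C L + clusterCost d p C T) := by
  set P := pairedCenters C l f η T with hP
  set R := removableCenters C l f η T with hR
  have hE : 0 ≤ clusterCost d p C L + clusterCost d p C T :=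
    add_nonneg (clusterCost_nonneg hd L) (clusterCost_nonneg hd T)
  obtain ⟨m, hm⟩ : ∃ m, m = ⌊κ * R.card⌋₊ := ⟨_, rfl⟩
  have hmκ : (m : ℝ) ≤ κ * R.card := hm ▸ Nat.floor_le (by positivity)
  rw [← hm]
  rcases Nat.eq_zero_or_pos m with hm0 | hm0
  · exact ⟨∅, fun _ => 0, by simp, by simp [hm0], by simp, by simp, by simpa using mul_nonneg hη0.le hE⟩
  have hRcard : 6 ≤ R.card := by
    have h1 : (1 : ℝ) ≤ m := by exact_mod_cast hm0
    have h2 : (0 : ℝ) ≤ R.card := Nat.cast_nonneg _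
    have h3 : (6 : ℝ) ≤ R.card := by nlinarith
    exact_mod_cast h3
  have hRT : R ⊆ T \ P := Finset.filter_subset _ _
  -- Substitutes for a closed x are the partners, which always stay open, and the other unpaired
  -- centers of `T`.
  let N : X → Finset X := fun x => P.image (partner C l f η) ∪ (T \ P).erase x
  have hN : ∀ x, (N x).Nonempty := by
    intro x
    have h1 : 1 ≤ (R.erase x).card := by
      have := Finset.pred_card_le_card_erase (s := R) (a := x)
      omega
    obtain ⟨y, hy⟩ := Finset.card_pos.1 h1
    exact ⟨y, Finset.mem_union_right _ (Finset.erase_subset_erase x hRT hy)⟩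
  choose τ hτN hτ using fun x => (N x).exists_min_image (d x) (hN x)
  have hD : ∀ c ∈ C, ∀ c' ∈ C, l c' = l c → f c' ≠ f c →
      d (f c) (τ (f c)) ≤ nearDist d T c + nearDist d L c + nearDist d L c' +
        throughDist d C l f η T c' := by
    intro c _ c' _ hll hff
    have h1 : ∃ y ∈ N (f c), d c' y ≤ throughDist d C l f η T c' := by
      by_cases h : f c' ∈ P
      · refine ⟨partner C l f η (f c'),
          Finset.mem_union_left _ (Finset.mem_image_of_mem _ h), ?_⟩
        rw [throughDist, if_pos h, ← hf.eq]
        exact hd.tri _ _ _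
      · refine ⟨f c', Finset.mem_union_right _ (Finset.mem_erase.2
          ⟨hff, Finset.mem_sdiff.2 ⟨hf.mem c', h⟩⟩), ?_⟩
        rw [throughDist, if_neg h, ← hf.eq, add_zero]
    obtain ⟨y, hy, hyd⟩ := h1
    have h2 := hτ (f c) y hy
    have h3 := hd.tri (f c) c y
    have h4 := hd.tri c (l c) y
    have h5 := hd.tri (l c) c' y
    have h6 := hf.eq c
    have h7 := hl.eq c
    have h8 := hl.eq c'
    rw [hd.symm] at h6
    rw [hll, hd.symm] at h8
    linarith
  have hW := sum_removable_le (p := p) hd hl hf hη hη0 (D := fun x => d x (τ x))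
    (fun x => hd.nonneg _ _) hD
  -- Independence under τ ensures that the substitute of a closed center is not closed itself.
  obtain ⟨A, hAR, hAc, hA⟩ := exists_indep_of_map τ _ R rfl
  have hmA : 2 * m ≤ A.card := by
    have h1 : (R.card : ℝ) ≤ 3 * A.card := by exact_mod_cast hAc
    have h2 : 6 * (m : ℝ) ≤ R.card := by
      have : (0 : ℝ) ≤ R.card := Nat.cast_nonneg _
      nlinarith
    have h3 : 2 * (m : ℝ) ≤ A.card := by linarith
    exact_mod_cast h3
  have hWnn : ∀ x, 0 ≤ ((cluster C f x).card : ℝ) * d x (τ x) ^ p := fun x =>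
    mul_nonneg (Nat.cast_nonneg _) (pow_nonneg (hd.nonneg _ _) p)
  obtain ⟨S₀, hSA, hSm, hSW⟩ := exists_cheap_subset
    (W := fun x => ((cluster C f x).card : ℝ) * d x (τ x) ^ p) (fun x _ => hWnn x) hmA
  refine ⟨S₀, fun x => d x (τ x), hSA.trans hAR, hSm, fun x => hd.nonneg _ _, ?_, ?_⟩
  · intro x hx
    refine ⟨τ x, ?_, le_rfl⟩
    rcases Finset.mem_union.1 (hτN x) with h | h
    · exact Finset.mem_union_left _ h
    · obtain ⟨h1, h2⟩ := Finset.mem_erase.1 h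
      exact Finset.mem_union_right _ (Finset.mem_sdiff.2
        ⟨h2, fun h3 => h1 (hA x (hSA hx) (hSA h3))⟩)
  · obtain ⟨w, hw⟩ : ∃ w, w = ∑ x ∈ R, ((cluster C f x).card : ℝ) * d x (τ x) ^ p := ⟨_, rfl⟩
    obtain ⟨v, hv⟩ : ∃ v, v = ∑ x ∈ S₀, ((cluster C f x).card : ℝ) * d x (τ x) ^ p := ⟨_, rfl⟩
    rw [← hw] at hW
    rw [← hv]
    have hw0 : 0 ≤ w := hw ▸ Finset.sum_nonneg fun x _ => hWnn x
    have h1 : ∑ x ∈ A, ((cluster C f x).card : ℝ) * d x (τ x) ^ p ≤ w :=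
      hw ▸ Finset.sum_le_sum_of_subset_of_nonneg hAR fun x _ _ => hWnn x
    have h2 : (A.card : ℝ) * v ≤ 2 * m * w := by
      rw [hv]
      exact hSW.trans (mul_le_mul_of_nonneg_left h1 (by positivity))
    have h3 : (R.card : ℝ) ≤ 3 * A.card := by exact_mod_cast hAc
    have hA0 : (0 : ℝ) < A.card := by exact_mod_cast (by omega : 0 < A.card)
    -- The factor 6 is 3 for the independent set times 2 for the cheap subset.
    have h4 : v ≤ 6 * κ * w := by
      refine le_of_mul_le_mul_left ?_ hA0
      have h5 : (m : ℝ) ≤ 3 * κ * A.card := by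
        have := mul_le_mul_of_nonneg_left h3 hκ0
        linarith
      have := mul_le_mul_of_nonneg_right h5 hw0
      linarith
    have h5 : η ^ 2 * v ≤ η ^ 2 * (η * (clusterCost d p C L + clusterCost d p C T)) := by
      calc η ^ 2 * v ≤ η ^ 2 * (6 * κ * w) := by gcongr
        _ = 6 * κ * (η ^ 2 * w) := by ring
        _ ≤ 6 * κ * (2 ^ (4 * p + 3) * (clusterCost d p C L + clusterCost d p C T)) := by gcongr
        _ = 6 * κ * 2 ^ (4 * p + 3) * (clusterCost d p C L + clusterCost d p C T) := by ring
        _ ≤ η ^ 3 * (clusterCost d p C L + clusterCost d p C T) := by gcongr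
        _ = _ := by ring
    exact le_of_mul_le_mul_left h5 (by positivity)

/-- A solution between `L` and `T` with the partners of the paired centers and the unpaired centers
of `T`, some of which are closed. -/
lemma exists_intermediate (hd : IsPseudometric d) (hl : IsNearest d L l) (hf : IsNearest d T f)
    (hη : η ≤ 1 / 4) (hη0 : 0 < η) (hκ0 : 0 ≤ κ) (hκ : κ ≤ 1 / 6)
    (hκη : 6 * κ * 2 ^ (4 * p + 3) ≤ η ^ 3) (hθ : 0 ≤ θ) (hK : 0 ≤ K)
    (hpow : ∀ u v : ℝ, 0 ≤ u → 0 ≤ v → (u + v) ^ p ≤ (1 + θ) * u ^ p + K * v ^ p)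
    (hT : T.Nonempty) (hTL : T.card ≤ L.card) :
    ∃ (M : Finset X) (ρ : ℕ), M.Nonempty ∧ M.card + ⌊κ * ρ⌋₊ ≤ T.card ∧
      ((L \ M) ∪ (M \ L)).card + 4 * T.card ≤ 4 * (L.card + ρ) ∧
      ∑ c ∈ C \ pairedClients C l f η T, (nearDist d L c ^ p - (1 + θ) * nearDist d T c ^ p) -
        K * η * 2 ^ (p + 2) * (clusterCost d p C L + clusterCost d p C T) ≤
        clusterCost d p C L - clusterCost d p C M := by
  obtain ⟨S₀, D, hS₀, hS₀c, hD0, hD, hDsum⟩ :=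
    exists_removal (p := p) (C := C) hd hl hf hη hη0 hκ0 hκ hκη
  have hcount := card_paired_add_le (C := C) (f := f) (T := T) hη hl.mem
  set P := pairedCenters C l f η T with hP
  set R := removableCenters C l f η T with hR
  set Q := P.image (partner C l f η) with hQ
  have hPT : P ⊆ T := Finset.filter_subset _ _
  have hRT : R ⊆ T \ P := Finset.filter_subset _ _
  have hQL : Q ⊆ L := Finset.image_subset_iff.2 fun x hx => partner_mem hl.mem hx
  have hQc : Q.card = P.card := Finset.card_image_of_injOn (partner_injOn hη)
  have hPc := Finset.card_sdiff_add_card_eq_card hPT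
  have hRc := Finset.card_sdiff_add_card_eq_card hRT
  have hSc := Finset.card_sdiff_add_card_eq_card (hS₀.trans hRT)
  have hSR := Finset.card_le_card hS₀
  obtain ⟨M, hM⟩ : ∃ M, M = Q ∪ ((T \ P) \ S₀) := ⟨_, rfl⟩
  have hMc : M.card ≤ Q.card + ((T \ P) \ S₀).card := hM ▸ Finset.card_union_le _ _
  have hQM : Q ⊆ M := hM ▸ Finset.subset_union_left
  have hLTnn : 0 ≤ clusterCost d p C L + clusterCost d p C T :=
    add_nonneg (clusterCost_nonneg hd L) (clusterCost_nonneg hd T)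
  refine ⟨M, R.card, ?_, ?_, ?_, ?_⟩
  · rcases P.eq_empty_or_nonempty with h | h
    · have h1 : S₀.card < T.card := by
        have h2 : T \ P = T := by rw [h, Finset.sdiff_empty]
        have h3 : R.card ≤ T.card := Finset.card_le_card (h2 ▸ hRT)
        have h4 : (S₀.card : ℝ) ≤ κ * R.card := hS₀c ▸ Nat.floor_le (by positivity)
        have h5 : (R.card : ℝ) ≤ T.card := by exact_mod_cast h3
        have h6 : (0 : ℝ) < T.card := by exact_mod_cast hT.card_pos
        have h7 : (S₀.card : ℝ) < T.card := by
          have : (0 : ℝ) ≤ R.card := Nat.cast_nonneg _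
          nlinarith
        exact_mod_cast h7
      have h2 : 0 < ((T \ P) \ S₀).card := by
        rw [h, Finset.card_empty] at hPc
        rw [h] at hSc ⊢
        omega
      obtain ⟨x, hx⟩ := Finset.card_pos.1 h2
      exact ⟨x, hM ▸ Finset.mem_union_right _ hx⟩
    · exact (h.image _).mono hQM
  · rw [← hS₀c]; omega
  -- Partners lie in both `L` and `M`, so at most |L| + |T| − 2|P| elements differ; twice `hcount`
  -- together with |T| ≤ |L| gives the claim.
  · have h1 : (L \ M).card ≤ L.card - Q.card := by
      rw [← Finset.card_sdiff_of_subset hQL]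
      exact Finset.card_le_card (Finset.sdiff_subset_sdiff (Finset.Subset.refl L) hQM)
    have h2 : (M \ L).card ≤ ((T \ P) \ S₀).card := by
      refine Finset.card_le_card fun x hx => ?_
      obtain ⟨h3, h4⟩ := Finset.mem_sdiff.1 hx
      rw [hM] at h3
      exact (Finset.mem_union.1 h3).resolve_left fun h => h4 (hQL h)
    have h3 := Finset.card_union_le (L \ M) (M \ L)
    have h4 := Finset.card_le_card hQL
    omega
  -- A paired client keeps `l c`. Any other client uses `f c` if it survives, else the partner or
  -- the substitute of `f c`; the last two cases give the error terms with factor K.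
  · have hnear : ∀ c, nearDist d M c ^ p ≤
        (if c ∈ pairedClients C l f η T then nearDist d L c ^ p
          else (1 + θ) * nearDist d T c ^ p) +
        ((if f c ∈ P then (if l c ≠ partner C l f η (f c) then
            K * d (f c) (partner C l f η (f c)) ^ p else 0) else 0) +
          if f c ∈ S₀ then K * D (f c) ^ p else 0) ∨ c ∉ C := by
      intro c
      by_cases hcC : c ∈ C
      swap
      · exact Or.inr hcC
      left
      have hb : 0 ≤ nearDist d T c ^ p := pow_nonneg hd.nearDist_nonneg p
      have hθb : nearDist d T c ^ p ≤ (1 + θ) * nearDist d T c ^ p := by nlinarith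
      have hterm1 : 0 ≤ (if f c ∈ P then (if l c ≠ partner C l f η (f c) then
            K * d (f c) (partner C l f η (f c)) ^ p else 0) else 0) := by
        split_ifs
        · exact mul_nonneg hK (pow_nonneg (hd.nonneg _ _) p)
        · exact le_rfl
        · exact le_rfl
      have hterm2 : 0 ≤ (if f c ∈ S₀ then K * D (f c) ^ p else 0) := by
        split_ifs
        · exact mul_nonneg hK (pow_nonneg (hD0 _) p)
        · exact le_rfl
      by_cases hc : c ∈ pairedClients C l f η T
      · rw [if_pos hc]
        obtain ⟨-, -, h1⟩ := Finset.mem_filter.1 hc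
        have h2 : nearDist d M c ≤ nearDist d L c := hl.eq c ▸ nearDist_le (hQM h1)
        have := pow_le_pow_left₀ hd.nearDist_nonneg h2 p
        linarith
      · rw [if_neg hc]
        by_cases hcP : f c ∈ P
        · have hne : l c ≠ partner C l f η (f c) := fun h => hc (Finset.mem_filter.2
            ⟨hcC, hcP, h ▸ Finset.mem_image_of_mem _ hcP⟩)
          rw [if_pos hcP, if_pos hne]
          have h2 : nearDist d M c ≤ nearDist d T c + d (f c) (partner C l f η (f c)) := by
            rw [← hf.eq]
            exact (nearDist_le (hQM (Finset.mem_image_of_mem _ hcP))).trans (hd.tri _ _ _)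
          have h3 := pow_le_pow_left₀ hd.nearDist_nonneg h2 p
          have h4 := hpow _ _ (hd.nearDist_nonneg (S := T) (c := c))
            (hd.nonneg (f c) (partner C l f η (f c)))
          linarith
        · by_cases hcS : f c ∈ S₀
          · rw [if_pos hcS]
            obtain ⟨y, hy, hyD⟩ := hD (f c) hcS
            have h2 : nearDist d M c ≤ nearDist d T c + D (f c) := by
              rw [← hf.eq]
              refine (nearDist_le (hM ▸ hy)).trans ((hd.tri _ (f c) _).trans ?_)
              linarith
            have h3 := pow_le_pow_left₀ hd.nearDist_nonneg h2 p
            have h4 := hpow _ _ (hd.nearDist_nonneg (S := T) (c := c)) (hD0 (f c))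
            linarith
          · have h2 : nearDist d M c ≤ nearDist d T c := by
              rw [← hf.eq]
              exact nearDist_le (hM ▸ Finset.mem_union_right _ (Finset.mem_sdiff.2
                ⟨Finset.mem_sdiff.2 ⟨hf.mem c, hcP⟩, hcS⟩))
            have h3 := pow_le_pow_left₀ hd.nearDist_nonneg h2 p
            linarith
    have hsum : clusterCost d p C M ≤
        ∑ c ∈ C, ((if c ∈ pairedClients C l f η T then nearDist d L c ^ p
          else (1 + θ) * nearDist d T c ^ p) +
        ((if f c ∈ P then (if l c ≠ partner C l f η (f c) then
            K * d (f c) (partner C l f η (f c)) ^ p else 0) else 0) +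
          if f c ∈ S₀ then K * D (f c) ^ p else 0)) := by
      rw [clusterCost_eq]
      exact Finset.sum_le_sum fun c hc => (hnear c).resolve_right fun h => h hc
    rw [Finset.sum_add_distrib, Finset.sum_add_distrib,
      sum_ite_cluster (S := P) (φ := fun x c => if l c ≠ partner C l f η x then
            K * d x (partner C l f η x) ^ p else 0),
      sum_ite_cluster (S := S₀) (φ := fun x _ => K * D x ^ p)] at hsum
    -- Only clients of x that do not use the partner in `L` pay here, an η-fraction of the cluster.
    have e1 : ∑ x ∈ P, ∑ c ∈ cluster C f x, (if l c ≠ partner C l f η x then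
            K * d x (partner C l f η x) ^ p else 0) ≤
        K * η * (2 ^ (p + 1) * (clusterCost d p C L + clusterCost d p C T)) := by
      refine le_trans ?_ (mul_le_mul_of_nonneg_left
        (sum_paired_dist_le (p := p) (C := C) hd hl hf hη) (mul_nonneg hK hη0.le))
      rw [Finset.mul_sum]
      refine Finset.sum_le_sum fun x hx => ?_
      rw [← Finset.sum_filter, Finset.sum_const, nsmul_eq_mul]
      have h1 := (isPair_partner hx).2.2
      have h2 : 0 ≤ K * d x (partner C l f η x) ^ p :=
        mul_nonneg hK (pow_nonneg (hd.nonneg _ _) p)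
      have h3 := mul_le_mul_of_nonneg_right h1 h2
      linarith
    have e2 : ∑ x ∈ S₀, ∑ c ∈ cluster C f x, K * D x ^ p ≤
        K * (η * (clusterCost d p C L + clusterCost d p C T)) := by
      refine le_trans (le_of_eq ?_) (mul_le_mul_of_nonneg_left hDsum hK)
      rw [Finset.mul_sum]
      refine Finset.sum_congr rfl fun x _ => ?_
      rw [Finset.sum_const, nsmul_eq_mul]
      ring
    have hsub : pairedClients C l f η T ⊆ C := Finset.filter_subset _ _
    have e3 : ∑ c ∈ C, (if c ∈ pairedClients C l f η T then nearDist d L c ^ p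
          else (1 + θ) * nearDist d T c ^ p) =
        ∑ c ∈ pairedClients C l f η T, nearDist d L c ^ p +
        ∑ c ∈ C \ pairedClients C l f η T, (1 + θ) * nearDist d T c ^ p := by
      rw [← Finset.sum_sdiff hsub, add_comm]
      congr 1
      · exact Finset.sum_congr rfl fun c hc => if_pos hc
      · exact Finset.sum_congr rfl fun c hc => if_neg (Finset.mem_sdiff.1 hc).2
    have e4 : clusterCost d p C L = ∑ c ∈ pairedClients C l f η T, nearDist d L c ^ p +
        ∑ c ∈ C \ pairedClients C l f η T, nearDist d L c ^ p := by
      rw [clusterCost_eq, ← Finset.sum_sdiff hsub, add_comm]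
    rw [e3] at hsum
    rw [Finset.sum_sub_distrib]
    have e5 : K * η * (clusterCost d p C L + clusterCost d p C T) ≤
        K * η * (2 ^ (p + 1) * (clusterCost d p C L + clusterCost d p C T)) := by
      refine mul_le_mul_of_nonneg_left ?_ (mul_nonneg hK hη0.le)
      exact le_mul_of_one_le_left hLTnn (one_le_pow₀ (by norm_num))
    have e6 : K * η * 2 ^ (p + 2) * (clusterCost d p C L + clusterCost d p C T) =
        2 * (K * η * (2 ^ (p + 1) * (clusterCost d p C L + clusterCost d p C T))) := by
      rw [pow_succ]; ring
    linarith

/-- Exchanging groups of pairs at a local optimum. -/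
lemma LocallyOptimal.sum_pairedClients_le (hopt : LocallyOptimal d p C k s ε L)
    (hd : IsPseudometric d) (hl : IsNearest d L l) (hf : IsNearest d T f)
    (hη : η ≤ 1 / 4) (hL : L.Nonempty) (hLk : L.card ≤ k) {q : ℕ} (hq : 0 < q)
    (hs : 2 * (q + 1) ≤ s) :
    ∃ t : ℕ, t * q ≤ T.card + q ∧
      ∑ c ∈ pairedClients C l f η T, (nearDist d L c ^ p - nearDist d T c ^ p) -
        ∑ x ∈ pairedCenters C l f η T,
          ∑ c ∈ (cluster C l (partner C l f η x)).filter (fun c => f c ≠ x),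
            ((nearDist d L c + d x (partner C l f η x)) ^ p - nearDist d L c ^ p) ≤
      t * (ε / C.card * clusterCost d p C L) := by
  set P := pairedCenters C l f η T with hP
  -- Exchanging pairs does not increase the number of centers, so all weights are 0 and the grouping
  -- only controls sizes.
  obtain ⟨𝓖, h1, h2, h3, h4⟩ := exists_grouping (e := fun _ : X => 0) (r := 0) hq _ P rfl
    (by simp) (by simp)
  let S : Finset X → Finset X := fun J => (L \ J.image (partner C l f η)) ∪ J
  have hPT : P ⊆ T := Finset.filter_subset _ _
  let g : X → X → ℝ := fun x c =>
    (nearDist d L c + d x (partner C l f η x)) ^ p - nearDist d L c ^ p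
  have hg : ∀ x c, 0 ≤ g x c := fun x c => sub_nonneg.2
    (pow_le_pow_left₀ hd.nearDist_nonneg (by linarith [hd.nonneg x (partner C l f η x)]) p)
  have himg : ∀ J ⊆ P, J.image (partner C l f η) ⊆ L := fun J hJ =>
    Finset.image_subset_iff.2 fun x hx => partner_mem hl.mem (hJ hx)
  have himgc : ∀ J ⊆ P, (J.image (partner C l f η)).card = J.card := fun J hJ =>
    Finset.card_image_of_injOn ((partner_injOn hη).mono (Finset.coe_subset.2 hJ))
  refine ⟨𝓖.card, h4.trans (Nat.add_le_add_right (Finset.card_le_card hPT) q), le_trans ?_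
    (hopt.sum_gain_le 𝓖 S fun J hJ => ⟨?_, ?_, ?_⟩)⟩
  · let loss : X → X → ℝ := fun x c => if l c = partner C l f η x ∧ f c ≠ x then g x c else 0
    have hloss : ∀ x c, 0 ≤ loss x c := fun x c => by
      simp only [loss]; split_ifs
      · exact hg x c
      · exact le_rfl
    -- A client that loses `l c` = partner of x without being a client of x may be rerouted via `l
    -- c` to x. A client of x losing this partner is a paired client, so it is covered by the gain.
    have key : ∀ c ∈ C, ∀ J ∈ 𝓖,
        (if f c ∈ J ∧ c ∈ pairedClients C l f η T then
          nearDist d L c ^ p - nearDist d T c ^ p else 0) - ∑ x ∈ J, loss x c ≤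
        nearDist d L c ^ p - nearDist d (S J) c ^ p := by
      intro c hc J hJ
      have hJP := (h1 J hJ).1
      have hlossJ : 0 ≤ ∑ x ∈ J, loss x c := Finset.sum_nonneg fun x _ => hloss x c
      split_ifs with h
      · have h5 : nearDist d (S J) c ≤ nearDist d T c := by
          rw [← hf.eq]; exact nearDist_le (Finset.mem_union_right _ h.1)
        have := pow_le_pow_left₀ hd.nearDist_nonneg h5 p
        linarith
      · by_cases hlc : l c ∈ J.image (partner C l f η)
        · obtain ⟨x, hx, hxl⟩ := Finset.mem_image.1 hlc
          have hfx : f c ≠ x := by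
            rintro rfl
            exact h ⟨hx, Finset.mem_filter.2 ⟨hc, hJP hx, Finset.image_subset_image hJP hlc⟩⟩
          have h5 : nearDist d (S J) c ≤ nearDist d L c + d x (partner C l f η x) := by
            refine (nearDist_le (Finset.mem_union_right _ hx)).trans ((hd.tri c (l c) x).trans ?_)
            rw [hl.eq, hd.symm (l c) x, hxl]
          have h6 := pow_le_pow_left₀ hd.nearDist_nonneg h5 p
          have h7 : loss x c ≤ ∑ x ∈ J, loss x c :=
            Finset.single_le_sum (fun x _ => hloss x c) hx
          have h8 : loss x c = g x c := if_pos ⟨hxl.symm, hfx⟩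
          simp only [h8, g] at h7
          linarith
        · have h5 : nearDist d (S J) c ≤ nearDist d L c := by
            rw [← hl.eq]
            exact nearDist_le (Finset.mem_union_left _ (Finset.mem_sdiff.2 ⟨hl.mem c, hlc⟩))
          have := pow_le_pow_left₀ hd.nearDist_nonneg h5 p
          linarith
    have hUnion : 𝓖.biUnion id = P := by
      ext x
      simp only [Finset.mem_biUnion, id]
      exact ⟨fun ⟨J, hJ, hx⟩ => (h1 J hJ).1 hx, fun hx => h2 x hx⟩
    have hdisj : Set.PairwiseDisjoint (𝓖 : Set (Finset X)) id := by
      intro J hJ J' hJ' hne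
      rw [Function.onFun, Finset.disjoint_left]
      intro x hx hx'
      exact hne (h3 J hJ J' hJ' x hx hx')
    have hC : ∀ c ∈ C, (if c ∈ pairedClients C l f η T then
          nearDist d L c ^ p - nearDist d T c ^ p else 0) - ∑ x ∈ P, loss x c ≤
        ∑ J ∈ 𝓖, (nearDist d L c ^ p - nearDist d (S J) c ^ p) := by
      intro c hc
      refine le_trans (le_of_eq ?_) (Finset.sum_le_sum fun J hJ => key c hc J hJ)
      rw [Finset.sum_sub_distrib, ← hUnion, Finset.sum_biUnion hdisj]
      congr 1
      by_cases hcp : c ∈ pairedClients C l f η T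
      · obtain ⟨J, hJ, hcJ⟩ := h2 (f c) (Finset.mem_filter.1 hcp).2.1
        rw [if_pos hcp, Finset.sum_eq_single_of_mem J hJ, if_pos ⟨hcJ, hcp⟩]
        intro J' hJ' hne
        exact if_neg fun h => hne (h3 J' hJ' J hJ _ h.1 hcJ)
      · rw [if_neg hcp]
        exact (Finset.sum_eq_zero fun J _ => if_neg fun h => hcp h.2).symm
    refine le_trans (le_of_eq ?_) (Finset.sum_le_sum hC)
    rw [eq_comm, Finset.sum_sub_distrib, ← Finset.sum_filter, Finset.sum_comm, eq_comm]
    congr 1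
    · refine Finset.sum_congr ?_ fun _ _ => rfl
      ext c
      rw [Finset.mem_filter]
      exact ⟨fun h => ⟨(Finset.mem_filter.1 h).1, h⟩, fun h => h.2⟩
    · refine Finset.sum_congr rfl fun x _ => ?_
      rw [← Finset.sum_filter]
      refine Finset.sum_congr ?_ fun _ _ => rfl
      ext c
      simp only [Finset.mem_filter, mem_cluster]
      tauto
  · rcases J.eq_empty_or_nonempty with rfl | h
    · simpa [S] using hL
    · exact h.mono Finset.subset_union_right
  · have h5 := Finset.card_union_le (L \ J.image (partner C l f η)) J
    have h6 := Finset.card_sdiff_add_card_eq_card (himg J (h1 J hJ).1)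
    have h7 := himgc J (h1 J hJ).1
    simp only [S]
    omega
  · have h5 : (L \ S J).card ≤ (J.image (partner C l f η)).card := by
      refine Finset.card_le_card fun x hx => ?_
      obtain ⟨h6, h7⟩ := Finset.mem_sdiff.1 hx
      by_contra h8
      exact h7 (Finset.mem_union_left _ (Finset.mem_sdiff.2 ⟨h6, h8⟩))
    have h6 : (S J \ L).card ≤ J.card := by
      refine Finset.card_le_card fun x hx => ?_
      obtain ⟨h6, h7⟩ := Finset.mem_sdiff.1 hx
      exact (Finset.mem_union.1 h6).resolve_left fun h => h7 (Finset.mem_sdiff.1 h).1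
    have h7 := himgc J (h1 J hJ).1
    have h8 := (h1 J hJ).2.1
    omega

end Intermediate

/-! ### Combination of the bounds and choice of parameters -/

section MainBound
open scoped Classical

/-- Let x = θ/2^p. If v ≤ xu, then (1 + x)^p ≤ 1 + (2^p − 1)x ≤ 1 + θ suffices; otherwise u and v
are both at most v/x and the second term suffices. -/
lemma add_pow_le_one_add_mul {θ u v : ℝ} (p : ℕ) (hθ : 0 < θ) (hθ1 : θ ≤ 1) (hu : 0 ≤ u)
    (hv : 0 ≤ v) : (u + v) ^ p ≤ (1 + θ) * u ^ p + (2 * 2 ^ p / θ) ^ p * v ^ p := by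
  have h2 : (1 : ℝ) ≤ 2 ^ p := one_le_pow₀ (by norm_num)
  obtain ⟨x, hx⟩ : ∃ x, x = θ / 2 ^ p := ⟨_, rfl⟩
  have hx0 : 0 < x := hx ▸ by positivity
  have hxθ : 2 ^ p * x = θ := by rw [hx]; field_simp
  have hx1 : x ≤ 1 := by nlinarith
  have hbern : ∀ m : ℕ, (1 + x) ^ m ≤ 1 + (2 ^ m - 1) * x := by
    intro m
    induction m with
    | zero => simp
    | succ m ih =>
      have h1 : (1 : ℝ) ≤ 2 ^ m := one_le_pow₀ (by norm_num)
      have h3 : ((2 : ℝ) ^ m - 1) * x * x ≤ (2 ^ m - 1) * x * 1 :=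
        mul_le_mul_of_nonneg_left hx1 (mul_nonneg (by linarith) hx0.le)
      calc (1 + x) ^ (m + 1) = (1 + x) ^ m * (1 + x) := pow_succ _ _
        _ ≤ (1 + (2 ^ m - 1) * x) * (1 + x) := by gcongr
        _ ≤ _ := by rw [pow_succ]; linarith
  have hup : 0 ≤ u ^ p := pow_nonneg hu p
  have hvp : 0 ≤ v ^ p := pow_nonneg hv p
  rcases le_total v (x * u) with h | h
  · have h1 : (u + v) ^ p ≤ (1 + θ) * u ^ p := by
      calc (u + v) ^ p ≤ ((1 + x) * u) ^ p := pow_le_pow_left₀ (by positivity) (by linarith) p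
        _ = (1 + x) ^ p * u ^ p := mul_pow _ _ _
        _ ≤ (1 + θ) * u ^ p := by
          gcongr
          have := hbern p
          linarith
    have h3 : 0 ≤ (2 * 2 ^ p / θ) ^ p * v ^ p := by positivity
    linarith
  · have hxx : 2 * 2 ^ p / θ = 2 / x := by rw [hx]; field_simp
    have h1 : (u + v) ^ p ≤ (2 * 2 ^ p / θ) ^ p * v ^ p := by
      rw [hxx, ← mul_pow]
      refine pow_le_pow_left₀ (by positivity) ?_ p
      have h3 : u ≤ 1 / x * v := by
        rw [one_div_mul_eq_div, le_div_iff₀ hx0]; linarith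
      have h4 : v ≤ 1 / x * v := le_mul_of_one_le_left hv (by rwa [le_div_iff₀ hx0, one_mul])
      calc u + v ≤ 1 / x * v + 1 / x * v := add_le_add h3 h4
        _ = 2 / x * v := by ring
    have h3 : 0 ≤ (1 + θ) * u ^ p := by positivity
    linarith

variable {X : Type u} {d : X → X → ℝ} {p k s : ℕ} {C L T : Finset X} {ε : ℝ}

/-- A local optimum of positive cost has exactly `k` centers, fewer than there are clients. -/
lemma LocallyOptimal.card_eq (hopt : LocallyOptimal d p C k s ε L) (hd : IsPseudometric d)
    (hp : 0 < p) (hL : L.Nonempty) (hLk : L.card ≤ k) (hpos : 0 < clusterCost d p C L)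
    (hε1 : ε < 1) (hs : 2 ≤ s) : L.card = k ∧ k < C.card := by
  obtain ⟨l, hl⟩ := exists_isNearest (d := d) hL
  have hC : C.Nonempty := by
    by_contra h
    rw [Finset.not_nonempty_iff_eq_empty] at h
    simp [clusterCost, h] at hpos
  obtain ⟨c, hc, hmax⟩ := C.exists_max_image (fun c => nearDist d L c ^ p) hC
  have hn : (0 : ℝ) < C.card := by exact_mod_cast hC.card_pos
  have havg : clusterCost d p C L ≤ C.card * nearDist d L c ^ p := by
    rw [clusterCost_eq, ← nsmul_eq_mul]
    exact Finset.sum_le_card_nsmul _ _ _ hmax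
  -- A client c of largest cost pays at least cost(`L`)/n, more than the threshold. A nearby
  -- solution that contains c and hurts nobody else would contradict optimality.
  have key : ∀ S : Finset X, c ∈ S → (∀ c' ∈ C, c' ≠ c → l c' ∈ S) → S.card ≤ k →
      (L \ S).card + (S \ L).card ≤ s → False := by
    intro S hcS hS hSk hSs
    have h1 := hopt S ⟨c, hcS⟩ hSk hSs
    have h2 : clusterCost d p C S ≤ clusterCost d p C L - nearDist d L c ^ p := by
      rw [clusterCost_eq, clusterCost_eq, ← Finset.add_sum_erase _ _ hc,
        ← Finset.add_sum_erase C (fun c => nearDist d L c ^ p) hc]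
      have h3 : nearDist d S c = 0 :=
        le_antisymm ((nearDist_le hcS).trans (hd.self c).le) hd.nearDist_nonneg
      have h4 : ∑ c' ∈ C.erase c, nearDist d S c' ^ p ≤ ∑ c' ∈ C.erase c, nearDist d L c' ^ p := by
        refine Finset.sum_le_sum fun c' hc' => pow_le_pow_left₀ hd.nearDist_nonneg ?_ p
        obtain ⟨h5, h6⟩ := Finset.mem_erase.1 hc'
        rw [← hl.eq c']
        exact nearDist_le (hS c' h6 h5)
      rw [h3, zero_pow hp.ne']
      linarith
    have h5 : clusterCost d p C L * (1 / C.card) ≤ nearDist d L c ^ p := by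
      rw [mul_one_div, div_le_iff₀ hn]; linarith
    have h6 : ε / C.card * clusterCost d p C L < 1 / C.card * clusterCost d p C L := by
      gcongr
    linarith
  have hk : L.card = k := by
    by_contra hne
    refine key (insert c L) (Finset.mem_insert_self _ _)
      (fun c' _ _ => Finset.mem_insert_of_mem (hl.mem c')) ?_ ?_
    · have := Finset.card_insert_le c L
      omega
    · have h1 : L \ insert c L = ∅ := Finset.sdiff_eq_empty_iff_subset.2 (Finset.subset_insert _ _)
      have h2 : (insert c L \ L).card ≤ ({c} : Finset X).card := by
        refine Finset.card_le_card fun x hx => ?_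
        obtain ⟨h3, h4⟩ := Finset.mem_sdiff.1 hx
        exact Finset.mem_singleton.2 ((Finset.mem_insert.1 h3).resolve_right h4)
      rw [h1]
      simp at h2 ⊢
      omega
  refine ⟨hk, ?_⟩
  by_contra hle
  -- If k ≥ n, the n − 1 other clients cannot occupy all k centers, so an idle one can be moved to
  -- c.
  have hex : ∃ x ∈ L, x ∉ (C.erase c).image l := by
    by_contra! hcon
    have h1 := Finset.card_le_card (show L ⊆ (C.erase c).image l from hcon)
    have h2 := Finset.card_image_le (s := C.erase c) (f := l)
    have h3 := Finset.card_erase_lt_of_mem hc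
    omega
  obtain ⟨x, hx, hxl⟩ := hex
  refine key (insert c (L.erase x)) (Finset.mem_insert_self _ _) (fun c' hc' hne => ?_) ?_ ?_
  · refine Finset.mem_insert_of_mem (Finset.mem_erase.2 ⟨fun h => hxl ?_, hl.mem c'⟩)
    exact h ▸ Finset.mem_image_of_mem l (Finset.mem_erase.2 ⟨hne, hc'⟩)
  · have h1 := Finset.card_insert_le c (L.erase x)
    have h2 := Finset.card_erase_lt_of_mem hx
    omega
  · have h1 : (L \ insert c (L.erase x)).card ≤ ({x} : Finset X).card := by
      refine Finset.card_le_card fun y hy => ?_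
      obtain ⟨h3, h4⟩ := Finset.mem_sdiff.1 hy
      by_contra h5
      exact h4 (Finset.mem_insert_of_mem (Finset.mem_erase.2
        ⟨fun h => h5 (Finset.mem_singleton.2 h), h3⟩))
    have h2 : (insert c (L.erase x) \ L).card ≤ ({c} : Finset X).card := by
      refine Finset.card_le_card fun y hy => ?_
      obtain ⟨h3, h4⟩ := Finset.mem_sdiff.1 hy
      refine Finset.mem_singleton.2 ((Finset.mem_insert.1 h3).resolve_right fun h => h4 ?_)
      exact (Finset.mem_erase.1 h).2
    simp only [Finset.card_singleton] at h1 h2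
    omega

/-- Parameters of the analysis of local search for accuracy `ε`. -/
structure Parameters (p h : ℕ) (ε θ K η κ : ℝ) (r s : ℕ) : Prop where
  ε_pos : 0 < ε
  ε_lt : ε < 1 / 2
  θ_nonneg : 0 ≤ θ
  θ_le : θ ≤ ε / 16
  K_nonneg : 0 ≤ K
  pow_le : ∀ u v : ℝ, 0 ≤ u → 0 ≤ v → (u + v) ^ p ≤ (1 + θ) * u ^ p + K * v ^ p
  η_pos : 0 < η
  η_le : η ≤ 1 / 4
  η_small : K * η * 2 ^ (p + 2) ≤ ε / 16
  κ_pos : 0 < κ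
  κ_le : κ ≤ 1 / 6
  κ_small : 6 * κ * 2 ^ (4 * p + 3) ≤ η ^ 3
  r_large : 5 * (40 * sepConst h / (κ / 32)) ^ 4 ≤ (r : ℝ)
  s_large : (128 + 4 * r + 1) * r ≤ s
  s_ge : 258 ≤ s
  s_large' : 8 / κ ≤ (s : ℝ)

variable {V : Type u} [Fintype V] {G : SimpleGraph V} {w : Sym2 V → ℝ} {C L M T : Finset V}
  {h r : ℕ} {θ K η κ : ℝ}

/-- Few exchanges: their number times the threshold is small. -/
lemma mul_threshold_le {t n : ℕ} {ε A : ℝ} (hn : 32 ≤ n) (ht : t * 128 ≤ 4 * n + 128)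
    (hε : 0 < ε) (hA : 0 ≤ A) : (t : ℝ) * (ε / n * A) ≤ ε / 16 * A := by
  have hn' : (32 : ℝ) ≤ n := by exact_mod_cast hn
  have ht' : (t : ℝ) * 128 ≤ 4 * n + 128 := by exact_mod_cast ht
  have h1 : (t : ℝ) / n ≤ 1 / 16 := by
    rw [div_le_div_iff₀ (by linarith) (by norm_num)]
    linarith
  calc (t : ℝ) * (ε / n * A) = (t / n) * (ε * A) := by ring
    _ ≤ 1 / 16 * (ε * A) := by gcongr
    _ = _ := by ring

/-- Shared vertices cost at most 4(κ/32)|F| = κ|F|/8 centers, while `hMT` and `hF` save at least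
κ|F|/4 − 1, the 1 coming from the floor. The balance is nonpositive once |F| ≥ 8/κ, which |F| > s
guarantees; for |F| ≤ s a single exchange leads to `M`. -/
lemma Parameters.cost_sub_le (P : Parameters p h ε θ K η κ r s)
    (hH : ∀ B : Fin h → Set V, ¬ CliqueModel G B)
    (hG : G.Connected) (hw : ∀ e ∈ G.edgeSet, 0 ≤ w e)
    (hopt : LocallyOptimal (shortestPathDist G w) p C k s ε L) (hL : L.Nonempty)
    (hLk : L.card = k) (hkn : k < C.card) (hn : 32 ≤ C.card) (hTk : T.card ≤ k)
    (hM : M.Nonempty) {ρ : ℕ} (hMT : M.card + ⌊κ * ρ⌋₊ ≤ T.card)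
    (hF : ((L \ M) ∪ (M \ L)).card + 4 * T.card ≤ 4 * (L.card + ρ)) :
    clusterCost (shortestPathDist G w) p C L - clusterCost (shortestPathDist G w) p C M ≤
      ε / 16 * clusterCost (shortestPathDist G w) p C L := by
  have hd := isPseudometric_shortestPathDist hG hw
  have hA := clusterCost_nonneg (p := p) (C := C) hd L
  have hdisj : Disjoint (L \ M) (M \ L) := by
    rw [Finset.disjoint_left]
    intro v h1 h2
    exact (Finset.mem_sdiff.1 h2).2 (Finset.mem_sdiff.1 h1).1
  by_cases hFs : ((L \ M) ∪ (M \ L)).card ≤ s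
  · have h1 := hopt M hM (by omega) (by rwa [← Finset.card_union_of_disjoint hdisj])
    have h2 := mul_threshold_le (t := 1) hn (by omega) P.ε_pos hA
    push_cast at h2
    linarith
  · have hκ := P.κ_pos
    have hκ1 := P.κ_le
    have hne : ((L \ M) ∪ (M \ L)).Nonempty := Finset.card_pos.1 (by omega)
    obtain ⟨𝓡, e, S, ρ', hE⟩ := exists_exchangeSystem hH hG hw hL hM hne
      (δ := κ / 32) (by positivity) (by linarith) P.r_large
    have hsum : ∑ R ∈ 𝓡, e R ≤ 0 := by
      have h1 := hE.sum_le
      have h2 : (M.card : ℝ) + ⌊κ * ρ⌋₊ ≤ T.card := by exact_mod_cast hMT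
      have h3 : κ * ρ < ⌊κ * ρ⌋₊ + 1 := Nat.lt_floor_add_one _
      have h4 : (((L \ M) ∪ (M \ L)).card : ℝ) + 4 * T.card ≤ 4 * (L.card + ρ) := by
        exact_mod_cast hF
      have h5 : (T.card : ℝ) ≤ L.card := by exact_mod_cast hLk ▸ hTk
      have h6 : (s : ℝ) ≤ ((L \ M) ∪ (M \ L)).card := by
        exact_mod_cast (not_le.1 hFs).le
      have h7 : 8 ≤ κ * ((L \ M) ∪ (M \ L)).card := by
        have := P.s_large'.trans h6
        rwa [div_le_iff₀ hκ, mul_comm] at this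
      have h8 := mul_le_mul_of_nonneg_left h4 hκ.le
      have h9 : κ * ((L.card : ℝ) - T.card) ≤ 1 * (L.card - T.card) :=
        mul_le_mul_of_nonneg_right (by linarith) (by linarith)
      have h10 : ((∑ R ∈ 𝓡, e R : ℤ) : ℝ) ≤ 0 := by linarith
      exact_mod_cast h10
    obtain ⟨t, ht, hle⟩ := hopt.cost_sub_le_of_exchangeSystem hd hE hLk hsum
      (q := 128) (by norm_num) P.s_large
    -- The number of regions is at most 2|F| ≤ 4k < 4n.
    refine hle.trans (mul_threshold_le hn ?_ P.ε_pos hA)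
    have h1 := hE.card_le
    have h2 := Finset.card_union_le (L \ M) (M \ L)
    have h3 : (L \ M).card ≤ L.card := Finset.card_le_card Finset.sdiff_subset
    have h4 : (M \ L).card ≤ M.card := Finset.card_le_card Finset.sdiff_subset
    omega

/-- Quality of local optima. -/
lemma Parameters.clusterCost_le (P : Parameters p h ε θ K η κ r s) (hp : 0 < p)
    (hH : ∀ B : Fin h → Set V, ¬ CliqueModel G B)
    (hG : G.Connected) (hw : ∀ e ∈ G.edgeSet, 0 ≤ w e)
    (hopt : LocallyOptimal (shortestPathDist G w) p C k s ε L) (hL : L.Nonempty)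
    (hLk : L.card ≤ k) (hT : T.Nonempty) (hTk : T.card ≤ k) :
    clusterCost (shortestPathDist G w) p C L ≤
      (1 + ε) * clusterCost (shortestPathDist G w) p C T := by
  have hd := isPseudometric_shortestPathDist hG hw
  have hA := clusterCost_nonneg (p := p) (C := C) hd L
  have hB := clusterCost_nonneg (p := p) (C := C) hd T
  have hε := P.ε_pos
  have hε1 := P.ε_lt
  have hs := P.s_ge
  rcases hA.eq_or_lt with h0 | hpos
  · rw [← h0]; positivity
  obtain ⟨hLk, hkn⟩ := hopt.card_eq hd hp hL hLk hpos (by linarith) (by omega)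
  by_cases hn : 32 ≤ C.card
  · obtain ⟨l, hl⟩ := exists_isNearest (d := shortestPathDist G w) hL
    obtain ⟨f, hf⟩ := exists_isNearest (d := shortestPathDist G w) hT
    obtain ⟨M, ρ, hM, hMT, hF, hcost⟩ := exists_intermediate (p := p) (C := C) hd hl hf P.η_le
      P.η_pos P.κ_pos.le P.κ_le P.κ_small P.θ_nonneg P.K_nonneg P.pow_le hT (hLk ▸ hTk)
    have h1 := P.cost_sub_le hH hG hw hopt hL hLk hkn hn hTk hM hMT hF
    obtain ⟨t, ht, h2⟩ := hopt.sum_pairedClients_le (η := η) hd hl hf P.η_le hL hLk.le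
      (q := 128) (by norm_num) (by omega)
    have h3 := h2.trans (mul_threshold_le hn (by omega) hε hA)
    have h4 := sum_reroute_le (p := p) (C := C) hd hl hf P.η_le P.η_pos.le P.θ_nonneg P.K_nonneg
      P.pow_le
    set d := shortestPathDist G w
    have hsub : pairedClients C l f η T ⊆ C := Finset.filter_subset _ _
    have h5 : clusterCost d p C L - (1 + θ) * clusterCost d p C T ≤
        ∑ c ∈ C \ pairedClients C l f η T, (nearDist d L c ^ p - (1 + θ) * nearDist d T c ^ p) +
        ∑ c ∈ pairedClients C l f η T, (nearDist d L c ^ p - nearDist d T c ^ p) := by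
      rw [clusterCost_eq, clusterCost_eq, Finset.mul_sum, ← Finset.sum_sub_distrib,
        ← Finset.sum_sdiff hsub]
      refine add_le_add le_rfl (Finset.sum_le_sum fun c _ => ?_)
      have := mul_nonneg P.θ_nonneg (pow_nonneg (hd.nearDist_nonneg (S := T) (c := c)) p)
      linarith
    have hE : 0 ≤ clusterCost d p C L + clusterCost d p C T := by linarith
    have h6 : K * η * 2 ^ (p + 2) * (clusterCost d p C L + clusterCost d p C T) ≤
        ε / 16 * (clusterCost d p C L + clusterCost d p C T) :=
      mul_le_mul_of_nonneg_right P.η_small hE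
    have h7 : K * η * 2 ^ (p + 1) * (clusterCost d p C L + clusterCost d p C T) ≤
        K * η * 2 ^ (p + 2) * (clusterCost d p C L + clusterCost d p C T) := by
      refine mul_le_mul_of_nonneg_right (mul_le_mul_of_nonneg_left ?_
        (mul_nonneg P.K_nonneg P.η_pos.le)) hE
      exact pow_le_pow_right₀ (by norm_num) (by omega)
    have h8 := mul_le_mul_of_nonneg_right P.θ_le hA
    have h9 := mul_le_mul_of_nonneg_right P.θ_le hB
    -- Five errors of ε/16 fall on cost(`L`): two thresholds, the rerouting term θ, and the two
    -- K-terms. The K-terms and the factor 1 + θ give three on cost(`T`).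
    have h10 : (1 - 5 * ε / 16) * clusterCost d p C L ≤
        (1 + 3 * ε / 16) * clusterCost d p C T := by linarith
    have h11 : (1 + 3 * ε / 16) ≤ (1 - 5 * ε / 16) * (1 + ε) := by nlinarith
    refine le_of_mul_le_mul_left ?_ (by linarith : 0 < 1 - 5 * ε / 16)
    refine h10.trans ?_
    calc _ ≤ (1 - 5 * ε / 16) * (1 + ε) * clusterCost d p C T := mul_le_mul_of_nonneg_right h11 hB
      _ = _ := by ring
  -- Here k < n < 32, so `T` differs from `L` in fewer than 64 ≤ s elements.
  · have h1 : (L \ T).card ≤ L.card := Finset.card_le_card Finset.sdiff_subset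
    have h2 : (T \ L).card ≤ T.card := Finset.card_le_card Finset.sdiff_subset
    have h3 := hopt T hT hTk (by omega)
    have hC2 : (2 : ℝ) ≤ C.card := by
      have := hL.card_pos
      exact_mod_cast (by omega : 2 ≤ C.card)
    have h4 : ε / C.card ≤ ε / 2 := by gcongr
    have h5 := mul_le_mul_of_nonneg_right h4 hA
    have h6 : (1 - ε / 2) * clusterCost (shortestPathDist G w) p C L ≤
        clusterCost (shortestPathDist G w) p C T := by linarith
    refine le_of_mul_le_mul_left ?_ (by linarith : 0 < 1 - ε / 2)
    refine h6.trans ?_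
    rw [← mul_assoc]
    exact le_mul_of_one_le_left hB (by nlinarith)

/-- Polynomially many exchanged centers suffice. -/
lemma exists_parameters (p h : ℕ) : ∃ c : ℕ, ∀ ε : ℝ, 0 < ε → ε < 1 / 2 →
    ∃ θ K η κ r, Parameters p h ε θ K η κ r ⌊1 / ε ^ c⌋₊ := by
  -- With x = 1/ε ≥ 2, numerical constants are absorbed into powers of x. K is at most x^(p(p+6)), η
  -- = ε^a compensates K·2^(p+2)·16/ε, κ = ε^b compensates 6·2^(4p+3)/η³, r is about x^e, and s must
  -- exceed a multiple of r².
  obtain ⟨a, ha⟩ : ∃ a, a = p * (p + 6) + p + 7 := ⟨_, rfl⟩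
  obtain ⟨b, hb⟩ : ∃ b, b = 3 * a + 4 * p + 6 := ⟨_, rfl⟩
  obtain ⟨e, he⟩ : ∃ e, e = 3 + 4 * (11 + sepConst h + b) := ⟨_, rfl⟩
  refine ⟨2 * e + 10, fun ε hε hε1 => ?_⟩
  obtain ⟨x, hx⟩ : ∃ x, x = 1 / ε := ⟨_, rfl⟩
  have hx2 : 2 ≤ x := by rw [hx, le_div_iff₀ hε]; linarith
  have hx0 : 0 < x := by linarith
  have hxε : x * ε = 1 := by rw [hx]; field_simp
  have hxεn : ∀ n : ℕ, x ^ n * ε ^ n = 1 := fun n => by rw [← mul_pow, hxε, one_pow]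
  have h2x : ∀ n : ℕ, (2 : ℝ) ^ n ≤ x ^ n := fun n => pow_le_pow_left₀ (by norm_num) hx2 n
  have hmono : ∀ m n : ℕ, m ≤ n → x ^ m ≤ x ^ n := fun m n hmn =>
    pow_le_pow_right₀ (by linarith) hmn
  have hεmono : ∀ m n : ℕ, m ≤ n → ε ^ n ≤ ε ^ m := fun m n hmn =>
    pow_le_pow_of_le_one hε.le (by linarith) hmn
  have hεsq : ε ^ 2 ≤ 1 / 4 := by nlinarith
  have hK : (2 * 2 ^ p / (ε / 16)) ^ p ≤ x ^ (p * (p + 6)) := by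
    rw [mul_comm p, pow_mul]
    refine pow_le_pow_left₀ (by positivity) ?_ p
    calc (2 : ℝ) * 2 ^ p / (ε / 16) = 2 ^ (p + 5) * x := by
          rw [hx, pow_add]; field_simp; norm_num
      _ ≤ x ^ (p + 5) * x := by gcongr
      _ = x ^ (p + 6) := (pow_succ _ _).symm
  obtain ⟨r, hr⟩ : ∃ r, r = ⌈x ^ e⌉₊ := ⟨_, rfl⟩
  have hxe1 : 1 ≤ x ^ e := one_le_pow₀ (by linarith)
  have hre : x ^ e ≤ r := hr ▸ Nat.le_ceil _
  have hr2 : (2 : ℝ) ≤ r := by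
    refine le_trans ?_ hre
    calc (2 : ℝ) ≤ x ^ 1 := by simpa using hx2
      _ ≤ x ^ e := hmono _ _ (by omega)
  have hr2' : 2 ≤ r := by exact_mod_cast hr2
  have hrle : (r : ℝ) ≤ x ^ (e + 1) := by
    have h1 : (r : ℝ) < x ^ e + 1 := hr ▸ Nat.ceil_lt_add_one (by linarith)
    rw [pow_succ]
    nlinarith
  have hs : (128 + 4 * r + 1) * r ≤ ⌊1 / ε ^ (2 * e + 10)⌋₊ := by
    refine Nat.le_floor ?_
    have h1 : 1 / ε ^ (2 * e + 10) = x ^ (2 * e + 10) := by rw [hx, one_div_pow]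
    rw [h1]
    push_cast
    calc (128 + 4 * (r : ℝ) + 1) * r ≤ (2 ^ 8 * r) * r := by
          gcongr; linarith
      _ ≤ (x ^ 8 * x ^ (e + 1)) * x ^ (e + 1) := by
          gcongr
      _ = x ^ (2 * e + 10) := by rw [← pow_add, ← pow_add]; congr 1; ring
  have hsr : r ≤ ⌊1 / ε ^ (2 * e + 10)⌋₊ := by
    refine le_trans ?_ hs
    exact Nat.le_mul_of_pos_left _ (by omega)
  refine ⟨ε / 16, (2 * 2 ^ p / (ε / 16)) ^ p, ε ^ a, ε ^ b, r, hε, hε1, by positivity, le_rfl,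
    by positivity, fun u v hu hv => add_pow_le_one_add_mul p (by positivity) (by linarith) hu hv,
    by positivity, (hεmono 2 a (by omega)).trans hεsq, ?_, by positivity, ?_, ?_, ?_, hs, ?_, ?_⟩
  · have h1 : (2 * 2 ^ p / (ε / 16)) ^ p * 2 ^ (p + 2) * 16 ≤ x ^ (p * (p + 6) + p + 6) := by
      calc (2 * 2 ^ p / (ε / 16)) ^ p * 2 ^ (p + 2) * 16 =
          (2 * 2 ^ p / (ε / 16)) ^ p * 2 ^ (p + 6) := by
            rw [pow_add 2 p 6, pow_add 2 p 2]; ring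
        _ ≤ x ^ (p * (p + 6)) * x ^ (p + 6) := by
            gcongr
        _ = _ := by rw [← pow_add]; congr 1
    have h2 : x ^ (p * (p + 6) + p + 6) * ε ^ a = ε := by
      rw [ha, pow_succ ε, ← mul_assoc, hxεn, one_mul]
    have h3 := mul_le_mul_of_nonneg_right h1 (by positivity : 0 ≤ ε ^ a)
    rw [h2] at h3
    linarith
  · refine (hεmono 3 b (by omega)).trans ?_
    calc ε ^ 3 ≤ (1 / 2) ^ 3 := pow_le_pow_left₀ hε.le hε1.le 3
      _ ≤ 1 / 6 := by norm_num
  · have h1 : (6 : ℝ) * 2 ^ (4 * p + 3) ≤ x ^ (4 * p + 6) := by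
      calc (6 : ℝ) * 2 ^ (4 * p + 3) ≤ 2 ^ 3 * 2 ^ (4 * p + 3) := by gcongr; norm_num
        _ = 2 ^ (4 * p + 6) := by rw [← pow_add]; congr 1; ring
        _ ≤ _ := h2x _
    have h2 : x ^ (4 * p + 6) * ε ^ b = (ε ^ a) ^ 3 := by
      rw [hb, add_assoc, pow_add ε, mul_left_comm, hxεn, mul_one, ← pow_mul, mul_comm a]
    have h3 := mul_le_mul_of_nonneg_right h1 (by positivity : 0 ≤ ε ^ b)
    linarith
  · refine le_trans ?_ hre
    have h1 : (40 : ℝ) * sepConst h / (ε ^ b / 32) ≤ x ^ (11 + sepConst h + b) := by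
      have h2 : (sepConst h : ℝ) ≤ 2 ^ sepConst h := by
        exact_mod_cast (Nat.lt_two_pow_self (n := sepConst h)).le
      have h3 : (1 : ℝ) / ε ^ b = x ^ b := by rw [hx, one_div_pow]
      calc (40 : ℝ) * sepConst h / (ε ^ b / 32) = 1280 * sepConst h * (1 / ε ^ b) := by
            field_simp; ring
        _ ≤ 2 ^ 11 * 2 ^ sepConst h * (1 / ε ^ b) := by gcongr; norm_num
        _ ≤ x ^ 11 * x ^ sepConst h * x ^ b := by
            rw [h3]
            have := h2x 11
            have := h2x (sepConst h)
            gcongr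
        _ = _ := by rw [← pow_add, ← pow_add]
    calc 5 * (40 * (sepConst h : ℝ) / (ε ^ b / 32)) ^ 4 ≤
        2 ^ 3 * (x ^ (11 + sepConst h + b)) ^ 4 := by gcongr; norm_num
      _ ≤ x ^ 3 * (x ^ (11 + sepConst h + b)) ^ 4 := by gcongr
      _ = x ^ e := by rw [← pow_mul, ← pow_add, he]; congr 1; ring
  · refine le_trans ?_ hs
    nlinarith
  · have h1 : (8 : ℝ) / ε ^ b ≤ x ^ (3 + b) := by
      have h3 : (1 : ℝ) / ε ^ b = x ^ b := by rw [hx, one_div_pow]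
      calc (8 : ℝ) / ε ^ b = 2 ^ 3 * (1 / ε ^ b) := by ring
        _ ≤ x ^ 3 * x ^ b := by rw [h3]; gcongr
        _ = _ := (pow_add _ _ _).symm
    refine h1.trans ((hmono _ _ (by omega)).trans (hre.trans ?_))
    exact_mod_cast hsr

end MainBound

/-! ### Runs of local search and the theorem -/

/-- Strict decrease of the cost forbids repetitions among finitely many sets. -/
lemma localSearchTerminates {X : Type u} [Finite X] [DecidableEq X] (cost : Finset X → ℝ)
    (n k s : ℕ) (ε : ℝ) : LocalSearchTerminates cost n k s ε := by
  rintro ⟨run, -, hrun⟩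
  have : StrictAnti fun i => cost (run i) := strictAnti_nat_of_succ_lt fun i => (hrun i).decrease
  exact not_injective_infinite_finite run (Function.Injective.of_comp (f := cost) this.injective)

lemma IsLocalSearchOutput.isSolution {X : Type u} [DecidableEq X] {cost : Finset X → ℝ}
    {n k s : ℕ} {ε : ℝ} {S : Finset X} (hk : 0 < k) (h : IsLocalSearchOutput cost n k s ε S) :
    IsSolution k S := by
  obtain ⟨⟨S₀, hS₀, hrun⟩, -⟩ := h
  rcases Relation.ReflTransGen.cases_tail hrun with h | ⟨S', -, h⟩
  · rw [h]
    exact ⟨Finset.card_pos.1 (hS₀ ▸ hk), hS₀.le⟩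
  · exact h.solution

lemma IsLocalSearchOutput.locallyOptimal {X : Type u} [DecidableEq X] {d : X → X → ℝ}
    (hd : IsPseudometric d) {p k s : ℕ} {C S : Finset X} {ε : ℝ} (hε : 0 ≤ ε)
    (h : IsLocalSearchOutput (clusterCost d p C) C.card k s ε S) :
    LocallyOptimal d p C k s ε S := by
  intro S' hne hcard hnear
  by_contra! hlt
  have h1 := clusterCost_nonneg (p := p) (C := C) hd S
  have h2 : 0 ≤ ε / C.card * clusterCost d p C S := by positivity
  refine h.2 S' ⟨⟨hne, hcard⟩, ?_, hlt.le, by linarith⟩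
  convert hnear

theorem mainTheorem1 (K : GraphFamily.{u}) (hK : MinorClosed K) (hK' : NontrivialFamily K)
    (p : ℕ) (hp : 0 < p) :
    ∃ c : ℕ, ∀ ε : ℝ, 0 < ε → ε < 1 / 2 →
      ∀ (V : Type u) [Fintype V] [DecidableEq V] (G : SimpleGraph V), K V G → G.Connected →
      ∀ w : Sym2 V → ℝ, (∀ e ∈ G.edgeSet, 0 ≤ w e) →
      ∀ (C : Finset V) (k : ℕ), 0 < k →
        LocalSearchTerminates (clusterCost (shortestPathDist G w) p C) C.card k
            ⌊1 / ε ^ c⌋₊ ε ∧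
        ∀ S : Finset V,
          IsLocalSearchOutput (clusterCost (shortestPathDist G w) p C) C.card k
            ⌊1 / ε ^ c⌋₊ ε S →
          IsSolution k S ∧
          ∀ T : Finset V, IsSolution k T →
            clusterCost (shortestPathDist G w) p C S
              ≤ (1 + ε) * clusterCost (shortestPathDist G w) p C T := by
  obtain ⟨h, hh⟩ := exists_excluded_cliqueModel K hK hK'
  obtain ⟨c, hc⟩ := exists_parameters p h
  refine ⟨c, fun ε hε hε1 V _ _ G hKG hG w hw C k hk =>
    ⟨localSearchTerminates _ _ _ _ _, fun S hS => ⟨hS.isSolution hk, fun T hT => ?_⟩⟩⟩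
  obtain ⟨θ, K', η, κ, r, P⟩ := hc ε hε hε1
  have hd := isPseudometric_shortestPathDist hG hw
  have hsol := hS.isSolution hk
  exact P.clusterCost_le hp (hh V G hKG hG) hG hw (hS.locallyOptimal hd hε.le) hsol.1 hsol.2
    hT.1 hT.2
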